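/- Let $F$ be an algebraically closed field of characteristic different from $2$, and let $p,q\in F^\times$ be elements that are not roots of unity. For $n\ge 1$ let $\mathcal H_n$ be the affine Hecke algebra of type $B_n$: the associative unital $F$-algebra generated by $X_0^{\pm1},\dots,X_n^{\pm1},T_0,\dots,T_{n-1}$, where the $X_j$ commute with each other, subject to $(T_0-p)(T_0+p^{-1})=0$; $(T_i-q)(T_i+q^{-1})=0$ for $i\ge1$; $T_iT_{i+1}T_i=T_{i+1}T_iT_{i+1}$ for $i\ge1$; $T_iT_j=T_jT_i$ for $|i-j|>1$; $T_1T_0T_1T_0=T_0T_1T_0T_1$; $T_0X_0T_0=X_0X_1$; $T_iX_j=X_jT_i$ for $j\ne i,i+1$; and $T_iX_iT_i=X_{i+1}$ for $i\ge1$. Put $\mathcal H_0=F[X_0^{\pm1}]$. Let $\tau$ be the anti-automorphism of $\mathcal H_n$ that fixes every $T_i$ and every $X_j$. For a finite-dimensional left $\mathcal H_n$-module $N$ let $N^\tau$ be the dual space $\operatorname{Hom}_F(N,F)$ with the left action $(hf)(m)=f(\tau(h)m)$. For $n\ge1$ and $a\in F^\times$, let $\mathcal H_{n-1,1}\cong\mathcal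 H_{n-1}\otimes_F F[X_n^{\pm1}]$ be the subalgebra of $\mathcal H_n$ generated by $T_0,\dots,T_{n-2}$ and $X_0^{\pm1},\dots,X_n^{\pm1}$. For a finite-dimensional $\mathcal H_{n-1}$-module $N$ let $N\boxtimes(a)$ be the $\mathcal H_{n-1,1}$-module $N$ on which $X_n$ acts as the scalar $a$, and set $$f_aN=\mathcal H_n\otimes_{\mathcal H_{n-1,1}}\bigl(N\boxtimes(a)\bigr).$$ The cosocle of a module is its largest semisimple quotient. **Corollary.** Let $n\ge1$, let $a\in\{1,-1\}$, and let $N$ be a finite-dimensional irreducible $\mathcal H_{n-1}$-module with $N\cong N^\tau$. Then either $f_aN$ has an irreducible cosocle, or $f_aN$ is the direct sum of two non-isomorphic irreducible $\mathcal H_n$-modules. -/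

import Mathlib

open scoped TensorProduct LaurentPolynomial

/-- Generators of the affine Hecke algebra of type `B_n`:
`T_0, …, T_{n-1}`, `X_0, …, X_n` and the inverses of the `X_j`. -/
inductive HeckeGen (n : ℕ) : Type
  | T (i : Fin n) : HeckeGen n
  | X (j : Fin (n + 1)) : HeckeGen n
  | Xinv (j : Fin (n + 1)) : HeckeGen n

namespace HeckeGen

variable (F : Type*) [Field F] {n : ℕ}

/-- The generator `T_i` in the free algebra. -/
def t (i : Fin n) : FreeAlgebra F (HeckeGen n) := FreeAlgebra.ι F (HeckeGen.T i)

/-- The generator `X_j` in the free algebra. -/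
def x (j : Fin (n + 1)) : FreeAlgebra F (HeckeGen n) := FreeAlgebra.ι F (HeckeGen.X j)

/-- The generator `X_j⁻¹` in the free algebra. -/
def y (j : Fin (n + 1)) : FreeAlgebra F (HeckeGen n) := FreeAlgebra.ι F (HeckeGen.Xinv j)

end HeckeGen

open HeckeGen in
/-- Defining relations of the affine Hecke algebra of type `B_n` with parameters `p`, `q`.
In the mixed relations `i.castSucc` and `i.succ` are the indices `i` and `i + 1`. -/
inductive HeckeRel {F : Type*} [Field F] (p q : Fˣ) (n : ℕ) :
    FreeAlgebra F (HeckeGen n) → FreeAlgebra F (HeckeGen n) → Prop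
  | quad_zero (i : Fin n) (hi : i.val = 0) :
      HeckeRel p q n
        ((t F i - algebraMap F _ (p : F)) * (t F i + algebraMap F _ (p : F)⁻¹)) 0
  | quad_pos (i : Fin n) (hi : 1 ≤ i.val) :
      HeckeRel p q n
        ((t F i - algebraMap F _ (q : F)) * (t F i + algebraMap F _ (q : F)⁻¹)) 0
  | braid (i j : Fin n) (hi : 1 ≤ i.val) (hij : j.val = i.val + 1) :
      HeckeRel p q n (t F i * t F j * t F i) (t F j * t F i * t F j)
  | far (i j : Fin n) (hij : i.val + 1 < j.val) :
      HeckeRel p q n (t F i * t F j) (t F j * t F i)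
  | braid_zero (i j : Fin n) (hi : i.val = 0) (hj : j.val = 1) :
      HeckeRel p q n (t F j * t F i * t F j * t F i) (t F i * t F j * t F i * t F j)
  | lattice_comm (j k : Fin (n + 1)) : HeckeRel p q n (x F j * x F k) (x F k * x F j)
  | lattice_mul_inv (j : Fin (n + 1)) : HeckeRel p q n (x F j * y F j) 1
  | lattice_inv_mul (j : Fin (n + 1)) : HeckeRel p q n (y F j * x F j) 1
  | mixed_zero (i : Fin n) (hi : i.val = 0) :
      HeckeRel p q n (t F i * x F i.castSucc * t F i) (x F i.castSucc * x F i.succ)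
  | mixed_comm (i : Fin n) (j : Fin (n + 1)) (h₁ : j ≠ i.castSucc) (h₂ : j ≠ i.succ) :
      HeckeRel p q n (t F i * x F j) (x F j * t F i)
  | mixed_pos (i : Fin n) (hi : 1 ≤ i.val) :
      HeckeRel p q n (t F i * x F i.castSucc * t F i) (x F i.succ)

/-- The affine Hecke algebra `H_n` of type `B_n` with parameters `p`, `q`
(for `n = 0` this is `F[X_0, X_0⁻¹]`). -/
def HeckeB {F : Type*} [Field F] (p q : Fˣ) (n : ℕ) : Type _ := RingQuot (HeckeRel p q n)

namespace HeckeB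

variable {F : Type*} [Field F] {p q : Fˣ} {n : ℕ}

instance : Ring (HeckeB p q n) := inferInstanceAs (Ring (RingQuot (HeckeRel p q n)))

instance : Algebra F (HeckeB p q n) := inferInstanceAs (Algebra F (RingQuot (HeckeRel p q n)))

variable (p q n) in
/-- The projection from the free algebra. -/
def mk : FreeAlgebra F (HeckeGen n) →ₐ[F] HeckeB p q n :=
  RingQuot.mkAlgHom F (HeckeRel p q n)

theorem mk_rel {u v : FreeAlgebra F (HeckeGen n)} (h : HeckeRel p q n u v) :
    mk p q n u = mk p q n v :=
  RingQuot.mkAlgHom_rel F h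

variable (p q) in
/-- `T_i ∈ H_n`. -/
def T (i : Fin n) : HeckeB p q n := mk p q n (HeckeGen.t F i)

variable (p q) in
/-- `X_j ∈ H_n`, as a unit. -/
def X (j : Fin (n + 1)) : (HeckeB p q n)ˣ where
  val := mk p q n (HeckeGen.x F j)
  inv := mk p q n (HeckeGen.y F j)
  val_inv := by
    rw [← map_mul, mk_rel (HeckeRel.lattice_mul_inv j), map_one]
  inv_val := by
    rw [← map_mul, mk_rel (HeckeRel.lattice_inv_mul j), map_one]

/-- The universal property of `H_n`: an algebra map is given by images `τ i`, `ξ j` of the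
`T_i`, `X_j` that satisfy the defining relations. -/
def lift {A : Type*} [Ring A] [Algebra F A] (τ : Fin n → A) (ξ : Fin (n + 1) → Aˣ)
    (quad_zero : ∀ i : Fin n, i.val = 0 →
      (τ i - algebraMap F A p) * (τ i + algebraMap F A (p : F)⁻¹) = 0)
    (quad_pos : ∀ i : Fin n, 1 ≤ i.val →
      (τ i - algebraMap F A q) * (τ i + algebraMap F A (q : F)⁻¹) = 0)
    (braid : ∀ i j : Fin n, 1 ≤ i.val → j.val = i.val + 1 → τ i * τ j * τ i = τ j * τ i * τ j)
    (far : ∀ i j : Fin n, i.val + 1 < j.val → τ i * τ j = τ j * τ i)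
    (braid_zero : ∀ i j : Fin n, i.val = 0 → j.val = 1 →
      τ j * τ i * τ j * τ i = τ i * τ j * τ i * τ j)
    (lattice_comm : ∀ j k, (ξ j : A) * ξ k = ξ k * ξ j)
    (mixed_zero : ∀ i : Fin n, i.val = 0 →
      τ i * ξ i.castSucc * τ i = ξ i.castSucc * ξ i.succ)
    (mixed_comm : ∀ (i : Fin n) (j : Fin (n + 1)), j ≠ i.castSucc → j ≠ i.succ →
      τ i * ξ j = ξ j * τ i)
    (mixed_pos : ∀ i : Fin n, 1 ≤ i.val → τ i * ξ i.castSucc * τ i = ξ i.succ) :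
    HeckeB p q n →ₐ[F] A :=
  RingQuot.liftAlgHom F (s := HeckeRel p q n)
    ⟨FreeAlgebra.lift F (fun g => match g with
      | HeckeGen.T i => τ i
      | HeckeGen.X j => (ξ j : A)
      | HeckeGen.Xinv j => ((ξ j)⁻¹ : Aˣ)), by
      intro u v h
      cases h <;>
        simp only [HeckeGen.t, HeckeGen.x, HeckeGen.y, map_mul, map_sub, map_add, map_zero,
          map_one, AlgHom.commutes, FreeAlgebra.lift_ι_apply, Units.mul_inv, Units.inv_mul]
      case quad_zero i hi => exact quad_zero i hi
      case quad_pos i hi => exact quad_pos i hi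
      case braid i j hi hij => exact braid i j hi hij
      case far i j hij => exact far i j hij
      case braid_zero i j hi hj => exact braid_zero i j hi hj
      case lattice_comm j k => exact lattice_comm j k
      case mixed_zero i hi => exact mixed_zero i hi
      case mixed_comm i j h₁ h₂ => exact mixed_comm i j h₁ h₂
      case mixed_pos i hi => exact mixed_pos i hi⟩

theorem quad_zero (i : Fin n) (hi : i.val = 0) :
    (T p q i - algebraMap F _ (p : F)) * (T p q i + algebraMap F _ (p : F)⁻¹) = 0 := by
  have h := mk_rel (p := p) (q := q) (HeckeRel.quad_zero i hi)
  simp only [map_mul, map_sub, map_add, map_zero, AlgHom.commutes] at h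
  exact h

theorem quad_pos (i : Fin n) (hi : 1 ≤ i.val) :
    (T p q i - algebraMap F _ (q : F)) * (T p q i + algebraMap F _ (q : F)⁻¹) = 0 := by
  have h := mk_rel (p := p) (q := q) (HeckeRel.quad_pos i hi)
  simp only [map_mul, map_sub, map_add, map_zero, AlgHom.commutes] at h
  exact h

theorem braid (i j : Fin n) (hi : 1 ≤ i.val) (hij : j.val = i.val + 1) :
    T p q i * T p q j * T p q i = T p q j * T p q i * T p q j := by
  have h := mk_rel (p := p) (q := q) (HeckeRel.braid i j hi hij)
  simp only [map_mul] at h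
  exact h

theorem far (i j : Fin n) (hij : i.val + 1 < j.val) :
    T p q i * T p q j = T p q j * T p q i := by
  have h := mk_rel (p := p) (q := q) (HeckeRel.far i j hij)
  simp only [map_mul] at h
  exact h

theorem braid_zero (i j : Fin n) (hi : i.val = 0) (hj : j.val = 1) :
    T p q j * T p q i * T p q j * T p q i = T p q i * T p q j * T p q i * T p q j := by
  have h := mk_rel (p := p) (q := q) (HeckeRel.braid_zero i j hi hj)
  simp only [map_mul] at h
  exact h

theorem lattice_comm (j k : Fin (n + 1)) :
    (X p q j : HeckeB p q n) * X p q k = X p q k * X p q j := by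
  have h := mk_rel (p := p) (q := q) (HeckeRel.lattice_comm j k)
  simp only [map_mul] at h
  exact h

theorem mixed_zero (i : Fin n) (hi : i.val = 0) :
    T p q i * X p q i.castSucc * T p q i = X p q i.castSucc * X p q i.succ := by
  have h := mk_rel (p := p) (q := q) (HeckeRel.mixed_zero i hi)
  simp only [map_mul] at h
  exact h

theorem mixed_comm (i : Fin n) (j : Fin (n + 1)) (h₁ : j ≠ i.castSucc) (h₂ : j ≠ i.succ) :
    T p q i * X p q j = X p q j * T p q i := by
  have h := mk_rel (p := p) (q := q) (HeckeRel.mixed_comm i j h₁ h₂)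
  simp only [map_mul] at h
  exact h

theorem mixed_pos (i : Fin n) (hi : 1 ≤ i.val) :
    T p q i * X p q i.castSucc * T p q i = X p q i.succ := by
  have h := mk_rel (p := p) (q := q) (HeckeRel.mixed_pos i hi)
  simp only [map_mul] at h
  exact h

/-- An element that commutes with the images of the `T_i` and `X_j` commutes with the image of `H_n`. -/
theorem commute_map {A : Type*} [Ring A] [Algebra F A] (φ : HeckeB p q n →ₐ[F] A) (z : A)
    (hT : ∀ i, Commute (φ (T p q i)) z) (hX : ∀ j : Fin (n + 1), Commute (φ (X p q j)) z)
    (h : HeckeB p q n) : Commute (φ h) z := by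
  obtain ⟨u, rfl⟩ := RingQuot.mkAlgHom_surjective F (HeckeRel p q n) h
  induction u using FreeAlgebra.induction with
  | grade0 r =>
    rw [AlgHom.commutes]
    exact (AlgHom.commutes φ r).symm ▸ Algebra.commutes r z
  | grade1 g =>
    cases g with
    | T i => exact hT i
    | X j => exact hX j
    | Xinv j =>
      have h1 : Commute ((Units.map (φ : HeckeB p q n →* A) (X p q j) : Aˣ) : A) z := hX j
      exact h1.units_inv_left
  | mul a b ha hb =>
    rw [map_mul]
    exact (map_mul φ _ _).symm ▸ ha.mul_left hb
  | add a b ha hb =>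
    rw [map_add]
    exact (map_add φ _ _).symm ▸ ha.add_left hb

variable (p q n) in
/-- The anti-automorphism `τ` of `H_n` that fixes all `T_i` and all `X_j`. -/
def tau : HeckeB p q n →ₐ[F] (HeckeB p q n)ᵐᵒᵖ :=
  lift (fun i => MulOpposite.op (T p q i)) (fun j => Units.opEquiv.symm (MulOpposite.op (X p q j)))
    (fun i hi => by
      apply MulOpposite.unop_injective
      have h := quad_zero (p := p) (q := q) i hi
      simp only [MulOpposite.unop_mul, MulOpposite.unop_sub, MulOpposite.unop_add,
        MulOpposite.unop_op, MulOpposite.algebraMap_apply, MulOpposite.unop_zero]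
      have hc := Algebra.commutes (p : F) (T p q i)
      have hd := Algebra.commutes ((p : F)⁻¹) (T p q i)
      have he := Algebra.commutes (p : F) (algebraMap F (HeckeB p q n) (p : F)⁻¹)
      rw [← h]
      simp only [mul_add, mul_sub, add_mul, sub_mul, hc, hd, he]
      abel)
    (fun i hi => by
      apply MulOpposite.unop_injective
      have h := quad_pos (p := p) (q := q) i hi
      simp only [MulOpposite.unop_mul, MulOpposite.unop_sub, MulOpposite.unop_add,
        MulOpposite.unop_op, MulOpposite.algebraMap_apply, MulOpposite.unop_zero]
      have hc := Algebra.commutes (q : F) (T p q i)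
      have hd := Algebra.commutes ((q : F)⁻¹) (T p q i)
      have he := Algebra.commutes (q : F) (algebraMap F (HeckeB p q n) (q : F)⁻¹)
      rw [← h]
      simp only [mul_add, mul_sub, add_mul, sub_mul, hc, hd, he]
      abel)
    (fun i j hi hij => MulOpposite.unop_injective (by
      simpa [mul_assoc] using braid (p := p) (q := q) i j hi hij))
    (fun i j hij => MulOpposite.unop_injective (by
      simpa using (far (p := p) (q := q) i j hij).symm))
    (fun i j hi hj => MulOpposite.unop_injective (by
      simpa [mul_assoc] using (braid_zero (p := p) (q := q) i j hi hj).symm))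
    (fun j k => MulOpposite.unop_injective (by
      simpa using lattice_comm (p := p) (q := q) k j))
    (fun i hi => MulOpposite.unop_injective (by
      simpa [mul_assoc, lattice_comm i.succ i.castSucc] using mixed_zero (p := p) (q := q) i hi))
    (fun i j h₁ h₂ => MulOpposite.unop_injective (by
      simpa using (mixed_comm (p := p) (q := q) i j h₁ h₂).symm))
    (fun i hi => MulOpposite.unop_injective (by
      simpa [mul_assoc] using mixed_pos (p := p) (q := q) i hi))

variable (p q n) in
/-- The map `H_n → H_{n+1}`, `T_i ↦ T_i`, `X_j ↦ X_j`. -/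
def incl : HeckeB p q n →ₐ[F] HeckeB p q (n + 1) :=
  lift (fun i => T p q i.castSucc) (fun j => X p q j.castSucc)
    (fun _ hi => quad_zero _ hi) (fun _ hi => quad_pos _ hi)
    (fun _ _ hi hij => braid _ _ hi hij) (fun _ _ hij => far _ _ hij)
    (fun _ _ hi hj => braid_zero _ _ hi hj) (fun _ _ => lattice_comm _ _)
    (fun i hi => mixed_zero i.castSucc hi)
    (fun i j h₁ h₂ => mixed_comm i.castSucc j.castSucc
      (fun h => h₁ (Fin.castSucc_injective _ h))
      (fun h => h₂ (Fin.castSucc_injective _ h)))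
    (fun i hi => mixed_pos i.castSucc hi)

theorem incl_T (i : Fin n) : incl p q n (T p q i) = T p q i.castSucc := by
  refine (RingQuot.liftAlgHom_mkAlgHom_apply F _ _ _).trans ?_
  exact FreeAlgebra.lift_ι_apply _ _

theorem incl_X (j : Fin (n + 1)) : incl p q n (X p q j) = X p q j.castSucc := by
  refine (RingQuot.liftAlgHom_mkAlgHom_apply F _ _ _).trans ?_
  exact FreeAlgebra.lift_ι_apply _ _

variable (p q n) in
/-- The map `F[X, X⁻¹] → H_{n+1}`, `X ↦ X_{n+1}`. -/
noncomputable def laurentLast : F[T;T⁻¹] →ₐ[F] HeckeB p q (n + 1) :=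
  AddMonoidAlgebra.lift F (HeckeB p q (n + 1)) ℤ
    ((Units.coeHom (HeckeB p q (n + 1))).comp (zpowersHom _ (X p q (Fin.last (n + 1)))))

theorem incl_commute_last (h : HeckeB p q n) :
    Commute (incl p q n h) (X p q (Fin.last (n + 1))) := by
  refine commute_map _ _ (fun i => ?_) (fun j => ?_) h
  · rw [incl_T]
    refine mixed_comm _ _ ?_ ?_ <;>
    · intro h
      have := congrArg Fin.val h
      simp at this
      omega
  · rw [incl_X]
    exact lattice_comm _ _

theorem incl_commute_laurentLast (h : HeckeB p q n) (f : F[T;T⁻¹]) :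
    Commute (incl p q n h) (laurentLast p q n f) := by
  induction f using AddMonoidAlgebra.induction_on with
  | of k =>
    have hk := (incl_commute_last h).units_zpow_right k
    have e : laurentLast p q n (AddMonoidAlgebra.of F ℤ (Multiplicative.ofAdd k)) =
        ((X p q (Fin.last (n + 1)) ^ k : (HeckeB p q (n + 1))ˣ) : HeckeB p q (n + 1)) :=
      AddMonoidAlgebra.lift_of _ _
    exact e ▸ hk
  | add f g hf hg => simpa only [map_add] using hf.add_right hg
  | smul r f hf => simpa only [map_smul] using hf.smul_right r

variable (p q n) in
/-- The embedding of the parabolic subalgebra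
`H_{n,1} ≅ H_n ⊗ F[X_{n+1}, X_{n+1}⁻¹]` into `H_{n+1}`. -/
noncomputable def parabolic : HeckeB p q n ⊗[F] F[T;T⁻¹] →ₐ[F] HeckeB p q (n + 1) :=
  Algebra.TensorProduct.lift (incl p q n) (laurentLast p q n) incl_commute_laurentLast

end HeckeB

/-- The `τ`-dual `N^τ`: the space `Hom_F(N, F)` with `(h • f)(m) = f(τ(h) m)`. -/
def TauDual {F : Type*} [Field F] (p q : Fˣ) (n : ℕ) (N : Type*) [AddCommGroup N] [Module F N] :
    Type _ := Module.Dual F N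

namespace TauDual

variable {F : Type*} [Field F] {p q : Fˣ} {n : ℕ} {N : Type*} [AddCommGroup N] [Module F N]

instance : AddCommGroup (TauDual p q n N) := inferInstanceAs (AddCommGroup (Module.Dual F N))

instance [Module (HeckeB p q n) N] [IsScalarTower F (HeckeB p q n) N] :
    Module (HeckeB p q n) (TauDual p q n N) where
  smul h f := LinearMap.comp (show Module.Dual F N from f)
    (Algebra.lsmul F F N (HeckeB.tau p q n h).unop)
  one_smul f := LinearMap.ext fun m => show f.toFun _ = f.toFun m by simp
  mul_smul h k f := LinearMap.ext fun m => show f.toFun _ = f.toFun _ by simp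
  smul_zero h := LinearMap.ext fun m => rfl
  smul_add h f g := LinearMap.ext fun m => rfl
  add_smul h k f := LinearMap.ext fun m =>
    show f.toFun _ = f.toFun _ + f.toFun _ by simp
  zero_smul f := LinearMap.ext fun m => show f.toFun _ = 0 by simp

end TauDual

/-- The outer tensor product `N ⊠ (a)` of an `H_n`-module `N` with the one-dimensional
`F[X, X⁻¹]`-module `(a)` on which `X` acts as `a`. Its space `N ⊗ F` is identified with `N`,
so that `h ⊗ X^k` acts as `a^k h`. -/
def BoxOne {F : Type*} [Field F] (p q : Fˣ) (n : ℕ) (a : Fˣ) (N : Type*) : Type _ :=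
  N

namespace BoxOne

variable {F : Type*} [Field F] {p q : Fˣ} {n : ℕ} {a : Fˣ} {N : Type*} [AddCommGroup N]

variable (p q n a) in
/-- The algebra map `H_n ⊗ F[X, X⁻¹] → H_n`, `h ⊗ X^k ↦ a^k h`. -/
noncomputable def eval : HeckeB p q n ⊗[F] F[T;T⁻¹] →ₐ[F] HeckeB p q n :=
  Algebra.TensorProduct.lift (AlgHom.id F _)
    ((Algebra.ofId F (HeckeB p q n)).comp
      (AddMonoidAlgebra.lift F F ℤ ((Units.coeHom F).comp (zpowersHom _ a))))
    (fun h f => Algebra.commute_algebraMap_right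
      (AddMonoidAlgebra.lift F F ℤ ((Units.coeHom F).comp (zpowersHom _ a)) f) h)

instance : AddCommGroup (BoxOne p q n a N) := inferInstanceAs (AddCommGroup N)

instance [Module F N] : Module F (BoxOne p q n a N) := inferInstanceAs (Module F N)

noncomputable instance [Module (HeckeB p q n) N] :
    Module (HeckeB p q n ⊗[F] F[T;T⁻¹]) (BoxOne p q n a N) :=
  Module.compHom N (eval p q n a).toRingHom

end BoxOne

/-- The relations `h φ(b) ⊗ v = h ⊗ b v` that turn `A ⊗_F V` into `A ⊗_B V`. -/
def inducedRel {F B A : Type*} [Field F] [Ring B] [Algebra F B] [Ring A] [Algebra F A]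
    (φ : B →ₐ[F] A) (V : Type*) [AddCommGroup V] [Module F V] [Module B V] :
    Submodule A (A ⊗[F] V) :=
  Submodule.span A {z | ∃ (h : A) (b : B) (v : V), z = (h * φ b) ⊗ₜ[F] v - h ⊗ₜ[F] (b • v)}

/-- The induced module `A ⊗_B V` along an algebra map `φ : B → A`. -/
abbrev Induced {F B A : Type*} [Field F] [Ring B] [Algebra F B] [Ring A] [Algebra F A]
    (φ : B →ₐ[F] A) (V : Type*) [AddCommGroup V] [Module F V] [Module B V] : Type _ :=
  (A ⊗[F] V) ⧸ inducedRel φ V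

/-- `f_a N = ind_{H_{n,1}}^{H_{n+1}} (N ⊠ (a))`, for an `H_n`-module `N`. -/
abbrev fInd {F : Type*} [Field F] (p q : Fˣ) (n : ℕ) (a : Fˣ) (N : Type*) [AddCommGroup N]
    [Module F N] [Module (HeckeB p q n) N] : Type _ :=
  Induced (HeckeB.parabolic p q n) (BoxOne p q n a N)

/-- The cosocle of `M`, its largest semisimple quotient. -/
abbrev Cosocle (R M : Type*) [Ring R] [AddCommGroup M] [Module R M] : Type _ :=
  M ⧸ sInf {K : Submodule R M | IsSemisimpleModule R (M ⧸ K)}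

/-! Here N is a module over H_n and M = f_a N a module over H_{n+1}. The theorem is a dimension
count in one joint generalized eigenspace. For a module V let V_b be the space on which X_b and all
later X_i have the generalized eigenvalue a (`tailSpace`). Take b ≥ 1 least with N_b ≠ 0, and put d
= dim N_b, m = n + 2 - b.

Upper bound (`finrank_tailSpace_fInd_le`): dim M_b ≤ 2md. The 2n + 2 minimal coset representatives
w_k of H_n in H_{n+1} filter M, with subquotients N on which the X_i act through a twist by w_k. In
the k-th subquotient one X_J acts as a or a⁻¹, the others as X_1, …, X_n in order. If J < b, an
eigenvector would lie in N_{b-1} = 0; if J ≥ b it lies in N_b. Each J from b to n + 1 occurs twice.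

Lower bound (`IsBoxMap.mul_finrank_le`): a nonzero quotient Q of M has dim Q_b ≥ md. It contains a
copy of N on which X_{n+1} = a, and for u in N_b the vectors T_j ⋯ T_n u, b ≤ j ≤ n + 1, are
independent: X_{n+1} - a strips the last factor T_n at the price of the scalar (q - q⁻¹)a ≠ 0. Two
independent copies of N give 2md (`IsBoxMap.two_mul_finrank_le`).

Detection (`exists_mem_tailSpace`): a nonzero submodule K of M has K_b ≠ 0. Indeed K maps onto the
last subquotient, which is N with X_{n+1} = a⁻¹; this equals a because a = ±1.

If M has only one maximal submodule, its cosocle is simple. If K₁ ≠ K₂ are maximal, M/K₁ and M/K₂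
already account for 2md dimensions, so (K₁ ∩ K₂)_b = 0 and hence K₁ ∩ K₂ = 0: M is the sum of two
simple modules. Were these isomorphic, Schur's lemma would put two independent copies of N into
M/K₁, and 2md + md would be at most 2md.

Detection needs the subquotients to be full copies of N, that is, M to be as large as possible
(`eq_zero_of_word_smul_toInd_mem`). This is proved by deformation. Over K = Frac F⟦X⟧ the scalar a
is replaced by z = a + X, which is no eigenvalue of any operator defined over F, so H_{n+1} acts on
(K ⊗ N)^(2n+2) by explicit intertwiner formulas. A lattice in this module, reduced modulo X,
receives a map from M that separates the subquotients. -/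

namespace HeckeB

variable {F : Type*} [Field F] {p q : Fˣ} {n : ℕ}

/-! ### Commutation relations in H_n, with generators indexed by natural numbers. -/

variable (p q) in
/-- The coefficient `c` in the quadratic relation `T_i ^ 2 = c T_i + 1`. -/
def qc (i : ℕ) : F := if i = 0 then (p : F) - (p : F)⁻¹ else (q : F) - (q : F)⁻¹

variable (p q n) in
/-- `T_i` indexed by a natural number (zero out of range). -/
def tN (i : ℕ) : HeckeB p q n := if h : i < n then T p q ⟨i, h⟩ else 0

variable (p q n) in
/-- `X_j` indexed by a natural number (one out of range). -/
def xN (j : ℕ) : (HeckeB p q n)ˣ := if h : j < n + 1 then X p q ⟨j, h⟩ else 1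

theorem qc_of_ne_zero {i : ℕ} (h : i ≠ 0) : qc p q i = qc p q 1 := by
  simp [qc, h]

theorem quad_iff {A : Type*} [Ring A] [Algebra F A] (s : Fˣ) (x : A) :
    (x - algebraMap F A s) * (x + algebraMap F A (s : F)⁻¹) = 0 ↔
      x * x = ((s : F) - (s : F)⁻¹) • x + 1 := by
  have e : (x - algebraMap F A s) * (x + algebraMap F A (s : F)⁻¹) =
      x * x - (((s : F) - (s : F)⁻¹) • x + 1) := by
    simp only [Algebra.algebraMap_eq_smul_one, sub_mul, mul_add, smul_mul_assoc, mul_smul_comm,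
      one_mul, mul_one, smul_sub, smul_smul, sub_smul, one_smul,
      inv_mul_cancel₀ s.ne_zero]
    abel
  rw [e, sub_eq_zero]

theorem tN_mul_self {i : ℕ} (h : i < n) :
    tN p q n i * tN p q n i = qc p q i • tN p q n i + 1 := by
  simp only [tN, h, dite_true]
  rcases Nat.eq_zero_or_pos i with rfl | hi
  · simpa [qc] using (quad_iff p _).1 (quad_zero (p := p) (q := q) ⟨0, h⟩ rfl)
  · simpa [qc, hi.ne'] using (quad_iff q _).1 (quad_pos (p := p) (q := q) ⟨i, h⟩ hi)

theorem tN_braid {i : ℕ} (hi : 1 ≤ i) (h : i + 1 < n) :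
    tN p q n i * tN p q n (i + 1) * tN p q n i =
      tN p q n (i + 1) * tN p q n i * tN p q n (i + 1) := by
  have h' : i < n := by omega
  simp only [tN, h, h', dite_true]
  exact braid _ _ hi rfl

theorem tN_far {i j : ℕ} (hij : i + 1 < j) : Commute (tN p q n i) (tN p q n j) := by
  by_cases h : j < n
  · have h' : i < n := by omega
    simp only [tN, h, h', dite_true]
    exact far _ _ hij
  · simp [tN, h]

theorem tN_braid_zero (h : 1 < n) :
    tN p q n 1 * tN p q n 0 * tN p q n 1 * tN p q n 0 =
      tN p q n 0 * tN p q n 1 * tN p q n 0 * tN p q n 1 := by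
  have h' : 0 < n := by omega
  simp only [tN, h, h', dite_true]
  exact braid_zero _ _ rfl rfl

theorem xN_comm (i j : ℕ) : Commute (xN p q n i) (xN p q n j) := by
  unfold xN
  split_ifs
  · exact Units.ext (lattice_comm _ _)
  all_goals simp

theorem xN_val_comm (i j : ℕ) : Commute (xN p q n i : HeckeB p q n) (xN p q n j) :=
  (xN_comm i j).units_val

theorem tN_xN_comm {i j : ℕ} (h₁ : j ≠ i) (h₂ : j ≠ i + 1) :
    Commute (tN p q n i) (xN p q n j : HeckeB p q n) := by
  unfold tN xN
  split_ifs with h h'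
  · refine mixed_comm _ _ ?_ ?_ <;> simp [Fin.ext_iff, h₁, h₂]
  all_goals simp

theorem tN_xN_tN {i : ℕ} (hi : 1 ≤ i) (h : i < n) :
    tN p q n i * xN p q n i * tN p q n i = xN p q n (i + 1) := by
  have h1 : i < n + 1 := by omega
  have h2 : i + 1 < n + 1 := by omega
  simp only [tN, xN, h, h1, h2, dite_true]
  exact mixed_pos ⟨i, h⟩ hi

theorem tN_zero_xN_tN (h : 0 < n) :
    tN p q n 0 * xN p q n 0 * tN p q n 0 = xN p q n 0 * xN p q n 1 := by
  have h2 : 0 + 1 < n + 1 := by omega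
  have h2' : 1 < n + 1 := by omega
  simp only [tN, xN, h, h2', Nat.succ_pos, dite_true]
  exact mixed_zero ⟨0, h⟩ rfl

/-- The quadratic relation says T_i⁻¹ = T_i - c; cancelling a T_i on the right turns the mixed
relations into commutation rules. -/
theorem tN_mul_sub {i : ℕ} (h : i < n) :
    tN p q n i * (tN p q n i - qc p q i • 1) = 1 := by
  rw [mul_sub, tN_mul_self h, mul_smul_comm, mul_one]
  abel

/-- `T_i X_i = X_{i+1} (T_i - c)`. -/
theorem tN_mul_xN {i : ℕ} (hi : 1 ≤ i) (h : i < n) :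
    tN p q n i * xN p q n i = xN p q n (i + 1) * tN p q n i
      - qc p q i • (xN p q n (i + 1) : HeckeB p q n) := by
  have e := congrArg (· * (tN p q n i - qc p q i • 1)) (tN_xN_tN (p := p) (q := q) hi h)
  simp only [mul_assoc, tN_mul_sub h, mul_one] at e
  rw [e, mul_sub, mul_smul_comm, mul_one]

theorem tN_mul_xN_succ {i : ℕ} (hi : 1 ≤ i) (h : i < n) :
    tN p q n i * xN p q n (i + 1) = xN p q n i * tN p q n i
      + qc p q i • (xN p q n (i + 1) : HeckeB p q n) := by
  conv_lhs => rw [← tN_xN_tN hi h]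
  rw [← tN_xN_tN hi h, ← mul_assoc, ← mul_assoc, tN_mul_self h, add_mul, add_mul, one_mul,
    smul_mul_assoc, smul_mul_assoc, add_comm]

theorem tN_zero_mul_xN_zero (h : 0 < n) :
    tN p q n 0 * xN p q n 0 = xN p q n 0 * xN p q n 1 * tN p q n 0
      - qc p q 0 • (xN p q n 0 * xN p q n 1 : HeckeB p q n) := by
  have e := congrArg (· * (tN p q n 0 - qc p q 0 • 1)) (tN_zero_xN_tN (p := p) (q := q) h)
  simp only [mul_assoc, tN_mul_sub h, mul_one] at e
  rw [e, mul_sub, mul_smul_comm, mul_one]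
  simp only [mul_sub, mul_assoc, mul_smul_comm]

theorem tN_zero_mul_xN_zero_one (h : 0 < n) :
    tN p q n 0 * (xN p q n 0 * xN p q n 1) = xN p q n 0 * tN p q n 0
      + qc p q 0 • (xN p q n 0 * xN p q n 1 : HeckeB p q n) := by
  conv_lhs => rw [← tN_zero_xN_tN h]
  rw [← tN_zero_xN_tN h, ← mul_assoc, ← mul_assoc, tN_mul_self h, add_mul, add_mul, one_mul,
    smul_mul_assoc, smul_mul_assoc, add_comm]

/-- `X_1 T_0 = T_0 X_1⁻¹ + c (1 + X_1)`. -/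
theorem xN_one_mul_tN_zero (h : 0 < n) :
    (xN p q n 1 : HeckeB p q n) * tN p q n 0 = tN p q n 0 * ((xN p q n 1)⁻¹ : (HeckeB p q n)ˣ)
      + qc p q 0 • (1 + (xN p q n 1 : HeckeB p q n)) := by
  have h1 := tN_zero_mul_xN_zero (p := p) (q := q) h
  have h2 := tN_zero_mul_xN_zero_one (p := p) (q := q) h
  have h3 := congrArg (· * (((xN p q n 1)⁻¹ : (HeckeB p q n)ˣ) : HeckeB p q n)) h2
  simp only [add_mul, mul_assoc, Units.mul_inv, mul_one, smul_mul_assoc] at h3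
  rw [h1] at h3
  have h4 := congrArg ((((xN p q n 0)⁻¹ : (HeckeB p q n)ˣ) : HeckeB p q n) * ·) h3
  simp only [mul_add, mul_sub, mul_smul_comm, mul_assoc, Units.inv_mul_cancel_left,
    Units.inv_mul] at h4
  rw [sub_eq_iff_eq_add] at h4
  rw [h4, smul_add]
  abel

theorem incl_tN {i : ℕ} (h : i < n) : incl p q n (tN p q n i) = tN p q (n + 1) i := by
  have h' : i < n + 1 := by omega
  simp only [tN, h, h', dite_true]
  exact incl_T _

theorem incl_xN {j : ℕ} (h : j ≤ n) : incl p q n (xN p q n j) = xN p q (n + 1) j := by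
  have h' : j < n + 1 := by omega
  have h'' : j < n + 1 + 1 := by omega
  simp only [xN, h', h'', dite_true]
  exact incl_X _

theorem xN_last : xN p q (n + 1) (n + 1) = X p q (Fin.last (n + 1)) := by
  simp [xN, Fin.last]

/-- q = q⁻¹ would make q² = 1. This coefficient drives the linear independence in the lower bound.
-/
theorem qc_one_ne_zero (hq : ∀ k : ℕ, 0 < k → q ^ k ≠ 1) : qc p q 1 ≠ 0 := by
  intro h
  simp only [qc, one_ne_zero, if_false, sub_eq_zero] at h
  apply hq 2 two_pos
  ext
  rw [Units.val_pow_eq_pow_val, sq]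
  nth_rw 1 [h]
  simp

/-- A property of elements of `H_n` holds if it holds for generators and is closed under the
algebra operations. -/
theorem gen_induction {P : HeckeB p q n → Prop} (hs : ∀ r : F, P (algebraMap F _ r))
    (hT : ∀ i, i < n → P (tN p q n i)) (hX : ∀ j, j ≤ n → P (xN p q n j))
    (hX' : ∀ j, j ≤ n → P ((xN p q n j)⁻¹ : (HeckeB p q n)ˣ))
    (hmul : ∀ a b, P a → P b → P (a * b)) (hadd : ∀ a b, P a → P b → P (a + b))
    (h : HeckeB p q n) : P h := by
  obtain ⟨u, rfl⟩ := RingQuot.mkAlgHom_surjective F (HeckeRel p q n) h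
  induction u using FreeAlgebra.induction with
  | grade0 r =>
    rw [AlgHom.commutes]
    exact hs r
  | grade1 g =>
    cases g with
    | T i =>
      have := hT i i.2
      simp only [tN, i.2, dite_true] at this
      exact this
    | X j =>
      have := hX j (by omega)
      simp only [xN, j.2, dite_true] at this
      exact this
    | Xinv j =>
      have := hX' j (by omega)
      simp only [xN, j.2, dite_true] at this
      exact this
  | mul a b ha hb =>
    rw [map_mul]
    exact hmul _ _ ha hb
  | add a b ha hb =>
    rw [map_add]
    exact hadd _ _ ha hb

end HeckeB

/-! ### Coset representatives of H_n in H_{n+1} and their interaction with the generators. -/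

namespace HeckeB

variable {F : Type*} [Field F] {p q : Fˣ} {n : ℕ}

/-- The index of the `k`-th generator in the chain `T_n, …, T_1, T_0, T_1, …, T_n`. -/
def chainIdx (n k : ℕ) : ℕ := if k ≤ n then n - k else k - n

/-- The absolute value of the image of `n + 1` under the first `k` reflections of the chain. -/
def chainPos (n k : ℕ) : ℕ := if k ≤ n then n + 1 - k else k - n

/-- The four ways T_i can meet w_k: it lengthens it to w_{k+1}, it cancels the last letter added, or
it passes through and comes out as T_i or as T_{i-1}. -/
theorem chain_cases {n k i : ℕ} (hk : k ≤ 2 * n + 1) (hi : i ≤ n) :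
    (i = chainIdx n k ∧ k ≤ 2 * n) ∨ (1 ≤ k ∧ i = chainIdx n (k - 1)) ∨
      i + 1 < chainPos n k ∨ chainPos n k < i := by
  unfold chainIdx chainPos
  split_ifs <;> omega

variable (p q n) in
/-- The products `T_{i_{k-1}} ⋯ T_{i_0}` along the chain: the minimal coset representatives of
`H_n` in `H_{n+1}`. -/
def word : ℕ → HeckeB p q (n + 1)
  | 0 => 1
  | k + 1 => tN p q (n + 1) (chainIdx n k) * word k

/-- The Weyl group identity s_i w_k = w_k s_{i'} has equal lengths on both sides, so it lifts to the
Hecke algebra. Away from the newest letter T_i just commutes with it; next to it a braid relation is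
needed, which reaches back two or three letters, hence the strong induction. -/
theorem tN_mul_word (k : ℕ) : k ≤ 2 * n + 1 →
    (∀ i, i + 1 < chainPos n k → tN p q (n + 1) i * word p q n k = word p q n k * tN p q (n + 1) i) ∧
    (∀ i, chainPos n k < i → i ≤ n →
      tN p q (n + 1) i * word p q n k = word p q n k * tN p q (n + 1) (i - 1)) := by
  induction k using Nat.strong_induction_on with
  | _ k ih =>
  intro hk
  rcases k with _ | k
  · refine ⟨fun i _ => by simp [word], fun i hi hi' => ?_⟩
    simp only [chainPos] at hi
    split_ifs at hi <;> omega
  have hcomm : ∀ {i j : ℕ}, i + 1 < j ∨ j + 1 < i →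
      tN p q (n + 1) i * (tN p q (n + 1) j * word p q n k) =
        tN p q (n + 1) j * (tN p q (n + 1) i * word p q n k) := by
    intro i j hij
    rw [← mul_assoc, ← mul_assoc]
    rcases hij with h | h
    · rw [(tN_far h).eq]
    · rw [(tN_far h).eq]
  have ihk := ih k (by omega) (by omega)
  refine ⟨fun i hi => ?_, fun i hi hin => ?_⟩
  · by_cases h1 : i + 1 < chainPos n k ∧ i + 1 < chainIdx n k
    · rw [word, hcomm (Or.inl h1.2), ihk.1 i h1.1, mul_assoc]
    · -- the second half of the chain, with `i` just below the new generator
      have hk' : n < k := by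
        unfold chainPos chainIdx at *
        split_ifs at * <;> omega
      have hik : i = chainIdx n (k - 1) := by
        unfold chainPos chainIdx at *
        split_ifs at * <;> omega
      have hd : chainIdx n k = i + 1 := by
        unfold chainPos chainIdx at *
        split_ifs at * <;> omega
      obtain ⟨k, rfl⟩ : ∃ l, k = l + 1 := ⟨k - 1, by omega⟩
      simp only [Nat.add_sub_cancel] at hik
      have ihk := ih k (by omega) (by omega)
      have hin : i + 1 ≤ n := by
        unfold chainIdx at *
        split_ifs at * <;> omega
      -- For i = 0 the word begins with T_1 T_0 T_1 and the braid relation of length four applies.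
      -- Otherwise it begins with T_{i+1} T_i and the one of length three suffices.
      rcases Nat.eq_zero_or_pos i with h0 | h0
      · subst h0
        have hkn : k = n := by
          unfold chainIdx at *
          split_ifs at * <;> omega
        obtain ⟨k, rfl⟩ : ∃ l, k = l + 1 := ⟨k - 1, by omega⟩
        have hd2 : chainIdx n k = 1 := by
          unfold chainIdx
          split_ifs <;> omega
        have ihk := (ih k (by omega) (by omega)).1 0 (by
          unfold chainPos
          split_ifs <;> omega)
        simp only [word, hd, ← hik, hd2, mul_assoc]
        rw [← ihk]
        have := congrArg (· * word p q n k)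
          (tN_braid_zero (p := p) (q := q) (n := n + 1) (by omega))
        simpa only [mul_assoc] using this.symm
      · have ihk := ihk.2 (i + 1) (by
          unfold chainIdx chainPos at *
          split_ifs at * <;> omega) hin
        simp only [word, hd, ← hik, mul_assoc]
        rw [Nat.add_sub_cancel] at ihk
        rw [← ihk]
        have := congrArg (· * word p q n k)
          (tN_braid (p := p) (q := q) (n := n + 1) (i := i) h0 (by omega))
        simpa only [mul_assoc] using this
  · by_cases h1 : chainPos n k < i ∧ chainIdx n k + 1 < i
    · rw [word, hcomm (Or.inr h1.2), ihk.2 i h1.1 hin, mul_assoc]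
    · have hk' : k < n := by
        unfold chainPos chainIdx at *
        split_ifs at * <;> omega
      have hd : i = chainIdx n k + 1 := by
        unfold chainPos chainIdx at *
        split_ifs at * <;> omega
      have hk1 : 1 ≤ k := by
        unfold chainPos chainIdx at *
        split_ifs at * <;> omega
      obtain ⟨k, rfl⟩ : ∃ l, k = l + 1 := ⟨k - 1, by omega⟩
      have hik : chainIdx n k = i := by
        unfold chainPos chainIdx at *
        split_ifs at * <;> omega
      have h0 : 1 ≤ chainIdx n (k + 1) := by
        unfold chainIdx
        split_ifs <;> omega
      have ihk := (ih k (by omega) (by omega)).1 (chainIdx n (k + 1)) (by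
          unfold chainIdx chainPos at *
          split_ifs at * <;> omega)
      simp only [word, hik]
      generalize chainIdx n (k + 1) = e at *
      subst hd
      simp only [mul_assoc, Nat.add_sub_cancel]
      rw [← ihk]
      have := congrArg (· * word p q n k)
        (tN_braid (p := p) (q := q) (n := n + 1) (i := e) h0 (by omega))
      simpa only [mul_assoc] using this.symm

/-- The image of `X_i` under the inverse of the `k`-th Weyl group element of the chain,
on the lattice with basis `X_0, …, X_{n+1}`. -/
def twist (p q : Fˣ) (n k i : ℕ) : (HeckeB p q (n + 1))ˣ :=
  if i = 0 then (if k ≤ n then xN p q (n + 1) 0 else xN p q (n + 1) 0 * xN p q (n + 1) (n + 1))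
  else if i < chainPos n k then xN p q (n + 1) i
  else if i = chainPos n k then
    (if k ≤ n then xN p q (n + 1) (n + 1) else (xN p q (n + 1) (n + 1))⁻¹)
  else xN p q (n + 1) (i - 1)

/-- On the descending half of the chain the position moves from i_k + 1 to i_k, on the ascending
half from i_k to i_k + 1. -/
theorem chain_step {k : ℕ} (hk : 1 ≤ chainIdx n k) :
    (k + 1 ≤ n ∧ chainPos n k = chainIdx n k + 1 ∧ chainPos n (k + 1) = chainIdx n k) ∨
      (n < k ∧ chainPos n k = chainIdx n k ∧ chainPos n (k + 1) = chainIdx n k + 1) := by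
  unfold chainIdx chainPos at *
  split_ifs at * <;> omega

theorem twist_succ_idx {k : ℕ} (hk : 1 ≤ chainIdx n k) :
    twist p q n (k + 1) (chainIdx n k) = twist p q n k (chainIdx n k + 1) := by
  rcases chain_step hk with ⟨h1, h2, h3⟩ | ⟨h1, h2, h3⟩
  · simp [twist, h2, h3, h1, (Nat.le_of_succ_le h1), Nat.one_le_iff_ne_zero.1 hk]
  · simp [twist, h2, h3, Nat.one_le_iff_ne_zero.1 hk]

theorem twist_succ_idx_succ {k : ℕ} (hk : 1 ≤ chainIdx n k) :
    twist p q n (k + 1) (chainIdx n k + 1) = twist p q n k (chainIdx n k) := by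
  rcases chain_step hk with ⟨h1, h2, h3⟩ | ⟨h1, h2, h3⟩
  · simp [twist, h2, h3, Nat.one_le_iff_ne_zero.1 hk]
  · simp [twist, h2, h3, Nat.one_le_iff_ne_zero.1 hk, h1.not_ge,
      (show ¬ k + 1 ≤ n by omega)]

theorem twist_succ_of_ne {k i : ℕ} (h1 : i ≠ chainIdx n k) (h2 : i ≠ chainIdx n k + 1)
    (hk : 1 ≤ chainIdx n k ∨ 1 ≤ i) : twist p q n (k + 1) i = twist p q n k i := by
  rcases Nat.eq_zero_or_pos (chainIdx n k) with h0 | h0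
  · have hkn : k = n := by
      unfold chainIdx at h0
      split_ifs at h0 <;> omega
    subst hkn
    have e1 : chainPos k k = 1 := by simp [chainPos]
    have e2 : chainPos k (k + 1) = 1 := by simp [chainPos]
    have h3 : ¬ i < 1 := by omega
    simp [twist, e1, e2, h3, (show i ≠ 0 by omega), (show i ≠ 1 by omega)]
  · rcases chain_step h0 with ⟨h3, h4, h5⟩ | ⟨h3, h4, h5⟩
    · have : i < chainIdx n k + 1 ↔ i < chainIdx n k := by omega
      simp [twist, h4, h5, h1, h2, h3, Nat.le_of_succ_le h3, this]
    · have : i < chainIdx n k + 1 ↔ i < chainIdx n k := by omega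
      simp [twist, h4, h5, h1, h2, h3.not_ge, (show ¬ k + 1 ≤ n by omega), this]

theorem twist_mid_zero :
    twist p q n (n + 1) 0 = twist p q n n 0 * twist p q n n 1 := by
  simp [twist, chainPos]

theorem twist_mid_one : twist p q n (n + 1) 1 = (twist p q n n 1)⁻¹ := by
  simp [twist, chainPos]

/-! ### The commutation rules as rules for vectors. -/

section Action

variable {M : Type*} [AddCommGroup M] [Module F M] [Module (HeckeB p q n) M]
  [IsScalarTower F (HeckeB p q n) M]

theorem xN_smul_tN_self {i : ℕ} (hi : 1 ≤ i) (h : i < n) (y : M) :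
    xN p q n i • tN p q n i • y =
      tN p q n i • xN p q n (i + 1) • y - qc p q i • xN p q n (i + 1) • y := by
  have := congrArg (· • y) (tN_mul_xN_succ (p := p) (q := q) hi h)
  simp only [add_smul, mul_smul, smul_assoc] at this
  simp only [Units.smul_def]
  rw [this]
  abel

theorem xN_succ_smul_tN {i : ℕ} (hi : 1 ≤ i) (h : i < n) (y : M) :
    xN p q n (i + 1) • tN p q n i • y =
      tN p q n i • xN p q n i • y + qc p q i • xN p q n (i + 1) • y := by
  have := congrArg (· • y) (tN_mul_xN (p := p) (q := q) hi h)
  simp only [sub_smul, mul_smul, smul_assoc] at this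
  simp only [Units.smul_def]
  rw [this]
  abel

omit [Module F M] [IsScalarTower F (HeckeB p q n) M] in
theorem xN_smul_tN_of_ne {i j : ℕ} (h₁ : j ≠ i) (h₂ : j ≠ i + 1) (y : M) :
    xN p q n j • tN p q n i • y = tN p q n i • xN p q n j • y := by
  simp only [Units.smul_def]
  rw [← mul_smul, ← mul_smul, (tN_xN_comm h₁ h₂).eq]

theorem xN_zero_smul_tN_zero (h : 0 < n) (y : M) :
    xN p q n 0 • tN p q n 0 • y =
      tN p q n 0 • xN p q n 0 • xN p q n 1 • y - qc p q 0 • xN p q n 0 • xN p q n 1 • y := by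
  have := congrArg (· • y) (tN_zero_mul_xN_zero_one (p := p) (q := q) h)
  simp only [add_smul, mul_smul, smul_assoc] at this
  simp only [Units.smul_def]
  rw [this]
  abel

theorem xN_one_smul_tN_zero (h : 0 < n) (y : M) :
    xN p q n 1 • tN p q n 0 • y =
      tN p q n 0 • (xN p q n 1)⁻¹ • y + qc p q 0 • (y + xN p q n 1 • y) := by
  have := congrArg (· • y) (xN_one_mul_tN_zero (p := p) (q := q) h)
  simp only [add_smul, mul_smul, smul_assoc, one_smul] at this
  simpa only [Units.smul_def] using this

end Action

/-! ### The filtration by coset representatives and its stability. -/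

section Filtration

variable {Q : Type*} [AddCommGroup Q] [Module F Q] [Module (HeckeB p q (n + 1)) Q]
  [IsScalarTower F (HeckeB p q (n + 1)) Q]

/-- The filtration `G_k = ∑_{l < k} w_l S`. -/
def filt (S : Submodule F Q) : ℕ → Submodule F Q
  | 0 => ⊥
  | k + 1 => filt S k ⊔ S.map (Algebra.lsmul F F Q (word p q n k))

variable {S : Submodule F Q}

theorem filt_le_iff {k : ℕ} {B : Submodule F Q} :
    filt (p := p) (q := q) (n := n) S k ≤ B ↔ ∀ l < k, ∀ v ∈ S, word p q n l • v ∈ B := by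
  induction k with
  | zero => simp [filt]
  | succ k ih =>
    rw [filt, sup_le_iff, ih, Submodule.map_le_iff_le_comap]
    constructor
    · rintro ⟨h1, h2⟩ l hl v hv
      rcases Nat.lt_succ_iff_lt_or_eq.1 hl with h | rfl
      · exact h1 l h v hv
      · exact h2 hv
    · intro h
      exact ⟨fun l hl => h l (by omega), fun v hv => h k (by omega) v hv⟩

theorem word_smul_mem_filt {k l : ℕ} (h : l < k) {v : Q} (hv : v ∈ S) :
    word p q n l • v ∈ filt (p := p) (q := q) (n := n) S k :=
  filt_le_iff.1 le_rfl l h v hv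

theorem filt_mono {k l : ℕ} (h : k ≤ l) :
    filt (p := p) (q := q) (n := n) S k ≤ filt (p := p) (q := q) (n := n) S l :=
  filt_le_iff.2 fun _ hj _ hv => word_smul_mem_filt (hj.trans_le h) hv

theorem smul_filt_le {k : ℕ} {B : Submodule F Q} (h : HeckeB p q (n + 1))
    (H : ∀ l < k, ∀ v ∈ S, h • word p q n l • v ∈ B) {g : Q}
    (hg : g ∈ filt (p := p) (q := q) (n := n) S k) : h • g ∈ B :=
  (filt_le_iff (B := B.comap (Algebra.lsmul F F Q h))).2 H hg

variable (p q n) in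
/-- Stability under the parabolic subalgebra generated by `T_i`, `i < n`, and all `X_j^{±1}`. -/
structure ParabolicStable (S : Submodule F Q) : Prop where
  t_mem : ∀ i < n, ∀ v ∈ S, tN p q (n + 1) i • v ∈ S
  x_mem : ∀ i ≤ n + 1, ∀ v ∈ S, xN p q (n + 1) i • v ∈ S
  x_inv_mem : ∀ i ≤ n + 1, ∀ v ∈ S, (xN p q (n + 1) i)⁻¹ • v ∈ S

variable (hS : ParabolicStable p q n S)
include hS

omit [IsScalarTower F (HeckeB p q (n + 1)) Q] in
theorem ParabolicStable.twist_mem {k i : ℕ} (hi : i ≤ n + 1) {v : Q} (hv : v ∈ S) :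
    twist p q n k i • v ∈ S ∧ (twist p q n k i)⁻¹ • v ∈ S := by
  unfold twist
  split_ifs
  · exact ⟨hS.x_mem _ (by omega) _ hv, hS.x_inv_mem _ (by omega) _ hv⟩
  · rw [mul_smul, mul_inv_rev, mul_smul]
    exact ⟨hS.x_mem _ (by omega) _ (hS.x_mem _ le_rfl _ hv),
      hS.x_inv_mem _ le_rfl _ (hS.x_inv_mem _ (by omega) _ hv)⟩
  · exact ⟨hS.x_mem _ (by omega) _ hv, hS.x_inv_mem _ (by omega) _ hv⟩
  · exact ⟨hS.x_mem _ (by omega) _ hv, hS.x_inv_mem _ (by omega) _ hv⟩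
  · rw [inv_inv]
    exact ⟨hS.x_inv_mem _ (by omega) _ hv, hS.x_mem _ (by omega) _ hv⟩
  · exact ⟨hS.x_mem _ (by omega) _ hv, hS.x_inv_mem _ (by omega) _ hv⟩

/-- Of all generators only T_{i_l}, the next letter of the chain, can raise the filtration degree of
w_l S. -/
theorem tN_smul_word_mem {l i : ℕ} (hl : l ≤ 2 * n + 1) (hi : i ≤ n) {v : Q} (hv : v ∈ S) :
    tN p q (n + 1) i • word p q n l • v ∈ filt (p := p) (q := q) (n := n) S (l + 1) ∨
      (i = chainIdx n l ∧ l ≤ 2 * n) ∧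
        tN p q (n + 1) i • word p q n l • v ∈ filt (p := p) (q := q) (n := n) S (l + 2) := by
  rcases chain_cases hl hi with ⟨rfl, h⟩ | ⟨h1, rfl⟩ | h | h
  · refine Or.inr ⟨⟨rfl, h⟩, ?_⟩
    rw [← mul_smul]
    exact word_smul_mem_filt (l := l + 1) (by omega) hv
  · left
    obtain ⟨l, rfl⟩ : ∃ j, l = j + 1 := ⟨l - 1, by omega⟩
    simp only [Nat.add_sub_cancel] at *
    rw [word, mul_smul, ← mul_smul, tN_mul_self (by omega), add_smul, one_smul, smul_assoc,
      ← mul_smul (tN _ _ _ _)]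
    exact add_mem (Submodule.smul_mem _ _ (word_smul_mem_filt (l := l + 1) (by omega) hv))
      (word_smul_mem_filt (by omega) hv)
  · left
    rw [← mul_smul, (tN_mul_word l hl).1 i h, mul_smul]
    refine word_smul_mem_filt (by omega) (hS.t_mem i ?_ v hv)
    unfold chainPos at h
    split_ifs at h <;> omega
  · left
    rw [← mul_smul, (tN_mul_word l hl).2 i h hi, mul_smul]
    refine word_smul_mem_filt (by omega) (hS.t_mem (i - 1) ?_ v hv)
    unfold chainPos at h
    split_ifs at h <;> omega

theorem tN_smul_filt {k i : ℕ} (hk : k ≤ 2 * n + 1) (hi : i ≤ n) {g : Q}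
    (hg : g ∈ filt (p := p) (q := q) (n := n) S k) :
    tN p q (n + 1) i • g ∈ filt (p := p) (q := q) (n := n) S (k + 1) := by
  refine smul_filt_le _ (fun l hl v hv => ?_) hg
  rcases tN_smul_word_mem hS (by omega : l ≤ 2 * n + 1) hi hv with h | ⟨⟨_, _⟩, h⟩
  · exact filt_mono (by omega) h
  · exact filt_mono (by omega) h

theorem tN_smul_filt_top {i : ℕ} (hi : i ≤ n) {g : Q}
    (hg : g ∈ filt (p := p) (q := q) (n := n) S (2 * n + 2)) :
    tN p q (n + 1) i • g ∈ filt (p := p) (q := q) (n := n) S (2 * n + 2) := by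
  refine smul_filt_le _ (fun l hl v hv => ?_) hg
  rcases tN_smul_word_mem hS (by omega : l ≤ 2 * n + 1) hi hv with h | ⟨⟨_, _⟩, h⟩
  · exact filt_mono (by omega) h
  · exact filt_mono (by omega) h

/-- The letter that leads from w_{2n} to the longest word is T_n, so the T_i with i < n preserve the
last proper step. The top quotient is therefore a module over the smaller algebra. -/
theorem tN_smul_filt_colevel_one {i : ℕ} (hi : i < n) {g : Q}
    (hg : g ∈ filt (p := p) (q := q) (n := n) S (2 * n + 1)) :
    tN p q (n + 1) i • g ∈ filt (p := p) (q := q) (n := n) S (2 * n + 1) := by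
  refine smul_filt_le _ (fun l hl v hv => ?_) hg
  rcases tN_smul_word_mem hS (by omega : l ≤ 2 * n + 1) hi.le hv with h | ⟨⟨h1, _⟩, h⟩
  · exact filt_mono (by omega) h
  · refine filt_mono ?_ h
    unfold chainIdx at h1
    split_ifs at h1 <;> omega

omit hS in
theorem twist_zero (i : ℕ) (hi : i ≤ n + 1) : twist p q n 0 i = xN p q (n + 1) i := by
  unfold twist chainPos
  split_ifs <;> first | omega | (congr 1; done) | skip
  all_goals simp_all

/-- Compatibility of the lattice with the filtration at level `k`. -/
theorem xN_filt (k : ℕ) (hk : k ≤ 2 * n + 1) :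
    (∀ g ∈ filt (p := p) (q := q) (n := n) S k, ∀ i ≤ n + 1,
      xN p q (n + 1) i • g ∈ filt (p := p) (q := q) (n := n) S k ∧
      (xN p q (n + 1) i)⁻¹ • g ∈ filt (p := p) (q := q) (n := n) S k) ∧
    (∀ v ∈ S, ∀ i ≤ n + 1, xN p q (n + 1) i • word p q n k • v -
      word p q n k • twist p q n k i • v ∈ filt (p := p) (q := q) (n := n) S k) ∧
    (∀ v ∈ S, ∀ i ≤ n + 1, (xN p q (n + 1) i)⁻¹ • word p q n k • v -
      word p q n k • (twist p q n k i)⁻¹ • v ∈ filt (p := p) (q := q) (n := n) S k) ∧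
    (∀ g ∈ filt (p := p) (q := q) (n := n) S (k + 1), ∀ i ≤ n + 1,
      xN p q (n + 1) i • g ∈ filt (p := p) (q := q) (n := n) S (k + 1) ∧
      (xN p q (n + 1) i)⁻¹ • g ∈ filt (p := p) (q := q) (n := n) S (k + 1)) := by
  -- the last two parts follow from the first two
  have aux : ∀ k, (∀ g ∈ filt (p := p) (q := q) (n := n) S k, ∀ i ≤ n + 1,
      xN p q (n + 1) i • g ∈ filt (p := p) (q := q) (n := n) S k ∧
      (xN p q (n + 1) i)⁻¹ • g ∈ filt (p := p) (q := q) (n := n) S k) ∧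
    (∀ v ∈ S, ∀ i ≤ n + 1, xN p q (n + 1) i • word p q n k • v -
      word p q n k • twist p q n k i • v ∈ filt (p := p) (q := q) (n := n) S k) →
    (∀ v ∈ S, ∀ i ≤ n + 1, (xN p q (n + 1) i)⁻¹ • word p q n k • v -
      word p q n k • (twist p q n k i)⁻¹ • v ∈ filt (p := p) (q := q) (n := n) S k) ∧
    (∀ g ∈ filt (p := p) (q := q) (n := n) S (k + 1), ∀ i ≤ n + 1,
      xN p q (n + 1) i • g ∈ filt (p := p) (q := q) (n := n) S (k + 1) ∧
      (xN p q (n + 1) i)⁻¹ • g ∈ filt (p := p) (q := q) (n := n) S (k + 1)) := by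
    rintro k ⟨H1, H2⟩
    have H3 : ∀ v ∈ S, ∀ i ≤ n + 1, (xN p q (n + 1) i)⁻¹ • word p q n k • v -
      word p q n k • (twist p q n k i)⁻¹ • v ∈ filt (p := p) (q := q) (n := n) S k := by
      intro v hv i hi
      -- The congruence for X_i is applied to twist⁻¹ v in place of v and then multiplied by X_i⁻¹.
      have h := (H1 _ (H2 _ (hS.twist_mem (k := k) hi hv).2 i hi) i hi).2
      rw [smul_sub, inv_smul_smul, smul_inv_smul] at h
      rw [← neg_sub]
      exact neg_mem h
    refine ⟨H3, fun g hg i hi => ?_⟩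
    rw [filt, Submodule.mem_sup] at hg
    obtain ⟨g, hg, _, ⟨v, hv, rfl⟩, rfl⟩ := hg
    have hm := filt_mono (p := p) (q := q) (n := n) (S := S) k.le_succ
    constructor
    · rw [smul_add]
      refine add_mem (hm (H1 g hg i hi).1) ?_
      have := add_mem (hm (H2 v hv i hi))
        (word_smul_mem_filt k.lt_succ_self (hS.twist_mem (k := k) hi hv).1)
      simpa using this
    · rw [smul_add]
      refine add_mem (hm (H1 g hg i hi).2) ?_
      have := add_mem (hm (H3 v hv i hi))
        (word_smul_mem_filt k.lt_succ_self (hS.twist_mem (k := k) hi hv).2)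
      simpa using this
  rw [← and_assoc]
  suffices H : _ ∧ _ from ⟨H, aux k H⟩
  induction k with
  | zero =>
    refine ⟨fun g hg i _ => ?_, fun v _ i hi => ?_⟩
    · rw [filt, Submodule.mem_bot] at hg
      simp [hg]
    · simp [word, twist_zero i hi]
  | succ k ih =>
    obtain ⟨G0, X⟩ := ih (by omega)
    obtain ⟨Xi, G⟩ := aux k ⟨G0, X⟩
    refine ⟨G, fun v hv i hi => ?_⟩
    have hdn : chainIdx n k ≤ n := by
      unfold chainIdx
      split_ifs <;> omega
    have hxw : ∀ j ≤ n + 1, ∀ v ∈ S, xN p q (n + 1) j • word p q n k • v ∈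
        filt (p := p) (q := q) (n := n) S (k + 1) := fun j hj v hv =>
      (G _ (word_smul_mem_filt k.lt_succ_self hv) j hj).1
    have hT : ∀ g ∈ filt (p := p) (q := q) (n := n) S k, tN p q (n + 1) (chainIdx n k) • g ∈
        filt (p := p) (q := q) (n := n) S (k + 1) := fun g hg =>
      tN_smul_filt hS (by omega) hdn hg
    -- Moving X_i past the new letter replaces it by its reflected image; the correction terms are
    -- multiples of w_k v and of lattice elements applied to w_k v, so they stay in step k + 1.
    rw [word, mul_smul, mul_smul]
    -- The letter T_0 occurs only in the middle, k = n. Its reflection sends X_0 to X_0 X_1 and X_1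
    -- to X_1⁻¹, which is why the congruences for inverses are carried along.
    rcases Nat.eq_zero_or_pos (chainIdx n k) with h0 | h0
    · have hkn : k = n := by
        unfold chainIdx at h0
        split_ifs at h0 <;> omega
      subst hkn
      by_cases hi2 : i ≠ chainIdx k k ∧ i ≠ chainIdx k k + 1
      · rw [xN_smul_tN_of_ne hi2.1 hi2.2, ← smul_sub,
          twist_succ_of_ne hi2.1 hi2.2 (Or.inr (by omega))]
        exact hT _ (X v hv i hi)
      rw [h0] at hT hi2 ⊢
      rcases (by omega : i = 0 ∨ i = 1) with rfl | rfl
      · rw [xN_zero_smul_tN_zero k.succ_pos, sub_right_comm, ← smul_sub]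
        refine sub_mem (hT _ ?_) (Submodule.smul_mem _ _
          (G _ (hxw 1 (by omega) v hv) 0 (by omega)).1)
        rw [twist_mid_zero, mul_smul]
        have h1 := (G0 _ (X v hv 1 (by omega)) 0 (by omega)).1
        have h2 := X _ (hS.twist_mem (k := k) (i := 1) (by omega) hv).1 0 (by omega)
        rw [smul_sub] at h1
        simpa using add_mem h1 h2
      · rw [xN_one_smul_tN_zero k.succ_pos, add_sub_right_comm, ← smul_sub, twist_mid_one]
        exact add_mem (hT _ (Xi v hv 1 (by omega))) (Submodule.smul_mem _ _
          (add_mem (word_smul_mem_filt k.lt_succ_self hv) (hxw 1 (by omega) v hv)))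
    · rcases (by omega : i = chainIdx n k ∨ i = chainIdx n k + 1 ∨
        (i ≠ chainIdx n k ∧ i ≠ chainIdx n k + 1)) with rfl | rfl | h
      · rw [xN_smul_tN_self h0 (by omega), sub_right_comm, ← smul_sub, twist_succ_idx h0]
        exact sub_mem (hT _ (X v hv _ (by omega))) (Submodule.smul_mem _ _
          (hxw _ (by omega) v hv))
      · rw [twist_succ_idx_succ h0, xN_succ_smul_tN h0 (by omega), add_sub_right_comm, ← smul_sub]
        exact add_mem (hT _ (X v hv _ (by omega))) (Submodule.smul_mem _ _
          (hxw _ (by omega) v hv))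
      · rw [xN_smul_tN_of_ne h.1 h.2, ← smul_sub, twist_succ_of_ne h.1 h.2 (Or.inl h0)]
        exact hT _ (X v hv i hi)

/-- The 2n + 2 words exhaust the cosets, so nothing leaves the last step: no letter follows the
longest word. -/
theorem filt_top_stable (h : HeckeB p q (n + 1)) {g : Q}
    (hg : g ∈ filt (p := p) (q := q) (n := n) S (2 * n + 2)) :
    h • g ∈ filt (p := p) (q := q) (n := n) S (2 * n + 2) := by
  have hX := (xN_filt hS (2 * n + 1) le_rfl).2.2.2
  revert g
  induction h using gen_induction with
  | hs r =>
    intro g hg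
    rw [algebraMap_smul]
    exact Submodule.smul_mem _ _ hg
  | hT i hi => exact fun hg => tN_smul_filt_top hS (by omega) hg
  | hX j hj => exact fun hg => (hX _ hg j hj).1
  | hX' j hj => exact fun hg => (hX _ hg j hj).2
  | hmul a b ha hb =>
    intro g hg
    rw [mul_smul]
    exact ha (hb hg)
  | hadd a b ha hb =>
    intro g hg
    rw [add_smul]
    exact add_mem (ha hg) (hb hg)

end Filtration

end HeckeB

namespace HeckeB

/-! ### Scalar identities behind the braid relations. -/

section RankTwo

variable {K A : Type*} [Field K] [Ring A] [Algebra K A]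

/-- The coefficient identity behind the braid relation of length three. -/
theorem braid_coeff {c : K} {t b₀ b₁ : A} (ht : t * t = c • t + 1) (hb : Commute b₀ b₁)
    (h : b₁ * t = (c • 1 - b₀) * b₁ + t * b₀) :
    t * b₀ * t = (1 + b₀ * (c • 1 - b₀)) * b₁ + b₀ * t * b₀ := by
  have h' : t * b₀ = b₁ * t - (c • 1 - b₀) * b₁ := by rw [h]; abel
  have hb' : b₀ * b₁ = b₁ * b₀ := hb
  rw [mul_assoc b₀ t b₀, h']
  simp only [sub_mul, mul_sub, mul_assoc, ht, add_mul, mul_add, smul_mul_assoc, mul_smul_comm,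
    one_mul, mul_one]
  abel

/-- The coefficient identities behind the braid relation of length four. -/
theorem braid_zero_coeff {c c₀ b : K} {t a e : A} (ht : t * t = c₀ • t + 1) (hae : Commute a e)
    (h : e * t = (c₀ - b) • e + b • (c • 1 - a) + t * a) :
    (c • 1 - a) * (b • t) + t * a * t =
        (1 + b * (c₀ - b)) • e + b • ((c • 1 - a) * (b • 1)) + b • (t * a) ∧
      (1 + a * (c • 1 - a)) * (b • t) + a * (t * a * t) =
        t * ((1 + a * (c • 1 - a)) * (b • 1)) + t * a * t * a := by
  have hP : t * a = e * t - (c₀ - b) • e - b • (c • 1 - a) := by rw [h]; abel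
  have hX : t * a * t = e + b • (e * t) - (b * c) • t + b • (a * t) := by
    rw [hP]
    simp only [sub_mul, mul_assoc, ht, mul_add, smul_mul_assoc, mul_smul_comm, one_mul, mul_one]
    module
  have hae' : a * e = e * a := hae
  refine ⟨?_, ?_⟩
  · rw [hX, hP]
    simp only [sub_mul, mul_smul_comm, mul_one, smul_mul_assoc, one_mul]
    module
  · have hPa : t * a * a = e * (t * a) - (c₀ - b) • (e * a) - (b * c) • a + b • (a * a) := by
      nth_rw 1 [hP]
      simp only [sub_mul, mul_assoc, smul_mul_assoc, one_mul]
      module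
    have haP : a * (t * a) = e * (a * t) - (c₀ - b) • (e * a) - (b * c) • a + b • (a * a) := by
      rw [hP]
      simp only [mul_sub, mul_smul_comm, mul_one, ← mul_assoc, hae']
      module
    rw [hX]
    simp only [mul_add, mul_sub, add_mul, sub_mul, mul_smul_comm, mul_one, one_mul,
      smul_mul_assoc, ← mul_assoc t a a, hPa, mul_assoc e t a, mul_assoc a t a, haP, ← mul_assoc a e t, hae',
      mul_assoc]
    module

end RankTwo

/-! ### Diagonal coefficients of the generic module. -/

variable {F : Type*} [Field F] {p q : Fˣ} {n : ℕ}

/-- A module `W` over an extension field `K` with an action of `H_n`, and a scalar `z` for which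
the denominators occurring in the intertwining operators are invertible. -/
structure GenericScalar {K W : Type*} [Field K] [Algebra F K] [AddCommGroup W] [Module K W]
    [Module F W] [IsScalarTower F K W] (ρ : HeckeB p q n →ₐ[F] Module.End K W) (z : Kˣ) where
  /-- The denominators. -/
  den : ℕ → (Module.End K W)ˣ
  den_lt : ∀ k < n, (den k : Module.End K W) = (z : K) • 1 - ρ (xN p q n (n - k))
  den_self : (den n : Module.End K W) = ((z : K) - 1) • 1
  den_gt : ∀ k, n < k → k ≤ 2 * n → (den k : Module.End K W) = (z : K) • ρ (xN p q n (k - n)) - 1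

namespace GenericScalar

variable {K W : Type*} [Field K] [Algebra F K] [AddCommGroup W] [Module K W]
    [Module F W] [IsScalarTower F K W] {ρ : HeckeB p q n →ₐ[F] Module.End K W} {z : Kˣ}
    (g : GenericScalar ρ z)

variable (p q n K) in
/-- The coefficient of the quadratic relation in step `k` of the chain. -/
def coef (k : ℕ) : K := algebraMap F K (qc p q (chainIdx n k))

variable (ρ z) in
/-- The numerators of the diagonal entries. -/
def num (k : ℕ) : Module.End K W := if k ≤ n then (z : K) • 1 else (z : K) • ρ (xN p q n (k - n))

/-- The diagonal entry of `T_{i_k}` at position `k`. -/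
def beta (k : ℕ) : Module.End K W := coef p q n K k • (num ρ z k * ↑(g.den k)⁻¹)

/-- The diagonal entry of `T_{i_k}` at position `k + 1`. -/
def beta' (k : ℕ) : Module.End K W := coef p q n K k • 1 - g.beta k

/-- The entry of `T_{i_k}` from position `k + 1` to position `k`. -/
def gam (k : ℕ) : Module.End K W := 1 + g.beta k * g.beta' k

/-- `beta` is the coefficient for which T_{i_k} - β is an intertwiner, i.e. carries X-eigenvectors
to eigenvectors for the reflected weight: c / (1 - X_i X_{i+1}⁻¹) for i = i_k ≥ 1 with the current
weights inserted, and cz / (z - 1) for T_0. It is used with its denominator cleared. -/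
theorem beta_mul_den (k : ℕ) : g.beta k * g.den k = coef p q n K k • num ρ z k := by
  rw [beta, smul_mul_assoc, mul_assoc, Units.inv_mul, mul_one]

/-- Apart from z, only X_{i_k} enters `beta k`, and at k = n nothing but scalars does. -/
theorem commute_beta {k : ℕ} (hk : k ≤ 2 * n) {y : Module.End K W}
    (hy : k ≠ n → Commute y (ρ (xN p q n (chainIdx n k)))) : Commute y (g.beta k) := by
  refine Commute.smul_right (Commute.mul_right ?_ (Commute.units_inv_right ?_)) _
  · unfold num
    split_ifs with h
    · exact (Commute.one_right _).smul_right _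
    · have := hy (by omega)
      rw [chainIdx, if_neg h] at this
      exact this.smul_right _
  · rcases lt_trichotomy k n with h | rfl | h
    · rw [g.den_lt k h]
      have := hy h.ne
      rw [chainIdx, if_pos h.le] at this
      exact ((Commute.one_right _).smul_right _).sub_right this
    · rw [g.den_self]
      exact (Commute.one_right _).smul_right _
    · rw [g.den_gt k h hk]
      have := hy h.ne'
      rw [chainIdx, if_neg h.not_ge] at this
      exact (this.smul_right _).sub_right (Commute.one_right _)

theorem commute_den_xN {k : ℕ} (hk : k ≤ 2 * n) (j : ℕ) :
    Commute (g.den k : Module.End K W) (ρ (xN p q n j)) := by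
  have h1 : ∀ i, Commute (ρ (xN p q n i)) (ρ (xN p q n j)) := fun i => (xN_val_comm i j).map ρ
  rcases lt_trichotomy k n with h | rfl | h
  · rw [g.den_lt k h]
    exact ((Commute.one_left _).smul_left _).sub_left (h1 _)
  · rw [g.den_self]
    exact (Commute.one_left _).smul_left _
  · rw [g.den_gt k h hk]
    exact ((h1 _).smul_left _).sub_left (Commute.one_left _)

theorem commute_den_beta {k l : ℕ} (hk : k ≤ 2 * n) (hl : l ≤ 2 * n) :
    Commute (g.den k : Module.End K W) (g.beta l) :=
  g.commute_beta hl fun _ => g.commute_den_xN hk _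

theorem commute_xN_beta {k : ℕ} (hk : k ≤ 2 * n) (j : ℕ) :
    Commute (ρ (xN p q n j)) (g.beta k) :=
  g.commute_beta hk fun _ => (xN_val_comm j _).map ρ

theorem commute_beta_beta {k l : ℕ} (hk : k ≤ 2 * n) (hl : l ≤ 2 * n) :
    Commute (g.beta k) (g.beta l) :=
  g.commute_beta hl fun _ => (g.commute_xN_beta hk _).symm

theorem commute_tN_beta {k i : ℕ} (hk : k ≤ 2 * n)
    (hi : k ≠ n → chainIdx n k ≠ i ∧ chainIdx n k ≠ i + 1) :
    Commute (ρ (tN p q n i)) (g.beta k) :=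
  g.commute_beta hk fun h => (tN_xN_comm (hi h).1 (hi h).2).map ρ

theorem map_tN_mul_self {i : ℕ} (h : i < n) :
    ρ (tN p q n i) * ρ (tN p q n i) =
      algebraMap F K (qc p q i) • ρ (tN p q n i) + 1 := by
  rw [← map_mul, tN_mul_self h, map_add, map_smul, map_one, algebraMap_smul]

/-- If z = 1, the unit `den n` is zero, which is possible only on the zero space. -/
theorem beta_self : g.beta n = (coef p q n K n * z * ((z : K) - 1)⁻¹) • 1 ∧
    (z : K) - 1 ≠ 0 ∨ Subsingleton W := by
  by_cases h : (z : K) - 1 = 0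
  · right
    have h1 := g.den_self
    rw [h, zero_smul] at h1
    have h2 : (1 : Module.End K W) = 0 := by
      rw [← (g.den n).mul_inv, h1, zero_mul]
    exact ⟨fun x y => by
      rw [← Module.End.one_apply (R := K) x, ← Module.End.one_apply (R := K) y, h2]; rfl⟩
  · left
    refine ⟨?_, h⟩
    rw [← Units.mul_left_inj (g.den n), beta_mul_den, g.den_self, num, if_pos le_rfl]
    rw [smul_mul_smul_comm, one_mul, smul_smul, inv_mul_cancel_right₀ h]

/-- The diagonal entries in two consecutive steps of the chain. -/
theorem beta_braid {k : ℕ} (hk : k + 1 ≤ 2 * n) (h : k + 1 < n ∨ n < k) {i : ℕ}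
    (hi : i = min (chainIdx n k) (chainIdx n (k + 1))) :
    g.beta (k + 1) * ρ (tN p q n i) =
      (coef p q n K k • 1 - g.beta k) * g.beta (k + 1) + ρ (tN p q n i) * g.beta k := by
  -- T does not commute with the denominators, so they are cleared on the sides where they stand:
  -- `den (k + 1)` on the left, `den k` on the right.
  rw [← Units.mul_left_inj (g.den k), ← Units.mul_right_inj (g.den (k + 1))]
  have hk0 : k ≤ 2 * n := by omega
  have e0 := g.beta_mul_den k
  have e1 : g.den (k + 1) * g.beta (k + 1) = coef p q n K (k + 1) • num ρ z (k + 1) := by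
    rw [← beta_mul_den, (g.commute_den_beta hk hk).eq]
  have c1 : g.beta (k + 1) * g.den k = g.den k * g.beta (k + 1) :=
    (g.commute_den_beta hk0 hk).symm.eq
  have c2 : (g.den (k + 1) : Module.End K W) * (coef p q n K k • 1 - g.beta k) =
      (coef p q n K k • 1 - g.beta k) * g.den (k + 1) :=
    (((Commute.one_right _).smul_right _).sub_right (g.commute_den_beta hk hk0)).eq
  have c3 : (g.den k : Module.End K W) * g.den (k + 1) = g.den (k + 1) * g.den k := by
    have : ∀ {y : Module.End K W}, (∀ j, Commute y (ρ (xN p q n j))) →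
        Commute y (g.den (k + 1)) := by
      intro y hy
      rcases lt_trichotomy (k + 1) n with h | h | h
      · rw [g.den_lt _ h]
        exact ((Commute.one_right _).smul_right _).sub_right (hy _)
      · omega
      · rw [g.den_gt _ h hk]
        exact ((hy _).smul_right _).sub_right (Commute.one_right _)
    exact (this (g.commute_den_xN hk0)).eq
  have hc : coef p q n K (k + 1) = coef p q n K k := by
    unfold coef qc chainIdx
    split_ifs <;> first | rfl | omega
  have hi1 : 1 ≤ i := by
    unfold chainIdx at hi
    split_ifs at hi <;> omega
  have hin : i < n := by
    unfold chainIdx at hi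
    split_ifs at hi <;> omega
  have hci : coef p q n K k = algebraMap F K (qc p q i) := by
    have : chainIdx n k ≠ 0 := by
      unfold chainIdx
      split_ifs <;> omega
    rw [coef, qc_of_ne_zero this, qc_of_ne_zero (by omega : i ≠ 0)]
  set t := ρ (tN p q n i) with ht
  set c := coef p q n K k with hcdef
  have r1 : t * ρ (xN p q n i) = ρ (xN p q n (i + 1)) * t - c • ρ (xN p q n (i + 1)) := by
    rw [ht, ← map_mul, tN_mul_xN hi1 hin, map_sub, map_mul, map_smul, hci, algebraMap_smul]
  have r2 : t * ρ (xN p q n (i + 1)) = ρ (xN p q n i) * t + c • ρ (xN p q n (i + 1)) := by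
    rw [ht, ← map_mul, tN_mul_xN_succ hi1 hin, map_add, map_mul, map_smul, hci, algebraMap_smul]
  -- The identity without denominators. It is one of the two commutation rules for T_i with X_i and
  -- X_{i+1}, according to the half of the chain.
  have key : num ρ z (k + 1) * (t * g.den k) = (c • g.den k - c • num ρ z k) * num ρ z (k + 1) +
      g.den (k + 1) * (t * num ρ z k) := by
    rcases h with h | h
    · have e2 : n - k = i + 1 := by
        unfold chainIdx at hi
        split_ifs at hi <;> omega
      have e3 : n - (k + 1) = i := by omega
      rw [g.den_lt k (by omega), g.den_lt (k + 1) h, num, num, if_pos (by omega),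
        if_pos (by omega), e2, e3]
      simp only [mul_sub, sub_mul, mul_smul_comm, smul_mul_assoc, mul_one, one_mul, r2, smul_sub]
      module
    · have e2 : k - n = i := by
        unfold chainIdx at hi
        split_ifs at hi <;> omega
      have e3 : k + 1 - n = i + 1 := by omega
      rw [g.den_gt k h hk0, g.den_gt (k + 1) (by omega) hk, num, num, if_neg (by omega),
        if_neg (by omega), e2, e3]
      simp only [mul_sub, sub_mul, mul_smul_comm, smul_mul_assoc, mul_one, one_mul, r1, smul_sub]
      module
  have c4 : (num ρ z (k + 1)) * g.den k = g.den k * num ρ z (k + 1) := by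
    unfold num
    split_ifs
    · simp
    · exact ((g.commute_den_xN hk0 _).smul_right _).symm.eq
  have e2 : (c • 1 - g.beta k) * g.den k = c • g.den k - c • num ρ z k := by
    rw [sub_mul, e0, smul_mul_assoc, one_mul]
  calc (g.den (k + 1) : Module.End K W) * (g.beta (k + 1) * t * g.den k)
      = (g.den (k + 1) * g.beta (k + 1)) * (t * g.den k) := by simp only [mul_assoc]
    _ = c • ((c • g.den k - c • num ρ z k) * num ρ z (k + 1)) +
        g.den (k + 1) * (t * (c • num ρ z k)) := by
      rw [e1, hc, smul_mul_assoc, key, smul_add, mul_smul_comm, mul_smul_comm]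
    _ = g.den (k + 1) * (((c • 1 - g.beta k) * g.beta (k + 1) + t * g.beta k) * g.den k) := by
      rw [add_mul, mul_add, mul_assoc t, e0, mul_assoc _ (g.beta (k + 1)), c1, ← mul_assoc _ (g.den k :
        Module.End K W), e2, ← e2]
      congr 1
      rw [← mul_assoc, ← mul_assoc, c2, mul_assoc _ (g.den (k + 1) : Module.End K W), ← c3]
      simp only [mul_assoc, e1, hc, mul_smul_comm]

/-- The diagonal entries in the three middle steps of the chain. -/
theorem beta_braid_zero (hn : 0 < n) {b : K} (hb : b * ((z : K) - 1) = coef p q n K n * z) :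
    g.beta (n + 1) * ρ (tN p q n 0) =
      (coef p q n K n - b) • g.beta (n + 1) + b • (coef p q n K (n - 1) • 1 - g.beta (n - 1)) +
        ρ (tN p q n 0) * g.beta (n - 1) := by
  obtain ⟨m, rfl⟩ : ∃ m, n = m + 1 := ⟨n - 1, by omega⟩
  simp only [Nat.add_sub_cancel]
  -- With n = m + 1 both outer denominators involve X_1 only; once they are cleared, the rule for
  -- X_1 T_0 X_1 decides the identity.
  rw [← Units.mul_left_inj (g.den m), ← Units.mul_right_inj (g.den (m + 1 + 1))]
  have e0 := g.beta_mul_den m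
  have e1 : g.den (m + 1 + 1) * g.beta (m + 1 + 1) =
      coef p q (m + 1) K (m + 1 + 1) • num ρ z (m + 1 + 1) := by
    rw [← beta_mul_den, (g.commute_den_beta (by omega) (by omega)).eq]
  have c1 : g.beta (m + 1 + 1) * g.den m = g.den m * g.beta (m + 1 + 1) :=
    (g.commute_den_beta (by omega) (by omega)).symm.eq
  have hc : coef p q (m + 1) K (m + 1 + 1) = coef p q (m + 1) K m := by
    unfold coef qc chainIdx
    split_ifs <;> first | rfl | omega
  have d0 : (g.den m : Module.End K W) = (z : K) • 1 - ρ (xN p q (m + 1) 1) := by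
    rw [g.den_lt m (by omega), Nat.add_sub_cancel_left]
  have d1 : (g.den (m + 1 + 1) : Module.End K W) = (z : K) • ρ (xN p q (m + 1) 1) - 1 := by
    rw [g.den_gt (m + 1 + 1) (by omega) (by omega), Nat.add_sub_cancel_left]
  have n0 : num ρ z m = (z : K) • 1 := if_pos (by omega)
  have n1 : num ρ z (m + 1 + 1) = (z : K) • ρ (xN p q (m + 1) 1) := by
    rw [num, if_neg (by omega), Nat.add_sub_cancel_left]
  have r : ρ (xN p q (m + 1) 1) * (ρ (tN p q (m + 1) 0) * ρ (xN p q (m + 1) 1)) =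
      ρ (tN p q (m + 1) 0) + coef p q (m + 1) K (m + 1) •
        (ρ (xN p q (m + 1) 1) + ρ (xN p q (m + 1) 1) * ρ (xN p q (m + 1) 1)) := by
    have := congrArg (· * (xN p q (m + 1) 1 : HeckeB p q (m + 1)))
      (xN_one_mul_tN_zero (p := p) (q := q) m.succ_pos)
    simp only [add_mul, mul_assoc, Units.inv_mul, mul_one, smul_mul_assoc, one_mul] at this
    rw [← map_mul, ← map_mul, this, map_add, map_smul, map_add, map_mul, coef, chainIdx,
      if_pos le_rfl, Nat.sub_self, algebraMap_smul]
  rw [n0] at e0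
  rw [n1] at e1
  set t := ρ (tN p q (m + 1) 0) with ht
  set x := ρ (xN p q (m + 1) 1) with hx
  set c := coef p q (m + 1) K m
  set c₀ := coef p q (m + 1) K (m + 1)
  have c2 : (g.den (m + 1 + 1) : Module.End K W) * g.beta m = g.beta m * g.den (m + 1 + 1) :=
    (g.commute_den_beta (by omega) (by omega)).eq
  have hxm : x * g.den m = g.den m * x := (g.commute_den_xN (by omega) _).symm.eq
  have hxm' : x * g.den (m + 1 + 1) = g.den (m + 1 + 1) * x :=
    (g.commute_den_xN (by omega) _).symm.eq
  have hw : (g.den (m + 1 + 1) : Module.End K W) * (g.beta (m + 1 + 1) * t * g.den m) =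
      (c * z) • (x * (t * g.den m)) := by
    rw [← mul_assoc, ← mul_assoc, e1, hc, smul_smul, smul_mul_assoc, smul_mul_assoc, mul_assoc]
  rw [hw]
  have h1 : (g.den (m + 1 + 1) : Module.End K W) * (g.beta (m + 1 + 1) * g.den m) =
      (c * z) • (x * g.den m) := by
    rw [← mul_assoc, e1, hc, smul_smul, smul_mul_assoc]
  have h2 : (g.den (m + 1 + 1) : Module.End K W) * ((c • 1 - g.beta m) * g.den m) =
      g.den (m + 1 + 1) * (-(c • x)) := by
    rw [sub_mul, e0, d0, smul_mul_assoc, one_mul]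
    congr 1
    module
  have h3 : (g.den (m + 1 + 1) : Module.End K W) * (t * g.beta m * g.den m) =
      (c * z) • (g.den (m + 1 + 1) * t) := by
    rw [mul_assoc t, e0, smul_smul, mul_smul_comm, mul_one, mul_smul_comm]
  rw [add_mul, add_mul, mul_add, mul_add, h3, smul_mul_assoc, smul_mul_assoc, mul_smul_comm,
    mul_smul_comm, h1, h2, d0, d1]
  have hb' : b * z = c₀ * z + b := by linear_combination hb
  simp only [mul_sub, sub_mul, mul_smul_comm, smul_mul_assoc, mul_one, one_mul, r, mul_neg]
  match_scalars <;> first | ring1 | linear_combination (c * (z + 1)) * hb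

end GenericScalar

end HeckeB

/-! ### The operators on W^(2n+2) and the verification of the relations. -/

namespace HeckeB
variable {F : Type*} [Field F] {p q : Fˣ} {n : ℕ}

namespace GenericScalar

variable {K W : Type*} [Field K] [Algebra F K] [AddCommGroup W] [Module K W]
    [Module F W] [IsScalarTower F K W] {ρ : HeckeB p q n →ₐ[F] Module.End K W} {z : Kˣ}
    (g : GenericScalar ρ z)

variable (K W n) in
/-- The inclusion of the `k`-th summand of `W ^ (2 n + 2)` (zero out of range). -/
def emb (k : ℕ) : W →ₗ[K] (Fin (2 * n + 2) → W) :=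
  if h : k < 2 * n + 2 then LinearMap.single K (fun _ => W) ⟨k, h⟩ else 0

theorem emb_apply_self {k : ℕ} (h : k < 2 * n + 2) (v : W) : emb n K W k v ⟨k, h⟩ = v := by
  simp [emb, h]

theorem emb_apply_ne {k : ℕ} {l : Fin (2 * n + 2)} (h : l.val ≠ k) (v : W) :
    emb n K W k v l = 0 := by
  unfold emb
  split_ifs
  · simp only [LinearMap.single_apply]
    exact Pi.single_eq_of_ne (fun e => h (by rw [e])) _
  · rfl

theorem ext_emb {M : Type*} [AddCommGroup M] [Module K M] {f f' : (Fin (2 * n + 2) → W) →ₗ[K] M}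
    (h : ∀ k ≤ 2 * n + 1, ∀ v, f (emb n K W k v) = f' (emb n K W k v)) : f = f' := by
  refine LinearMap.pi_ext fun i v => ?_
  have := h i (by omega) v
  simpa only [emb, i.2, dite_true, LinearMap.single_apply] using this

/-- The operator of `T_i` on the `k`-th summand. -/
def tCol (i k : ℕ) : W →ₗ[K] (Fin (2 * n + 2) → W) :=
  if i = chainIdx n k ∧ k ≤ 2 * n then emb n K W (k + 1) + emb n K W k ∘ₗ g.beta k
  else if 1 ≤ k ∧ i = chainIdx n (k - 1) then
    emb n K W (k - 1) ∘ₗ g.gam (k - 1) + emb n K W k ∘ₗ g.beta' (k - 1)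
  else if i < chainPos n k then emb n K W k ∘ₗ ρ (tN p q n i)
  else emb n K W k ∘ₗ ρ (tN p q n (i - 1))

/-- The operator of `T_i` on `W ^ (2 n + 2)`. -/
def tOp (i : ℕ) : Module.End K (Fin (2 * n + 2) → W) :=
  LinearMap.lsum K (fun _ => W) K fun k => g.tCol i k

theorem tOp_emb {i k : ℕ} (hk : k ≤ 2 * n + 1) (v : W) :
    g.tOp i (emb n K W k v) = g.tCol i k v := by
  have h : k < 2 * n + 2 := by omega
  have e : emb n K W k v = Pi.single ⟨k, h⟩ v := by simp [emb, h]
  rw [tOp, e, LinearMap.lsum_piSingle]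

theorem tOp_up {k : ℕ} (hk : k ≤ 2 * n) (v : W) :
    g.tOp (chainIdx n k) (emb n K W k v) = emb n K W (k + 1) v + emb n K W k (g.beta k v) := by
  rw [tOp_emb g (by omega), tCol, if_pos ⟨rfl, hk⟩]
  rfl

theorem chainIdx_succ_ne (k : ℕ) : chainIdx n k ≠ chainIdx n (k + 1) := by
  unfold chainIdx
  split_ifs <;> omega

theorem tOp_down {k : ℕ} (hk : k ≤ 2 * n) (v : W) :
    g.tOp (chainIdx n k) (emb n K W (k + 1) v) =
      emb n K W k (g.gam k v) + emb n K W (k + 1) (g.beta' k v) := by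
  rw [tOp_emb g (by omega), tCol, if_neg (fun h => chainIdx_succ_ne k h.1),
    if_pos ⟨by omega, by simp⟩]
  rfl

theorem tOp_low {i k : ℕ} (hk : k ≤ 2 * n + 1) (hi : i + 1 < chainPos n k) (v : W) :
    g.tOp i (emb n K W k v) = emb n K W k (ρ (tN p q n i) v) := by
  rw [tOp_emb g hk, tCol, if_neg, if_neg, if_pos (by omega)]
  · rfl
  all_goals
    unfold chainIdx chainPos at *
    split_ifs at * <;> omega

theorem tOp_high {i k : ℕ} (hk : k ≤ 2 * n + 1) (hi : chainPos n k < i) (v : W) :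
    g.tOp i (emb n K W k v) = emb n K W k (ρ (tN p q n (i - 1)) v) := by
  rw [tOp_emb g hk, tCol, if_neg, if_neg, if_neg (by omega)]
  · rfl
  all_goals
    unfold chainIdx chainPos at *
    split_ifs at * <;> omega

/-- A relation that is compatible with `T_{i_k}` passes from position `k` to position `k + 1`. -/
theorem rel_propagate {D Y : Module.End K (Fin (2 * n + 2) → W)} {k : ℕ} (hk : k ≤ 2 * n)
    (hY : D * g.tOp (chainIdx n k) = Y * D) (h : ∀ v, D (emb n K W k v) = 0) (v : W) :
    D (emb n K W (k + 1) v) = 0 := by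
  have e := g.tOp_up hk v
  rw [← sub_eq_iff_eq_add] at e
  rw [← e, map_sub, h, sub_zero, ← Module.End.mul_apply, hY, Module.End.mul_apply, h, map_zero]

/-- On positions k and k + 1, T_{i_k} is a two-by-two block with commuting entries, trace β + β' = c
and determinant ββ' - γ = -1, so Cayley–Hamilton is the quadratic relation. On the other positions a
generator of H_n acts. -/
theorem tOp_quad {i : ℕ} (hi : i ≤ n) :
    g.tOp i * g.tOp i = algebraMap F K (qc p q i) • g.tOp i + 1 := by
  refine ext_emb fun k hk v => ?_
  rw [LinearMap.add_apply, LinearMap.smul_apply, Module.End.one_apply, Module.End.mul_apply]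
  rcases chain_cases hk hi with ⟨rfl, h⟩ | ⟨h1, rfl⟩ | h | h
  · rw [g.tOp_up h, map_add, g.tOp_up h, g.tOp_down h, ← coef]
    simp only [gam, beta', LinearMap.add_apply, LinearMap.sub_apply, LinearMap.smul_apply,
      Module.End.one_apply, Module.End.mul_apply, map_add, map_sub, map_smul, smul_add]
    abel
  · obtain ⟨k, rfl⟩ : ∃ l, k = l + 1 := ⟨k - 1, by omega⟩
    rw [Nat.add_sub_cancel, g.tOp_down (by omega), map_add, g.tOp_up (by omega),
      g.tOp_down (by omega), ← coef]
    simp only [gam, beta', LinearMap.add_apply, LinearMap.sub_apply, LinearMap.smul_apply,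
      Module.End.one_apply, Module.End.mul_apply, map_add, map_sub, map_smul, smul_add, smul_sub]
    abel
  · rw [g.tOp_low hk h, g.tOp_low hk h, ← Module.End.mul_apply, map_tN_mul_self]
    · simp
    · unfold chainPos at h
      split_ifs at h <;> omega
  · have : qc p q i = qc p q (i - 1) := by
      have h0 : 1 ≤ chainPos n k := by
        unfold chainPos
        split_ifs <;> omega
      rw [qc_of_ne_zero (by omega : i ≠ 0), qc_of_ne_zero (by omega : i - 1 ≠ 0)]
    rw [g.tOp_high hk h, g.tOp_high hk h, ← Module.End.mul_apply, map_tN_mul_self, this]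
    · simp
    · omega

/-- For D the difference of the two sides of a relation, D T_i = Y D holds for the generators
involved. Vanishing of D then spreads upwards along the chain, and only positions not entered
through an involved generator need a computation. -/
theorem rel_eq_zero {D : Module.End K (Fin (2 * n + 2) → W)} (P : ℕ → Prop)
    (hP : ∀ i, P i → ∃ Y, D * g.tOp i = Y * D)
    (base : ∀ k ≤ 2 * n + 1, (1 ≤ k → ¬ P (chainIdx n (k - 1))) → ∀ v, D (emb n K W k v) = 0) :
    D = 0 := by
  refine ext_emb fun k => ?_
  induction k with
  | zero => exact fun hk v => base 0 hk (by omega) v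
  | succ k ih =>
    intro hk v
    by_cases h : P (chainIdx n k)
    · obtain ⟨Y, hY⟩ := hP _ h
      exact g.rel_propagate (by omega) hY (ih (by omega)) v
    · exact base _ hk (fun _ => by simpa using h) v

theorem tOp_far {i j : ℕ} (hij : i + 1 < j) (hj : j ≤ n) :
    g.tOp i * g.tOp j = g.tOp j * g.tOp i := by
  rw [← sub_eq_zero]
  have q1 := g.tOp_quad (by omega : i ≤ n)
  have q2 := g.tOp_quad hj
  refine g.rel_eq_zero (fun l => l = i ∨ l = j) ?_ fun k hk hk' v => ?_
  · rintro l (hl | hl) <;> rw [hl]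
    -- The factor is c - T_i = -T_i⁻¹. The same works for the relation of length four; in the one of
    -- length three the two generators are swapped.
    · refine ⟨algebraMap F K (qc p q i) • 1 - g.tOp i, ?_⟩
      simp only [sub_mul, mul_sub, smul_mul_assoc, one_mul, mul_assoc, q1, mul_add,
        mul_smul_comm, mul_one]
      simp only [← mul_assoc, q1, add_mul, smul_mul_assoc, one_mul]
      module
    · refine ⟨algebraMap F K (qc p q j) • 1 - g.tOp j, ?_⟩
      simp only [sub_mul, mul_sub, smul_mul_assoc, one_mul, mul_assoc, q2, mul_add,
        mul_smul_comm, mul_one]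
      simp only [← mul_assoc, q2, add_mul, smul_mul_assoc, one_mul]
      module
  · rw [LinearMap.sub_apply, Module.End.mul_apply, Module.End.mul_apply, sub_eq_zero]
    rcases chain_cases hk (by omega : i ≤ n) with ⟨hi, h⟩ | ⟨h1, hi⟩ | hi | hi
    · have J1 : chainPos n k < j := by
        unfold chainIdx chainPos at *
        split_ifs at * <;> omega
      have J2 : chainPos n (k + 1) < j := by
        unfold chainIdx chainPos at *
        split_ifs at * <;> omega
      have hc := g.commute_tN_beta h (i := j - 1) (fun _ => by omega)
      have hc' := LinearMap.congr_fun hc.eq v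
      simp only [Module.End.mul_apply] at hc'
      rw [g.tOp_high hk J1, hi, g.tOp_up h, g.tOp_up h, map_add, g.tOp_high (by omega) J2,
        g.tOp_high hk J1, hc']
    · exact absurd (Or.inl hi.symm) (hk' h1)
    all_goals
      rcases chain_cases hk hj with ⟨hj', h⟩ | ⟨h1, hj'⟩ | hj' | hj'
    · have J2 : i + 1 < chainPos n (k + 1) := by
        unfold chainIdx chainPos at *
        split_ifs at * <;> omega
      have hc := g.commute_tN_beta h (i := i) (fun _ => by omega)
      have hc' := LinearMap.congr_fun hc.eq v
      simp only [Module.End.mul_apply] at hc'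
      rw [g.tOp_low hk hi, hj', g.tOp_up h, g.tOp_up h, map_add, g.tOp_low (by omega) J2,
        g.tOp_low hk hi, hc']
    · exact absurd (Or.inr hj'.symm) (hk' h1)
    · rw [g.tOp_low hk hi, g.tOp_low hk hj', g.tOp_low hk hj', g.tOp_low hk hi,
        ← Module.End.mul_apply, ← Module.End.mul_apply, ← map_mul, ← map_mul, (tN_far hij).eq]
    · rw [g.tOp_low hk hi, g.tOp_high hk hj', g.tOp_high hk hj', g.tOp_low hk hi,
        ← Module.End.mul_apply, ← Module.End.mul_apply, ← map_mul, ← map_mul,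
        (tN_far (by omega : i + 1 < j - 1)).eq]
    · exfalso
      unfold chainIdx chainPos at *
      split_ifs at * <;> omega
    · exact absurd (Or.inr hj'.symm) (hk' h1)
    · exfalso
      omega
    · have h0 : 1 ≤ chainPos n k := by
        unfold chainPos
        split_ifs <;> omega
      rw [g.tOp_high hk hi, g.tOp_high hk hj', g.tOp_high hk hj', g.tOp_high hk hi,
        ← Module.End.mul_apply, ← Module.End.mul_apply, ← map_mul, ← map_mul,
        (tN_far (by omega : i - 1 + 1 < j - 1)).eq]

/-- Positions k, k + 1, k + 2 form one coset for the two generators, and T_{i_{k+1}} fixes position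
k, T_{i_k} position k + 2. Comparison of coordinates leaves exactly `beta_braid` and `braid_coeff`.
-/
theorem tOp_braid_base {k : ℕ} (hk : k + 1 ≤ 2 * n) (h : k + 1 < n ∨ n < k) (v : W) :
    g.tOp (chainIdx n (k + 1)) (g.tOp (chainIdx n k) (g.tOp (chainIdx n (k + 1)) (emb n K W k v))) =
    g.tOp (chainIdx n k) (g.tOp (chainIdx n (k + 1)) (g.tOp (chainIdx n k) (emb n K W k v))) := by
  obtain ⟨i, hi⟩ : ∃ i, i = min (chainIdx n k) (chainIdx n (k + 1)) := ⟨_, rfl⟩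
  have hin : i < n := by
    unfold chainIdx at hi
    split_ifs at hi <;> omega
  have hA : ∀ v, g.tOp (chainIdx n (k + 1)) (emb n K W k v) =
      emb n K W k (ρ (tN p q n i) v) := by
    intro v
    rcases h with h | h
    · have e : chainIdx n (k + 1) = i := by
        unfold chainIdx at *
        split_ifs at * <;> omega
      rw [e, g.tOp_low (by omega)]
      unfold chainIdx chainPos at *
      split_ifs at * <;> omega
    · have e : chainIdx n (k + 1) = i + 1 := by
        unfold chainIdx at *
        split_ifs at * <;> omega
      rw [e, g.tOp_high (by omega), Nat.add_sub_cancel]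
      unfold chainIdx chainPos at *
      split_ifs at * <;> omega
  have hB : ∀ v, g.tOp (chainIdx n k) (emb n K W (k + 2) v) =
      emb n K W (k + 2) (ρ (tN p q n i) v) := by
    intro v
    rcases h with h | h
    · have e : chainIdx n k = i + 1 := by
        unfold chainIdx at *
        split_ifs at * <;> omega
      rw [e, g.tOp_high (by omega), Nat.add_sub_cancel]
      unfold chainIdx chainPos at *
      split_ifs at * <;> omega
    · have e : chainIdx n k = i := by
        unfold chainIdx at *
        split_ifs at * <;> omega
      rw [e, g.tOp_low (by omega)]
      unfold chainIdx chainPos at *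
      split_ifs at * <;> omega
  have e1 := g.beta_braid hk h hi
  have hc : algebraMap F K (qc p q i) = coef p q n K k := by
    have h1 : chainIdx n k ≠ 0 := by
      unfold chainIdx
      split_ifs <;> omega
    have h2 : i ≠ 0 := by
      unfold chainIdx at hi
      split_ifs at hi <;> omega
    rw [coef, qc_of_ne_zero h1, qc_of_ne_zero h2]
  have ht := map_tN_mul_self (ρ := ρ) hin
  rw [hc] at ht
  have e2 := braid_coeff ht (g.commute_beta_beta (by omega) hk) e1
  have e1v := LinearMap.congr_fun e1 v
  have e2v := LinearMap.congr_fun e2 v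
  simp only [Module.End.mul_apply, LinearMap.add_apply] at e1v e2v
  simp only [hA, hB, g.tOp_up hk, g.tOp_up (by omega : k ≤ 2 * n),
    g.tOp_down (by omega : k ≤ 2 * n), map_add, gam, beta', e1v, e2v, Module.End.mul_apply,
    LinearMap.add_apply]
  abel

theorem tOp_braid {i : ℕ} (hi : 1 ≤ i) (hin : i + 1 ≤ n) :
    g.tOp i * g.tOp (i + 1) * g.tOp i = g.tOp (i + 1) * g.tOp i * g.tOp (i + 1) := by
  rw [← sub_eq_zero]
  have q1 := g.tOp_quad (by omega : i ≤ n)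
  have q2 := g.tOp_quad hin
  rw [qc_of_ne_zero (by omega)] at q1 q2
  refine g.rel_eq_zero (fun l => l = i ∨ l = i + 1) ?_ fun k hk hk' v => ?_
  · rintro l (hl | hl) <;> rw [hl]
    · refine ⟨algebraMap F K (qc p q 1) • 1 - g.tOp (i + 1), ?_⟩
      simp only [sub_mul, mul_sub, smul_mul_assoc, one_mul, mul_assoc, q1, mul_add,
        mul_smul_comm, mul_one]
      simp only [← mul_assoc, q2, add_mul, smul_mul_assoc, one_mul]
      module
    · refine ⟨algebraMap F K (qc p q 1) • 1 - g.tOp i, ?_⟩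
      simp only [sub_mul, mul_sub, smul_mul_assoc, one_mul, mul_assoc, q2, mul_add,
        mul_smul_comm, mul_one]
      simp only [← mul_assoc, q1, add_mul, smul_mul_assoc, one_mul]
      module
  · simp only [LinearMap.sub_apply, Module.End.mul_apply]
    rw [sub_eq_zero]
    have hk1 : 1 ≤ k → chainIdx n (k - 1) ≠ i ∧ chainIdx n (k - 1) ≠ i + 1 := fun h =>
      not_or.1 (hk' h)
    -- At a starting position either both generators act through H_n, where the braid relation is
    -- known, or the next two letters of the chain are these two generators, in one of the two
    -- orders.
    rcases (by
      unfold chainIdx chainPos at *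
      split_ifs at * <;> omega : i + 1 + 1 < chainPos n k ∨ chainPos n k < i ∨
        (k + 1 < n ∧ chainIdx n k = i + 1 ∧ chainIdx n (k + 1) = i) ∨
        (n < k ∧ k + 1 ≤ 2 * n ∧ chainIdx n k = i ∧ chainIdx n (k + 1) = i + 1))
      with h | h | ⟨h, h1, h2⟩ | ⟨h, h', h1, h2⟩
    · simp only [g.tOp_low hk h, g.tOp_low hk (by omega : i + 1 < chainPos n k)]
      simp only [← Module.End.mul_apply, ← map_mul]
      rw [← mul_assoc, ← mul_assoc, tN_braid hi]
      unfold chainPos at h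
      split_ifs at h <;> omega
    · have h0 : 1 ≤ chainPos n k := by
        unfold chainPos
        split_ifs <;> omega
      obtain ⟨i, rfl⟩ : ∃ j, i = j + 1 := ⟨i - 1, by omega⟩
      simp only [g.tOp_high hk h, g.tOp_high hk (by omega : chainPos n k < i + 1 + 1),
        Nat.add_sub_cancel]
      simp only [← Module.End.mul_apply, ← map_mul]
      rw [← mul_assoc, ← mul_assoc, tN_braid (by omega) (by omega)]
    · have := g.tOp_braid_base (by omega) (Or.inl h) v
      rwa [h1, h2] at this
    · have := g.tOp_braid_base h' (Or.inr h) v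
      rw [h1, h2] at this
      exact this.symm

theorem tOp_braid_zero (hn : 1 ≤ n) :
    g.tOp 1 * g.tOp 0 * g.tOp 1 * g.tOp 0 = g.tOp 0 * g.tOp 1 * g.tOp 0 * g.tOp 1 := by
  rw [← sub_eq_zero]
  have q1 := g.tOp_quad (by omega : 0 ≤ n)
  have q2 := g.tOp_quad hn
  refine g.rel_eq_zero (fun l => l = 0 ∨ l = 1) ?_ fun k hk hk' v => ?_
  · rintro l (hl | hl) <;> rw [hl]
    · refine ⟨algebraMap F K (qc p q 0) • 1 - g.tOp 0, ?_⟩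
      simp only [sub_mul, mul_sub, smul_mul_assoc, one_mul, mul_assoc, q1, mul_add,
        mul_smul_comm, mul_one]
      simp only [← mul_assoc, q1, add_mul, smul_mul_assoc, one_mul]
      module
    · refine ⟨algebraMap F K (qc p q 1) • 1 - g.tOp 1, ?_⟩
      simp only [sub_mul, mul_sub, smul_mul_assoc, one_mul, mul_assoc, q2, mul_add,
        mul_smul_comm, mul_one]
      simp only [← mul_assoc, q2, add_mul, smul_mul_assoc, one_mul]
      module
  · simp only [LinearMap.sub_apply, Module.End.mul_apply]
    rw [sub_eq_zero]
    have hk1 : 1 ≤ k → chainIdx n (k - 1) ≠ 0 ∧ chainIdx n (k - 1) ≠ 1 := fun h =>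
      not_or.1 (hk' h)
    rcases (by
      unfold chainIdx chainPos at *
      split_ifs at * <;> omega : 0 + 1 + 1 < chainPos n k ∨ k + 1 = n) with h | h
    · simp only [g.tOp_low hk h, g.tOp_low hk (by omega : 0 + 1 < chainPos n k)]
      simp only [← Module.End.mul_apply, ← map_mul]
      have hbr := tN_braid_zero (p := p) (q := q) (n := n) (by
        unfold chainPos at h
        split_ifs at h <;> omega)
      simp only [mul_assoc] at hbr
      simp only [hbr]
    · subst h
      rcases g.beta_self with ⟨hb, hz⟩ | hs
      · set b : K := coef p q (k + 1) K (k + 1) * z * ((z : K) - 1)⁻¹ with hbdef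
        have e1 := g.beta_braid_zero (by omega) (b := b) (by
          rw [hbdef, inv_mul_cancel_right₀ hz])
        have ht := map_tN_mul_self (ρ := ρ) (i := 0) (by omega : 0 < k + 1)
        have hc0 : algebraMap F K (qc p q 0) = coef p q (k + 1) K (k + 1) := by
          simp [coef, chainIdx]
        have hc2 : coef p q (k + 1) K (k + 1 + 1) = coef p q (k + 1) K k := by
          unfold coef qc chainIdx
          split_ifs <;> first | rfl | omega
        rw [hc0] at ht
        rw [Nat.add_sub_cancel] at e1
        obtain ⟨e2, e3⟩ := braid_zero_coeff ht
          (g.commute_beta_beta (by omega : k ≤ 2 * (k + 1)) (by omega : k + 1 + 1 ≤ 2 * (k + 1))) e1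
        have d0 : chainIdx (k + 1) k = 1 := by simp [chainIdx]
        have d1 : chainIdx (k + 1) (k + 1) = 0 := by simp [chainIdx]
        have d2 : chainIdx (k + 1) (k + 2) = 1 := by simp [chainIdx]
        have u0 := g.tOp_up (k := k) (by omega)
        have u1 := g.tOp_up (k := k + 1) (by omega)
        have u2 := g.tOp_up (k := k + 2) (by omega)
        have w0 := g.tOp_down (k := k) (by omega)
        have w1 := g.tOp_down (k := k + 1) (by omega)
        have f0 := g.tOp_low (k := k) (i := 0) (by omega) (by
          unfold chainPos
          split_ifs <;> omega)
        have f3 := g.tOp_low (k := k + 1 + 2) (i := 0) (by omega) (by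
          unfold chainPos
          split_ifs <;> omega)
        rw [d0] at u0 w0
        rw [d1] at u1 w1
        rw [d2] at u2
        have e1v := LinearMap.congr_fun e1 v
        have e2v := LinearMap.congr_fun e2 v
        have e3v := LinearMap.congr_fun e3 v
        simp only [Module.End.mul_apply, LinearMap.add_apply, LinearMap.smul_apply,
          LinearMap.sub_apply, Module.End.one_apply, map_smul, map_add, map_sub] at e1v e2v e3v
        simp only [f0, u0, u1, u2, w0, w1, f3, map_add, gam, beta', hb, Module.End.mul_apply,
          LinearMap.add_apply, LinearMap.smul_apply, LinearMap.sub_apply, Module.End.one_apply,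
          map_smul, map_sub]
        -- Both sides live on positions k, …, k + 3. They agree visibly at k + 3; the other three
        -- coordinates are the three prepared identities.
        have E1 := congrArg (emb (k + 1) K W (k + 2)) e1v
        have E2 := congrArg (emb (k + 1) K W (k + 1)) e2v
        have E3 := congrArg (emb (k + 1) K W k) e3v
        simp only [map_add, map_smul, map_sub] at E1 E2 E3
        simp only [show k + 1 + 1 = k + 2 from rfl, show k + 1 + 2 = k + 3 from rfl] at E1 E2 E3 ⊢
        linear_combination (norm := module) E1 + E2 + E3
      · have : v = 0 := Subsingleton.elim _ _
        simp [this]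

variable (ρ z) in
/-- The eigenvalue of `X_i` on the `k`-th summand. -/
def xi (k i : ℕ) : (Module.End K W)ˣ :=
  if i = 0 then
    (if k ≤ n then Units.map (ρ : _ →* _) (xN p q n 0)
      else Units.map (algebraMap K (Module.End K W) : _ →* _) z * Units.map (ρ : _ →* _) (xN p q n 0))
  else if i < chainPos n k then Units.map (ρ : _ →* _) (xN p q n i)
  else if i = chainPos n k then
    (if k ≤ n then Units.map (algebraMap K (Module.End K W) : _ →* _) z
      else (Units.map (algebraMap K (Module.End K W) : _ →* _) z)⁻¹)
  else Units.map (ρ : _ →* _) (xN p q n (i - 1))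

variable (ρ z) in
/-- The operator of `X_i`. -/
def xOp (i : ℕ) : (Module.End K (Fin (2 * n + 2) → W))ˣ where
  val := LinearMap.pi fun k => (xi ρ z k i : Module.End K W) ∘ₗ LinearMap.proj k
  inv := LinearMap.pi fun k => ((xi ρ z k i)⁻¹ : (Module.End K W)ˣ).val ∘ₗ LinearMap.proj k
  val_inv := by
    refine LinearMap.ext fun f => funext fun k => ?_
    exact LinearMap.congr_fun (xi ρ z k i).mul_inv _
  inv_val := by
    refine LinearMap.ext fun f => funext fun k => ?_
    exact LinearMap.congr_fun (xi ρ z k i).inv_mul _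

theorem xOp_emb {i k : ℕ} (v : W) :
    (xOp ρ z i : Module.End K (Fin (2 * n + 2) → W)) (emb n K W k v) =
      emb n K W k ((xi ρ z k i : Module.End K W) v) := by
  ext l
  change (xi ρ z l i : Module.End K W) (emb n K W k v l) = _
  by_cases h : l.val = k
  · subst h
    rw [emb_apply_self l.2, emb_apply_self l.2]
  · rw [emb_apply_ne h, emb_apply_ne h, map_zero]

theorem xi_low {k i : ℕ} (h0 : i ≠ 0) (h : i < chainPos n k) :
    (xi ρ z k i : Module.End K W) = ρ (xN p q n i) := by
  rw [xi, if_neg h0, if_pos h]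
  rfl

theorem xi_high {k i : ℕ} (h : chainPos n k < i) :
    (xi ρ z k i : Module.End K W) = ρ (xN p q n (i - 1)) := by
  rw [xi, if_neg (by omega), if_neg (by omega), if_neg (by omega)]
  rfl

theorem xi_pos {k i : ℕ} (h : i = chainPos n k) (h0 : i ≠ 0) (hk : k ≤ n) :
    (xi ρ z k i : Module.End K W) = (z : K) • 1 := by
  rw [xi, if_neg h0, if_neg (by omega), if_pos h, if_pos hk]
  exact Algebra.algebraMap_eq_smul_one _

theorem xi_neg {k i : ℕ} (h : i = chainPos n k) (h0 : i ≠ 0) (hk : n < k) :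
    (xi ρ z k i : Module.End K W) = (z⁻¹ : K) • 1 := by
  rw [xi, if_neg h0, if_neg (by omega), if_pos h, if_neg (by omega), ← map_inv]
  change algebraMap K (Module.End K W) ((z⁻¹ : Kˣ) : K) = _
  rw [Units.val_inv_eq_inv_val, Algebra.algebraMap_eq_smul_one]

theorem xi_zero_le {k : ℕ} (hk : k ≤ n) :
    (xi ρ z k 0 : Module.End K W) = ρ (xN p q n 0) := by
  rw [xi, if_pos rfl, if_pos hk]
  rfl

theorem xi_zero_gt {k : ℕ} (hk : n < k) :
    (xi ρ z k 0 : Module.End K W) = (z : K) • ρ (xN p q n 0) := by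
  rw [xi, if_pos rfl, if_neg (by omega), Units.val_mul]
  exact (Algebra.smul_def _ _).symm

theorem commute_xi {y : Module.End K W} {k i : ℕ}
    (hy : (i = 0 ∨ i < chainPos n k → Commute y (ρ (xN p q n i))))
    (hy' : chainPos n k < i → Commute y (ρ (xN p q n (i - 1)))) :
    Commute y (xi ρ z k i : Module.End K W) := by
  rcases Nat.eq_zero_or_pos i with rfl | h0
  · rcases le_or_gt k n with hk | hk
    · rw [xi_zero_le hk]
      exact hy (Or.inl rfl)
    · rw [xi_zero_gt hk]
      exact (hy (Or.inl rfl)).smul_right _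
  · rcases lt_trichotomy i (chainPos n k) with h | h | h
    · rw [xi_low h0.ne' h]
      exact hy (Or.inr h)
    · rcases le_or_gt k n with hk | hk
      · rw [xi_pos h h0.ne' hk]
        exact (Commute.one_right _).smul_right _
      · rw [xi_neg h h0.ne' hk]
        exact (Commute.one_right _).smul_right _
    · rw [xi_high h]
      exact hy' h

theorem commute_xN_xi (k i j : ℕ) :
    Commute (ρ (xN p q n j)) (xi ρ z k i : Module.End K W) :=
  commute_xi (fun _ => (xN_val_comm _ _).map ρ) (fun _ => (xN_val_comm _ _).map ρ)

theorem xOp_comm (i j : ℕ) : (xOp ρ z i : Module.End K (Fin (2 * n + 2) → W)) * xOp ρ z j =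
    xOp ρ z j * xOp ρ z i := by
  refine ext_emb fun k _ v => ?_
  simp only [Module.End.mul_apply, xOp_emb]
  have h : Commute (xi ρ z k i : Module.End K W) (xi ρ z k j) :=
    commute_xi (fun _ => (commute_xN_xi k i j).symm) (fun _ => (commute_xN_xi k i _).symm)
  congr 1
  exact LinearMap.congr_fun h.eq v

theorem chain_mid {k : ℕ} (h : chainIdx n k = 0) : k = n := by
  unfold chainIdx at h
  split_ifs at h <;> omega

theorem chainPos_pos (k : ℕ) : 1 ≤ chainPos n k := by
  unfold chainPos
  split_ifs <;> omega

theorem xi_succ_of_ne {k i : ℕ} (h1 : i ≠ chainIdx n k) (h2 : i ≠ chainIdx n k + 1) :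
    xi ρ z (k + 1) i = xi ρ z k i := by
  rcases Nat.eq_zero_or_pos (chainIdx n k) with h0 | h0
  · obtain rfl := chain_mid h0
    have e1 : chainPos k k = 1 := by simp [chainPos]
    have e2 : chainPos k (k + 1) = 1 := by simp [chainPos]
    simp [xi, e1, e2, (show i ≠ 0 by omega), (show i ≠ 1 by omega)]
  · rcases chain_step h0 with ⟨h3, h4, h5⟩ | ⟨h3, h4, h5⟩
    · have : i < chainIdx n k + 1 ↔ i < chainIdx n k := by omega
      simp [xi, h4, h5, h1, h2, h3, Nat.le_of_succ_le h3, this]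
    · have : i < chainIdx n k + 1 ↔ i < chainIdx n k := by omega
      simp [xi, h4, h5, h1, h2, h3.not_ge, (show ¬ k + 1 ≤ n by omega), this]

theorem xi_succ_idx {k : ℕ} (hk : 1 ≤ chainIdx n k) :
    xi ρ z (k + 1) (chainIdx n k) = xi ρ z k (chainIdx n k + 1) := by
  rcases chain_step hk with ⟨h1, h2, h3⟩ | ⟨h1, h2, h3⟩
  · simp [xi, h2, h3, h1, (Nat.le_of_succ_le h1), Nat.one_le_iff_ne_zero.1 hk]
  · simp [xi, h2, h3, Nat.one_le_iff_ne_zero.1 hk]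

theorem xi_succ_idx_succ {k : ℕ} (hk : 1 ≤ chainIdx n k) :
    xi ρ z (k + 1) (chainIdx n k + 1) = xi ρ z k (chainIdx n k) := by
  rcases chain_step hk with ⟨h1, h2, h3⟩ | ⟨h1, h2, h3⟩
  · simp [xi, h2, h3, Nat.one_le_iff_ne_zero.1 hk]
  · simp [xi, h2, h3, Nat.one_le_iff_ne_zero.1 hk, h1.not_ge,
      (show ¬ k + 1 ≤ n by omega)]

theorem commute_xi_beta {k : ℕ} (hk : k ≤ 2 * n) (l i : ℕ) :
    Commute (xi ρ z l i : Module.End K W) (g.beta k) :=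
  g.commute_beta hk fun _ => (commute_xN_xi _ _ _).symm

/-- The intertwining property of T_{i_k} - β in coefficients; this equation determines `beta` for
i_k ≥ 1. -/
theorem beta_mul_xi {k : ℕ} (hk : k ≤ 2 * n) (h0 : 1 ≤ chainIdx n k) :
    g.beta k * xi ρ z k (chainIdx n k) =
      xi ρ z k (chainIdx n k + 1) * (g.beta k - coef p q n K k • 1) := by
  have hd := g.beta_mul_den k
  have hc := (g.commute_xi_beta hk k (chainIdx n k + 1)).eq
  rw [mul_sub, hc, mul_smul_comm, mul_one]
  rcases chain_step h0 with ⟨h1, h2, h3⟩ | ⟨h1, h2, h3⟩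
  · rw [xi_pos h2.symm (by omega) (by omega), xi_low (by omega) (by omega)]
    rw [g.den_lt k (by omega), num, if_pos (by omega), mul_sub, sub_eq_iff_eq_add] at hd
    rw [hd, chainIdx, if_pos (by omega)]
    abel
  · rw [xi_neg h2.symm (by omega) h1, xi_high (by omega), Nat.add_sub_cancel]
    rw [g.den_gt k h1 hk, num, if_neg (by omega), mul_sub, mul_one, mul_smul_comm,
      sub_eq_iff_eq_add] at hd
    have hd' := congrArg (fun y => (z⁻¹ : K) • y) hd
    simp only [smul_add, smul_smul, inv_mul_cancel₀ z.ne_zero, one_smul,  mul_comm _ (z : K), inv_mul_cancel_left₀ z.ne_zero] at hd'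
    have e : chainIdx n k = k - n := by
      rw [chainIdx, if_neg (by omega)]
    rw [e, hd', mul_smul_comm, mul_one]
    abel

theorem tOp_xOp_comm {i j : ℕ} (hi : i ≤ n) (h1 : j ≠ i) (h2 : j ≠ i + 1) :
    g.tOp i * xOp ρ z j = xOp ρ z j * g.tOp i := by
  rw [← sub_eq_zero]
  have q1 := g.tOp_quad hi
  refine g.rel_eq_zero (fun l => l = i) ?_ fun k hk hk' v => ?_
  · rintro l hl
    rw [hl]
    refine ⟨algebraMap F K (qc p q i) • 1 - g.tOp i, ?_⟩
    simp only [sub_mul, mul_sub, smul_mul_assoc, one_mul, mul_assoc, q1, mul_add,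
      mul_smul_comm, mul_one]
    simp only [← mul_assoc, q1, add_mul, smul_mul_assoc, one_mul]
    module
  · rw [LinearMap.sub_apply, sub_eq_zero, Module.End.mul_apply, Module.End.mul_apply, xOp_emb]
    have J0 := chainPos_pos (n := n) k
    rcases chain_cases hk hi with ⟨hi, h⟩ | ⟨h3, hi⟩ | hi | hi
    · rw [hi] at h1 h2 ⊢
      have hc := LinearMap.congr_fun (g.commute_xi_beta h k j).eq v
      simp only [Module.End.mul_apply] at hc
      rw [g.tOp_up h, g.tOp_up h, map_add, xOp_emb, xOp_emb, xi_succ_of_ne h1 h2, hc]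
    · exact absurd hi.symm (hk' h3)
    · rw [g.tOp_low hk hi, g.tOp_low hk hi, xOp_emb]
      have hc : Commute (ρ (tN p q n i)) (xi ρ z k j : Module.End K W) :=
        commute_xi (fun _ => (tN_xN_comm h1 h2).map ρ)
          (fun _ => (tN_xN_comm (by omega) (by omega)).map ρ)
      congr 1
      exact LinearMap.congr_fun hc.eq v
    · rw [g.tOp_high hk hi, g.tOp_high hk hi, xOp_emb]
      have hc : Commute (ρ (tN p q n (i - 1))) (xi ρ z k j : Module.End K W) :=
        commute_xi (fun _ => (tN_xN_comm (by omega) (by omega)).map ρ)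
          (fun _ => (tN_xN_comm (by omega) (by omega)).map ρ)
      congr 1
      exact LinearMap.congr_fun hc.eq v

theorem tOp_mul_sub {i : ℕ} (hi : i ≤ n) :
    (g.tOp i - algebraMap F K (qc p q i) • 1) * g.tOp i = 1 := by
  rw [sub_mul, g.tOp_quad hi, smul_mul_assoc, one_mul]
  abel

theorem tOp_mixed_pos {i : ℕ} (h0 : 1 ≤ i) (hi : i ≤ n) :
    g.tOp i * xOp ρ z i * g.tOp i = xOp ρ z (i + 1) := by
  -- Since T - c = T⁻¹, the relation is equivalent to T X_i = X_{i+1} (T - c), which can be read off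
  -- column by column.
  have key : g.tOp i * xOp ρ z i =
      xOp ρ z (i + 1) * (g.tOp i - algebraMap F K (qc p q i) • 1) := by
    refine ext_emb fun k hk v => ?_
    rw [Module.End.mul_apply, Module.End.mul_apply, xOp_emb, LinearMap.sub_apply,
      LinearMap.smul_apply, Module.End.one_apply, map_sub, map_smul, xOp_emb]
    rcases chain_cases hk hi with ⟨rfl, h⟩ | ⟨h1, rfl⟩ | h | h
    · have e := LinearMap.congr_fun (g.beta_mul_xi h h0) v
      simp only [Module.End.mul_apply, LinearMap.sub_apply, LinearMap.smul_apply,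
        Module.End.one_apply, map_sub, map_smul] at e
      rw [g.tOp_up h, g.tOp_up h, map_add, xOp_emb, xOp_emb, xi_succ_idx_succ h0, e, ← coef]
      simp only [map_sub, map_smul]
      abel
    · obtain ⟨k, rfl⟩ : ∃ l, k = l + 1 := ⟨k - 1, by omega⟩
      rw [Nat.add_sub_cancel] at *
      have h : k ≤ 2 * n := by omega
      have e := LinearMap.congr_fun (g.beta_mul_xi h h0) v
      have hc := g.commute_xi_beta h k (chainIdx n k + 1)
      have hc1 := LinearMap.congr_fun hc.eq v
      have hc2 := LinearMap.congr_fun (g.commute_xi_beta h k (chainIdx n k)).eq v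
      have hg : Commute (xi ρ z k (chainIdx n k + 1) : Module.End K W) (g.gam k) :=
        (Commute.one_right _).add_right
          (hc.mul_right (((Commute.one_right _).smul_right _).sub_right hc))
      have hg1 := LinearMap.congr_fun hg.eq v
      simp only [Module.End.mul_apply, LinearMap.sub_apply, LinearMap.smul_apply,
        Module.End.one_apply, map_sub, map_smul] at e hc1 hc2 hg1
      rw [g.tOp_down h, g.tOp_down h, map_add, xOp_emb, xOp_emb, xi_succ_idx_succ h0,
        xi_succ_idx h0, hg1, beta', ← coef]
      simp only [map_sub, map_smul, LinearMap.sub_apply, LinearMap.smul_apply,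
        Module.End.one_apply]
      rw [← hc1, hc2, e]
      simp only [map_sub, map_smul]
      abel
    · have hin : i < n := by
        unfold chainPos at h
        split_ifs at h <;> omega
      have e := LinearMap.congr_fun (congrArg ρ (tN_mul_xN (p := p) (q := q) h0 hin)) v
      simp only [map_mul, map_sub, map_smul, Module.End.mul_apply, LinearMap.sub_apply,
        LinearMap.smul_apply] at e
      rw [xi_low (by omega) (by omega), xi_low (by omega) h, g.tOp_low hk h, g.tOp_low hk h,
        xOp_emb, xi_low (by omega) h, e, map_sub, ← algebraMap_smul K (qc p q i) (ρ _ v), map_smul]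
    · have J0 := chainPos_pos (n := n) k
      have hq : qc p q i = qc p q (i - 1) := by
        rw [qc_of_ne_zero (by omega : i ≠ 0), qc_of_ne_zero (by omega : i - 1 ≠ 0)]
      have e := LinearMap.congr_fun (congrArg ρ (tN_mul_xN (p := p) (q := q) (i := i - 1) (n := n)
        (by omega) (by omega))) v
      simp only [map_mul, map_sub, map_smul, Module.End.mul_apply, LinearMap.sub_apply,
        LinearMap.smul_apply, Nat.sub_add_cancel h0] at e
      rw [xi_high (by omega), xi_high (by omega), g.tOp_high hk h, g.tOp_high hk h,
        xOp_emb, xi_high (by omega), Nat.add_sub_cancel, e, map_sub,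
        ← algebraMap_smul K (qc p q (i - 1)) (ρ _ v), map_smul, hq]
  rw [key, mul_assoc, g.tOp_mul_sub hi, mul_one]

theorem tOp_mixed_zero :
    g.tOp 0 * xOp ρ z 0 * g.tOp 0 = xOp ρ z 0 * xOp ρ z 1 := by
  have hi : 0 ≤ n := n.zero_le
  have e1 : chainPos n n = 1 := by simp [chainPos]
  have e2 : chainPos n (n + 1) = 1 := by simp [chainPos]
  -- The equation (z - 1) β = cz in the middle of the chain; it plays the part of `beta_mul_xi` for
  -- T_0.
  have hb : (z : K) • g.beta n = g.beta n + (coef p q n K n * z) • 1 := by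
    have := g.beta_mul_den n
    rw [g.den_self, num, if_pos le_rfl, mul_smul_comm, mul_one, sub_smul, one_smul,
      sub_eq_iff_eq_add, smul_smul] at this
    rw [this, add_comm]
  have hc0 : algebraMap F K (qc p q 0) = coef p q n K n := by
    rw [coef, chainIdx, if_pos le_rfl, Nat.sub_self]
  have key : g.tOp 0 * xOp ρ z 0 =
      xOp ρ z 0 * xOp ρ z 1 * (g.tOp 0 - algebraMap F K (qc p q 0) • 1) := by
    refine ext_emb fun k hk v => ?_
    rw [Module.End.mul_apply, Module.End.mul_apply, xOp_emb, LinearMap.sub_apply,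
      LinearMap.smul_apply, Module.End.one_apply, map_sub, map_smul, Module.End.mul_apply,
      Module.End.mul_apply, xOp_emb, xOp_emb]
    rcases chain_cases hk hi with ⟨h0, h⟩ | ⟨h1, h0⟩ | h | h
    · obtain rfl := chain_mid h0.symm
      have u := g.tOp_up h
      rw [← h0] at u
      rw [u, u, hc0]
      simp only [map_add, xOp_emb]
      rw [xi_zero_le le_rfl, xi_zero_gt (by omega), xi_neg e2.symm one_ne_zero (by omega),
        xi_pos e1.symm one_ne_zero le_rfl]
      have hc := LinearMap.congr_fun (g.commute_xN_beta h 0).eq v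
      have hbv := LinearMap.congr_fun hb v
      simp only [Module.End.mul_apply, LinearMap.smul_apply, LinearMap.add_apply,
        Module.End.one_apply, map_smul, smul_smul] at hc hbv ⊢
      have hbx := congrArg (emb k K W k) (congrArg (ρ (xN p q k 0) : Module.End K W) hbv)
      simp only [map_add, map_smul] at hbx
      rw [← hc]
      simp only [inv_mul_cancel₀ z.ne_zero, one_smul]
      linear_combination (norm := module) -hbx
    · obtain ⟨k, rfl⟩ : ∃ l, k = l + 1 := ⟨k - 1, by omega⟩
      rw [Nat.add_sub_cancel] at h0
      obtain rfl := chain_mid h0.symm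
      have h : k ≤ 2 * k := by omega
      have u := g.tOp_down h
      rw [← h0] at u
      rw [u, u, hc0]
      simp only [map_add, xOp_emb]
      rw [xi_zero_le le_rfl, xi_zero_gt (by omega), xi_neg e2.symm one_ne_zero (by omega),
        xi_pos e1.symm one_ne_zero le_rfl]
      have hc := g.commute_xN_beta h 0
      have hg : Commute (ρ (xN p q k 0) : Module.End K W) (g.gam k) :=
        (Commute.one_right _).add_right
          (hc.mul_right (((Commute.one_right _).smul_right _).sub_right hc))
      have hc1 := LinearMap.congr_fun hc.eq v
      have hg1 := LinearMap.congr_fun hg.eq v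
      have hbv := LinearMap.congr_fun hb v
      simp only [Module.End.mul_apply, LinearMap.smul_apply, LinearMap.add_apply, beta',
        LinearMap.sub_apply, map_sub,
        Module.End.one_apply, map_smul, smul_smul]
        at hc1 hg1 hbv ⊢
      have hbx := congrArg (ρ (xN p q k 0) : Module.End K W) hbv
      have hbx' := congrArg (emb k K W (k + 1)) hbx
      simp only [map_add, map_smul] at hbx'
      rw [← hc1, hg1]
      have hz : (z : K) ≠ 0 := z.ne_zero
      linear_combination (norm := (match_scalars <;> field_simp <;> ring)) -hbx'
    · have r := LinearMap.congr_fun (congrArg ρ (tN_zero_mul_xN_zero (p := p) (q := q) (n := n) (by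
        unfold chainPos at h
        split_ifs at h <;> omega))) v
      simp only [map_mul, map_sub, map_smul, Module.End.mul_apply, LinearMap.sub_apply,
        LinearMap.smul_apply] at r
      rw [← algebraMap_smul K (qc p q 0) (ρ _ _), hc0] at r
      have r' := congrArg (emb n K W k) r
      simp only [map_sub, map_smul] at r'
      have f := g.tOp_low hk h
      rw [f, f, xOp_emb, xOp_emb, xi_low one_ne_zero h, hc0]
      rcases le_or_gt k n with hkn | hkn
      · rw [xi_zero_le hkn]
        exact r'
      · rw [xi_zero_gt hkn]
        simp only [LinearMap.smul_apply, map_smul, r']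
        module
    · omega
  rw [key, mul_assoc, g.tOp_mul_sub hi, mul_one]

end GenericScalar

end HeckeB

/-! ### The generic module as an H_{n+1}-module, and its filtration. -/

namespace HeckeB
variable {F : Type*} [Field F] {p q : Fˣ} {n : ℕ}

namespace GenericScalar

variable {K W : Type*} [Field K] [Algebra F K] [AddCommGroup W] [Module K W]
    [Module F W] [IsScalarTower F K W] {ρ : HeckeB p q n →ₐ[F] Module.End K W} {z : Kˣ}
    (g : GenericScalar ρ z)

theorem tOp_quad_zero (s : Fˣ) {i : ℕ} (hi : i ≤ n) (hs : qc p q i = (s : F) - (s : F)⁻¹) :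
    (g.tOp i - algebraMap F _ (s : F)) * (g.tOp i + algebraMap F _ (s : F)⁻¹) = 0 := by
  rw [quad_iff, g.tOp_quad hi, hs, algebraMap_smul]

/-- The module `W ^ (2 n + 2)` over `H_{n+1}`. -/
def rep : HeckeB p q (n + 1) →ₐ[F] Module.End K (Fin (2 * n + 2) → W) :=
  lift (fun i => g.tOp i) (fun j => xOp ρ z j)
    (fun i hi => g.tOp_quad_zero p (by omega) (by simp [qc, hi]))
    (fun i hi => g.tOp_quad_zero q (by omega) (by simp [qc, Nat.one_le_iff_ne_zero.1 hi]))
    (fun i j hi hij => by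
      have := g.tOp_braid hi (by omega)
      rwa [← hij] at this)
    (fun i j hij => g.tOp_far hij (by omega))
    (fun i j hi hj => by
      rw [hi, hj]
      exact g.tOp_braid_zero (by omega))
    (fun j k => xOp_comm _ _)
    (fun i hi => by
      have := g.tOp_mixed_zero
      simpa [hi] using this)
    (fun i j h₁ h₂ => by
      refine g.tOp_xOp_comm (by omega) ?_ ?_
      · exact fun h => h₁ (Fin.ext (by simpa using h))
      · exact fun h => h₂ (Fin.ext (by simpa using h)))
    (fun i hi => by simpa using g.tOp_mixed_pos hi (by omega))

theorem rep_tN {i : ℕ} (hi : i ≤ n) : g.rep (tN p q (n + 1) i) = g.tOp i := by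
  have h : i < n + 1 := by omega
  simp only [tN, h, dite_true]
  refine (RingQuot.liftAlgHom_mkAlgHom_apply F _ _ _).trans ?_
  exact FreeAlgebra.lift_ι_apply _ _

theorem rep_xN {j : ℕ} (hj : j ≤ n + 1) : g.rep (xN p q (n + 1) j) = xOp ρ z j := by
  have h : j < n + 1 + 1 := by omega
  simp only [xN, h, dite_true]
  refine (RingQuot.liftAlgHom_mkAlgHom_apply F _ _ _).trans ?_
  exact FreeAlgebra.lift_ι_apply _ _

theorem rep_xN_last_emb (v : W) :
    g.rep (xN p q (n + 1) (n + 1)) (emb n K W 0 v) = emb n K W 0 ((z : K) • v) := by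
  rw [g.rep_xN le_rfl, xOp_emb, xi_pos (by simp [chainPos]) (by omega) (by omega)]
  rfl

theorem rep_incl_emb (h : HeckeB p q n) (v : W) :
    g.rep (incl p q n h) (emb n K W 0 v) = emb n K W 0 (ρ h v) := by
  have hX : ∀ j ≤ n, ∀ v, g.rep (incl p q n (xN p q n j)) (emb n K W 0 v) =
      emb n K W 0 (ρ (xN p q n j) v) := by
    intro j hj v
    rw [incl_xN hj, g.rep_xN (by omega), xOp_emb]
    rcases Nat.eq_zero_or_pos j with rfl | h0
    · rw [xi_zero_le (by omega)]
    · rw [xi_low h0.ne' (by simp only [chainPos, zero_le, if_true]; omega)]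
  induction h using gen_induction generalizing v with
  | hs r => simp only [AlgHom.commutes, Module.algebraMap_end_apply, LinearMap.map_smul_of_tower]
  | hT i hi =>
    rw [incl_tN hi, g.rep_tN hi.le, g.tOp_low (by omega)]
    simp only [chainPos, zero_le, if_true]
    omega
  | hX j hj => exact hX j hj v
  | hX' j hj =>
    have h1 := hX j hj (ρ ((xN p q n j)⁻¹ : (HeckeB p q n)ˣ) v)
    rw [← Module.End.mul_apply (ρ _), ← map_mul, Units.mul_inv, map_one, Module.End.one_apply] at h1
    rw [← h1, ← Module.End.mul_apply, ← map_mul, ← map_mul, Units.inv_mul, map_one, map_one,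
      Module.End.one_apply]
  | hmul a b ha hb =>
    rw [map_mul, map_mul, Module.End.mul_apply, hb, ha, map_mul, Module.End.mul_apply]
  | hadd a b ha hb =>
    rw [map_add, map_add, LinearMap.add_apply, hb, ha, map_add, LinearMap.add_apply, map_add]

variable (K W n) in
/-- The vectors supported on the positions below `k`. -/
def below (k : ℕ) : Submodule K (Fin (2 * n + 2) → W) where
  carrier := {f | ∀ l : Fin (2 * n + 2), k ≤ l.val → f l = 0}
  add_mem' hf hf' l hl := by simp [hf l hl, hf' l hl]
  zero_mem' l _ := rfl
  smul_mem' c f hf l hl := by simp [hf l hl]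

theorem emb_mem_below {k l : ℕ} (h : k < l) (v : W) : emb n K W k v ∈ below n K W l :=
  fun _ hm => emb_apply_ne (by omega) v

theorem below_mono {k l : ℕ} (h : k ≤ l) : below n K W k ≤ below n K W l :=
  fun _ hf m hm => hf m (h.trans hm)

theorem tOp_mem_below (i k : ℕ) {f : Fin (2 * n + 2) → W} (hf : f ∈ below n K W k) :
    g.tOp i f ∈ below n K W (k + 1) := by
  have e : f = ∑ l : Fin (2 * n + 2), emb n K W l (f l) := by
    conv_lhs => rw [← Finset.univ_sum_single f]
    refine Finset.sum_congr rfl fun l _ => ?_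
    simp [emb]
  rw [e, map_sum]
  refine Submodule.sum_mem _ fun l _ => ?_
  by_cases hl : k ≤ l.val
  · rw [hf l hl, map_zero, map_zero]
    exact Submodule.zero_mem _
  · rw [tOp_emb g (by omega), tCol]
    split_ifs
    · exact add_mem (emb_mem_below (by omega) _) (emb_mem_below (by omega) _)
    · exact add_mem (emb_mem_below (by omega) _) (emb_mem_below (by omega) _)
    · exact emb_mem_below (by omega) _
    · exact emb_mem_below (by omega) _

/-- The words are unitriangular: w_k e_0 v has leading term e_k v. Independence of the w_k is thus
built into the generic module. -/
theorem rep_word {k : ℕ} (hk : k ≤ 2 * n + 1) (v : W) :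
    g.rep (word p q n k) (emb n K W 0 v) - emb n K W k v ∈ below n K W k := by
  induction k with
  | zero => simp [word]
  | succ k ih =>
    have h := g.tOp_mem_below (chainIdx n k) k (ih (by omega))
    rw [map_sub, g.tOp_up (by omega)] at h
    have hd : chainIdx n k ≤ n := by
      unfold chainIdx
      split_ifs <;> omega
    rw [word, map_mul, Module.End.mul_apply, g.rep_tN hd]
    have := add_mem h (emb_mem_below (K := K) (W := W) (n := n) k.lt_succ_self (g.beta k v))
    convert this using 1
    abel

/-- The type `W ^ (2 n + 2)` with its `H_{n+1}`-module structure. -/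
def Carrier (_g : GenericScalar ρ z) : Type _ := Fin (2 * n + 2) → W

instance : AddCommGroup g.Carrier := inferInstanceAs (AddCommGroup (Fin (2 * n + 2) → W))
instance : Module K g.Carrier := inferInstanceAs (Module K (Fin (2 * n + 2) → W))
instance : Module F g.Carrier := inferInstanceAs (Module F (Fin (2 * n + 2) → W))
instance : Module (HeckeB p q (n + 1)) g.Carrier :=
  Module.compHom (Fin (2 * n + 2) → W) g.rep.toRingHom

theorem smul_carrier (h : HeckeB p q (n + 1)) (f : g.Carrier) : h • f = g.rep h f := rfl

instance : IsScalarTower F (HeckeB p q (n + 1)) g.Carrier where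
  smul_assoc c h f := by
    rw [smul_carrier, smul_carrier, map_smul]
    rfl

/-- The inclusion of the first summand. -/
def baseMap : W →ₗ[F] g.Carrier := (emb n K W 0).restrictScalars F

/-- The vectors `e_0 v`, `v ∈ S`. -/
def base (S : Submodule F W) : Submodule F g.Carrier := S.map g.baseMap

theorem filt_base_le (S : Submodule F W) {k : ℕ} (hk : k ≤ 2 * n + 2) {f : g.Carrier}
    (hf : f ∈ filt (p := p) (q := q) (n := n) (g.base S) k) : f ∈ below n K W k := by
  let B : Submodule F g.Carrier := (below n K W k).restrictScalars F
  refine (filt_le_iff (B := B)).2 ?_ hf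
  rintro l hl _ ⟨v, _, rfl⟩
  have := add_mem (below_mono (by omega) (g.rep_word (by omega : l ≤ 2 * n + 1) v))
    (emb_mem_below (K := K) hl v)
  rw [sub_add_cancel] at this
  exact this

theorem word_smul_base_apply (k : Fin (2 * n + 2)) (v : W) :
    g.rep (word p q n k) (emb n K W 0 v) k = v := by
  have := g.rep_word (by omega : k.val ≤ 2 * n + 1) v k le_rfl
  rw [Pi.sub_apply, emb_apply_self k.2, sub_eq_zero] at this
  exact this

/-- An element of the filtration supported below position `k` lies in the `k`-th step. -/
theorem mem_filt_of_mem_below (S : Submodule F W) (k : ℕ) {f : g.Carrier}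
    (hf : f ∈ filt (p := p) (q := q) (n := n) (g.base S) (2 * n + 2)) (hk : k ≤ 2 * n + 2)
    (hb : f ∈ below n K W k) : f ∈ filt (p := p) (q := q) (n := n) (g.base S) k := by
  induction hk using Nat.decreasingInduction with
  | self => exact hf
  | of_succ k hk ih =>
    have h := ih (below_mono (by omega) hb)
    rw [filt, Submodule.mem_sup] at h
    obtain ⟨f', hf', _, ⟨_, ⟨v, hv, rfl⟩, rfl⟩, rfl⟩ := h
    have h1 := hb ⟨k, hk⟩ le_rfl
    have h2 := g.filt_base_le S (by omega) hf' ⟨k, hk⟩ le_rfl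
    have h3 := g.word_smul_base_apply ⟨k, hk⟩ v
    have h4 : f' ⟨k, hk⟩ + g.rep (word p q n k) (emb n K W 0 v) ⟨k, hk⟩ = 0 := h1
    rw [h2, h3, zero_add] at h4
    subst h4
    rwa [map_zero, map_zero, add_zero]

theorem base_parabolicStable (S : Submodule F W) (hS : ∀ h, ∀ v ∈ S, ρ h v ∈ S)
    (hz : ∀ v ∈ S, (z : K) • v ∈ S) (hz' : ∀ v ∈ S, (z⁻¹ : K) • v ∈ S) :
    ParabolicStable p q n (g.base S) where
  t_mem i hi := by
    rintro _ ⟨v, hv, rfl⟩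
    refine ⟨_, hS (tN p q n i) v hv, ?_⟩
    have := g.rep_incl_emb (tN p q n i) v
    rw [incl_tN hi] at this
    exact this.symm
  x_mem i hi := by
    rintro _ ⟨v, hv, rfl⟩
    rcases Nat.lt_or_ge n i with h | h
    · obtain rfl : i = n + 1 := by omega
      exact ⟨_, hz v hv, (g.rep_xN_last_emb v).symm⟩
    · refine ⟨_, hS (xN p q n i) v hv, ?_⟩
      have := g.rep_incl_emb (xN p q n i) v
      rw [incl_xN h] at this
      exact this.symm
  x_inv_mem i hi := by
    rintro _ ⟨v, hv, rfl⟩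
    rcases Nat.lt_or_ge n i with h | h
    · obtain rfl : i = n + 1 := by omega
      refine ⟨_, hz' v hv, ?_⟩
      rw [eq_inv_smul_iff]
      refine (g.rep_xN_last_emb _).trans ?_
      rw [smul_inv_smul₀ z.ne_zero]
      rfl
    · refine ⟨_, hS ((xN p q n i)⁻¹ : (HeckeB p q n)ˣ) v hv, ?_⟩
      rw [eq_inv_smul_iff]
      have := g.rep_incl_emb (xN p q n i) (ρ ((xN p q n i)⁻¹ : (HeckeB p q n)ˣ) v)
      rw [incl_xN h, ← Module.End.mul_apply (ρ _), ← map_mul, Units.mul_inv, map_one] at this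
      exact this

end GenericScalar

end HeckeB

namespace HeckeB
variable {F : Type*} [Field F] {p q : Fˣ} {n : ℕ}

/-! ### The scalar a + X over Frac F⟦X⟧ is generic. -/

section Scalars

/-- A transcendental scalar is not an eigenvalue of an extended endomorphism. -/
theorem isUnit_smul_one_sub_baseChange {K N : Type*} [Field K] [Algebra F K] [AddCommGroup N]
    [Module F N] [FiniteDimensional F N] {c : K} (hc : Transcendental F c) (u : Module.End F N) :
    IsUnit (c • (1 : Module.End K (K ⊗[F] N)) - Module.End.baseChangeHom F K N u) := by
  set b := Module.End.baseChangeHom F K N u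
  have h0 : Polynomial.aeval b (minpoly F u) = 0 := by
    rw [Polynomial.aeval_algHom_apply, minpoly.aeval, map_zero]
  have hP : minpoly F u ≠ 0 := minpoly.ne_zero (Algebra.IsIntegral.isIntegral u)
  by_contra h
  have hs : c ∈ spectrum K b := by
    rw [spectrum.mem_iff, Algebra.algebraMap_eq_smul_one]
    exact h
  -- Spectral mapping: an eigenvalue c of the extended operator would be a root of the minimal
  -- polynomial of u, whose coefficients lie in F.
  have h1 := spectrum.subset_polynomial_aeval b ((minpoly F u).map (algebraMap F K)) ⟨c, hs, rfl⟩
  rw [Polynomial.aeval_map_algebraMap, h0] at h1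
  have : Nontrivial (Module.End K (K ⊗[F] N)) := by
    by_contra hn
    rw [not_nontrivial_iff_subsingleton] at hn
    exact h (isUnit_of_subsingleton _)
  rw [spectrum.zero_eq, Set.mem_singleton_iff] at h1
  simp only [Polynomial.eval_map_algebraMap] at h1
  exact hc ⟨_, hP, h1⟩

theorem isUnit_smul_sub_one {K W : Type*} [Field K] [AddCommGroup W] [Module K W] {c : K}
    (h0 : c ≠ 0) {b : Module.End K W} (h : IsUnit (c⁻¹ • (1 : Module.End K W) - b)) :
    IsUnit (c • b - 1) := by
  have h1 := (((Units.mk0 c h0).isUnit.map (algebraMap K (Module.End K W))).mul h).neg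
  convert h1 using 1
  rw [Algebra.algebraMap_eq_smul_one, smul_mul_assoc, one_mul, smul_sub, smul_smul, Units.val_mk0,
    mul_inv_cancel₀ h0, one_smul, neg_sub]

theorem isUnit_smul_baseChange_sub_one {K N : Type*} [Field K] [Algebra F K] [AddCommGroup N]
    [Module F N] [FiniteDimensional F N] {c : K} (hc : Transcendental F c) (u : Module.End F N) :
    IsUnit (c • Module.End.baseChangeHom F K N u - (1 : Module.End K (K ⊗[F] N))) := by
  have h0 : c ≠ 0 := by
    rintro rfl
    exact hc isAlgebraic_zero
  exact isUnit_smul_sub_one h0 (isUnit_smul_one_sub_baseChange (N := N) (c := c⁻¹)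
    (fun h => hc (IsAlgebraic.inv_iff.1 h)) u)

variable (F) in
/-- The field of fractions of the power series ring. -/
abbrev PowerFrac : Type _ := FractionRing (PowerSeries F)

/-- The power series `a + X` as a unit. -/
noncomputable def shiftUnit (a : Fˣ) : (PowerSeries F)ˣ :=
  (PowerSeries.isUnit_iff_constantCoeff (φ := PowerSeries.C (a : F) + PowerSeries.X).2
    (by simp)).unit

theorem val_shiftUnit (a : Fˣ) :
    (shiftUnit a : PowerSeries F) = PowerSeries.C (a : F) + PowerSeries.X := rfl

/-- The generic scalar `a + X`. -/
noncomputable def genScalar (a : Fˣ) : (PowerFrac F)ˣ :=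
  Units.map (algebraMap (PowerSeries F) (PowerFrac F) : _ →* _) (shiftUnit a)

theorem transcendental_genScalar (a : Fˣ) : Transcendental F (genScalar a : PowerFrac F) := by
  have hX : Transcendental F (PowerSeries.X : PowerSeries F) := by
    have h := (Polynomial.transcendental_X F)
    rwa [← transcendental_algebraMap_iff (A := PowerSeries F)
      (show Function.Injective (algebraMap (Polynomial F) (PowerSeries F)) from
        Polynomial.coe_injective F), PowerSeries.algebraMap_apply', Polynomial.coe_X] at h
  have h1 : Transcendental F (shiftUnit a : PowerSeries F) := by
    intro h
    refine hX ?_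
    have := h.sub (isAlgebraic_algebraMap (A := PowerSeries F) (a : F))
    rwa [val_shiftUnit, PowerSeries.algebraMap_apply, Algebra.algebraMap_self, RingHom.id_apply,
      add_sub_cancel_left] at this
  exact (transcendental_algebraMap_iff (IsFractionRing.injective _ _)).2 h1

end Scalars

section Generic

variable (p q n)
variable (a : Fˣ) (N : Type*) [AddCommGroup N] [Module F N] [Module (HeckeB p q n) N]
    [IsScalarTower F (HeckeB p q n) N]

/-- The action of `H_n` on `K ⊗ N`. -/
noncomputable def genRep : HeckeB p q n →ₐ[F] Module.End (PowerFrac F) (PowerFrac F ⊗[F] N) :=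
  (Module.End.baseChangeHom F (PowerFrac F) N).comp (Algebra.lsmul F F N)

variable [FiniteDimensional F N]

/-- The scalar `a + X` is generic for `K ⊗ N`. -/
noncomputable def generic : GenericScalar (genRep p q n N) (genScalar a) where
  den k := if k < n then
      (isUnit_smul_one_sub_baseChange (N := N) (transcendental_genScalar a)
        (Algebra.lsmul F F N (xN p q n (n - k) : HeckeB p q n))).unit
    else if k = n then
      Units.map (algebraMap (PowerFrac F) (Module.End (PowerFrac F) (PowerFrac F ⊗[F] N)) : _ →* _)
        (Units.mk0 ((genScalar a : PowerFrac F) - 1) (fun h => transcendental_genScalar a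
          (by rw [sub_eq_zero.1 h]; exact isAlgebraic_one)))
    else (isUnit_smul_baseChange_sub_one (N := N) (transcendental_genScalar a)
      (Algebra.lsmul F F N (xN p q n (k - n) : HeckeB p q n))).unit
  den_lt k hk := by
    rw [if_pos hk]
    rfl
  den_self := by
    rw [if_neg (lt_irrefl _), if_pos rfl]
    exact Algebra.algebraMap_eq_smul_one _
  den_gt k hk _ := by
    rw [if_neg (by omega), if_neg (by omega)]
    rfl

end Generic
end HeckeB

namespace HeckeB
variable {F : Type*} [Field F] {p q : Fˣ} {n : ℕ}

/-! ### The subquotients of f_a N are full copies of N, by reduction modulo X. -/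

section Independence

variable {a : Fˣ} {N : Type*} [AddCommGroup N] [Module F N] [Module (HeckeB p q n) N]

variable (p q n a N) in
/-- The map `v ↦ 1 ⊗ v` from `N` to `f_a N`. -/
noncomputable def toInd : N →ₗ[F] fInd p q n a N where
  toFun v := Submodule.Quotient.mk ((1 : HeckeB p q (n + 1)) ⊗ₜ[F] (show BoxOne p q n a N from v))
  map_add' v w := by
    rw [← Submodule.Quotient.mk_add]
    exact congrArg _ (TensorProduct.tmul_add _ _ _)
  map_smul' c v := by
    rw [RingHom.id_apply, ← Submodule.Quotient.mk_smul]
    exact congrArg _ ((TensorProduct.mk F (HeckeB p q (n + 1)) (BoxOne p q n a N) 1).map_smul c v)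

theorem smul_toInd (h : HeckeB p q (n + 1)) (v : N) :
    h • toInd p q n a N v = Submodule.Quotient.mk (p := inducedRel (parabolic p q n)
      (BoxOne p q n a N)) (h ⊗ₜ[F] (show BoxOne p q n a N from v)) := by
  rw [toInd]
  refine (Submodule.Quotient.mk_smul _ _ _).symm.trans ?_
  rw [TensorProduct.smul_tmul', smul_eq_mul, mul_one]

variable (a) in
/-- The evaluation `X ↦ a` of Laurent polynomials. -/
noncomputable def laurentEval : F[T;T⁻¹] →ₐ[F] F :=
  AddMonoidAlgebra.lift F F ℤ ((Units.coeHom F).comp (zpowersHom _ a))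

theorem parabolic_smul_toInd (h : HeckeB p q n) (f : F[T;T⁻¹]) (v : N) :
    (incl p q n h * laurentLast p q n f) • toInd p q n a N v =
      toInd p q n a N ((h * algebraMap F _ (laurentEval a f)) • v) := by
  rw [smul_toInd]
  refine (Submodule.Quotient.eq _).2 ?_
  refine Submodule.subset_span ⟨1, h ⊗ₜ f, v, ?_⟩
  rw [one_mul, parabolic, Algebra.TensorProduct.lift_tmul]
  rfl

theorem incl_smul_toInd (h : HeckeB p q n) (v : N) :
    incl p q n h • toInd p q n a N v = toInd p q n a N (h • v) := by
  simpa using parabolic_smul_toInd (a := a) h 1 v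

theorem laurentLast_T_one : laurentLast p q n (LaurentPolynomial.T 1) =
    xN p q (n + 1) (n + 1) := by
  rw [xN_last]
  have e : laurentLast p q n (AddMonoidAlgebra.of F ℤ (Multiplicative.ofAdd 1)) =
        ((X p q (Fin.last (n + 1)) ^ (1 : ℤ) : (HeckeB p q (n + 1))ˣ) : HeckeB p q (n + 1)) :=
      AddMonoidAlgebra.lift_of _ _
  rw [zpow_one] at e
  exact e

theorem laurentEval_T_one : laurentEval a (LaurentPolynomial.T 1) = (a : F) := by
  have e : laurentEval a (AddMonoidAlgebra.of F ℤ (Multiplicative.ofAdd 1)) =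
        ((a ^ (1 : ℤ) : Fˣ) : F) :=
      AddMonoidAlgebra.lift_of _ _
  rw [zpow_one] at e
  exact e

theorem xN_last_smul_toInd [IsScalarTower F (HeckeB p q n) N] (v : N) :
    xN p q (n + 1) (n + 1) • toInd p q n a N v = (a : F) • toInd p q n a N v := by
  have := parabolic_smul_toInd (a := a) (1 : HeckeB p q n) (LaurentPolynomial.T 1) v
  rw [laurentLast_T_one, laurentEval_T_one, map_one, one_mul, one_mul, algebraMap_smul,
    map_smul] at this
  exact this

/-- The base of the filtration of `f_a N`. -/
theorem toInd_parabolicStable [IsScalarTower F (HeckeB p q n) N] :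
    ParabolicStable p q n (LinearMap.range (toInd p q n a N)) where
  t_mem i hi := by
    rintro _ ⟨v, rfl⟩
    rw [← incl_tN hi, incl_smul_toInd]
    exact ⟨_, rfl⟩
  x_mem i hi := by
    rintro _ ⟨v, rfl⟩
    rcases Nat.lt_or_ge n i with h | h
    · obtain rfl : i = n + 1 := by omega
      rw [xN_last_smul_toInd]
      exact Submodule.smul_mem _ _ ⟨_, rfl⟩
    · rw [Units.smul_def, ← incl_xN h, incl_smul_toInd]
      exact ⟨_, rfl⟩
  x_inv_mem i hi := by
    rintro _ ⟨v, rfl⟩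
    rcases Nat.lt_or_ge n i with h | h
    · obtain rfl : i = n + 1 := by omega
      refine ⟨(a : F)⁻¹ • v, ?_⟩
      rw [eq_inv_smul_iff, xN_last_smul_toInd, map_smul, smul_inv_smul₀ a.ne_zero]
    · refine ⟨((xN p q n i)⁻¹ : (HeckeB p q n)ˣ) • v, ?_⟩
      rw [eq_inv_smul_iff, Units.smul_def, ← incl_xN h, incl_smul_toInd, ← Units.smul_def,
        smul_inv_smul]

/-- The last step is H_{n+1}-stable and contains the generating space 1 ⊗ N. -/
theorem filt_toInd_top [IsScalarTower F (HeckeB p q n) N] :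
    filt (p := p) (q := q) (n := n) (LinearMap.range (toInd p q n a N)) (2 * n + 2) = ⊤ := by
  rw [eq_top_iff]
  rintro x -
  obtain ⟨t, rfl⟩ := Submodule.Quotient.mk_surjective _ x
  induction t using TensorProduct.induction_on with
  | zero => exact zero_mem _
  | tmul h v =>
    have h1 : toInd p q n a N v ∈ filt (p := p) (q := q) (n := n)
        (LinearMap.range (toInd p q n a N)) (2 * n + 2) := by
      have := word_smul_mem_filt (p := p) (q := q) (n := n) (l := 0) (k := 2 * n + 2) (by omega)
        (LinearMap.mem_range_self (toInd p q n a N) v)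
      rwa [word, one_smul] at this
    have h2 := filt_top_stable toInd_parabolicStable h h1
    exact smul_toInd (a := a) h (show N from v) ▸ h2
  | add s t hs ht => exact add_mem hs ht

variable [IsScalarTower F (HeckeB p q n) N]

theorem finiteDimensional_fInd [FiniteDimensional F N] : FiniteDimensional F (fInd p q n a N) := by
  have : ∀ k, FiniteDimensional F
      (filt (p := p) (q := q) (n := n) (LinearMap.range (toInd p q n a N)) k) := by
    intro k
    induction k with
    | zero =>
      rw [filt]
      infer_instance
    | succ k ih =>
      rw [filt]
      infer_instance
  have h := this (2 * n + 2)
  rw [filt_toInd_top] at h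
  exact Module.Finite.equiv (Submodule.topEquiv (R := F) (M := fInd p q n a N))

/-- The image of `F⟦X⟧ ⊗ N` in `K ⊗ N`. -/
noncomputable def latticeMap (N : Type*) [AddCommGroup N] [Module F N] :
    PowerSeries F ⊗[F] N →ₗ[F] PowerFrac F ⊗[F] N :=
  LinearMap.rTensor N (IsScalarTower.toAlgHom F (PowerSeries F) (PowerFrac F)).toLinearMap

theorem latticeMap_tmul (o : PowerSeries F) (v : N) :
    latticeMap N (o ⊗ₜ[F] v) = algebraMap (PowerSeries F) (PowerFrac F) o ⊗ₜ v := rfl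

theorem latticeMap_injective : Function.Injective (latticeMap (F := F) N) :=
  Module.Flat.rTensor_preserves_injective_linearMap _ (IsFractionRing.injective _ _)

theorem latticeMap_smul (o : PowerSeries F) (t : PowerSeries F ⊗[F] N) :
    latticeMap N (o • t) = algebraMap (PowerSeries F) (PowerFrac F) o • latticeMap N t := by
  induction t using TensorProduct.induction_on with
  | zero => simp
  | tmul r v =>
    rw [TensorProduct.smul_tmul', latticeMap_tmul, latticeMap_tmul, TensorProduct.smul_tmul',
      smul_eq_mul, map_mul, smul_eq_mul]
  | add s t hs ht => rw [smul_add, map_add, hs, ht, map_add, smul_add]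

/-- Both sides lie in F⟦X⟧ ⊗ N, where taking constant coefficients sends the left one to v and the
right one to zero. -/
theorem eq_zero_of_one_tmul_eq {v : N} {t : PowerSeries F ⊗[F] N}
    (h : (1 : PowerFrac F) ⊗ₜ[F] v =
      algebraMap (PowerSeries F) (PowerFrac F) PowerSeries.X • latticeMap N t) : v = 0 := by
  rw [← latticeMap_smul, ← map_one (algebraMap (PowerSeries F) (PowerFrac F)),
    ← latticeMap_tmul] at h
  have h1 := latticeMap_injective h
  let c : PowerSeries F →ₗ[F] F := PowerSeries.coeff 0
  have h2 : ∀ s : PowerSeries F ⊗[F] N, LinearMap.rTensor N c ((PowerSeries.X : PowerSeries F) • s)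
      = 0 := by
    intro s
    induction s using TensorProduct.induction_on with
    | zero => simp
    | tmul r v =>
      rw [TensorProduct.smul_tmul', LinearMap.rTensor_tmul]
      simp [c]
    | add s t hs ht => rw [smul_add, map_add, hs, ht, add_zero]
  have h3 := congrArg (LinearMap.rTensor N c) h1
  rw [h2, LinearMap.rTensor_tmul] at h3
  have h4 := congrArg (TensorProduct.lid F N) h3
  simpa [c] using h4

theorem genRep_latticeMap (h : HeckeB p q n) (t : PowerSeries F ⊗[F] N) :
    genRep p q n N h (latticeMap N t) =
      latticeMap N (LinearMap.lTensor _ (Algebra.lsmul F F N h) t) := by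
  induction t using TensorProduct.induction_on with
  | zero => simp
  | tmul r v => rfl
  | add s t hs ht => rw [map_add, map_add, map_add, map_add, hs, ht]

variable [FiniteDimensional F N]

variable (p q n a N) in
/-- The lattice generated by `1 ⊗ N`. -/
noncomputable def latticeBase : Submodule F (generic p q n a N).Carrier :=
  (generic p q n a N).base (LinearMap.range (latticeMap N))

theorem latticeBase_parabolicStable : ParabolicStable p q n (latticeBase p q n a N) := by
  refine (generic p q n a N).base_parabolicStable _ ?_ ?_ ?_
  · rintro h _ ⟨t, rfl⟩
    exact ⟨_, (genRep_latticeMap h t).symm⟩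
  · rintro _ ⟨t, rfl⟩
    exact ⟨_, latticeMap_smul (shiftUnit a : PowerSeries F) t⟩
  · rintro _ ⟨t, rfl⟩
    refine ⟨_, (latticeMap_smul ((shiftUnit a)⁻¹ : (PowerSeries F)ˣ) t).trans ?_⟩
    congr 1
    rw [eq_comm, inv_eq_of_mul_eq_one_right]
    rw [genScalar, Units.coe_map, MonoidHom.coe_coe, ← map_mul, Units.mul_inv, map_one]

theorem smul_smul_carrier (h : HeckeB p q (n + 1)) (c : PowerFrac F)
    (f : (generic p q n a N).Carrier) : h • c • f = c • h • f :=
  map_smul ((generic p q n a N).rep h) c f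

variable (p q n a N) in
/-- The map `h ⊗ v ↦ h (1 ⊗ v)` into the generic module. -/
noncomputable def genMap :
    HeckeB p q (n + 1) ⊗[F] BoxOne p q n a N →ₗ[F] (generic p q n a N).Carrier :=
  TensorProduct.lift ((Algebra.lsmul F F (generic p q n a N).Carrier).toLinearMap.compl₂
    ((generic p q n a N).baseMap ∘ₗ latticeMap N ∘ₗ TensorProduct.mk F (PowerSeries F) N 1))

theorem genMap_tmul (h : HeckeB p q (n + 1)) (v : N) :
    genMap p q n a N (h ⊗ₜ[F] (show BoxOne p q n a N from v)) =
      h • (generic p q n a N).baseMap (latticeMap N (1 ⊗ₜ v)) := rfl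

theorem genMap_smul (h : HeckeB p q (n + 1)) (t : HeckeB p q (n + 1) ⊗[F] BoxOne p q n a N) :
    genMap p q n a N (h • t) = h • genMap p q n a N t := by
  induction t using TensorProduct.induction_on with
  | zero => rw [smul_zero, map_zero, smul_zero]
  | tmul k v =>
    rw [TensorProduct.smul_tmul', smul_eq_mul]
    exact mul_smul h k ((generic p q n a N).baseMap (latticeMap N (1 ⊗ₜ v)))
  | add s t hs ht => rw [smul_add, map_add, hs, ht, map_add, smul_add]

variable (a) in
/-- The map `X ↦ a + X` from Laurent polynomials to power series. -/
noncomputable def laurentShift : F[T;T⁻¹] →ₐ[F] PowerSeries F :=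
  AddMonoidAlgebra.lift F (PowerSeries F) ℤ
    ((Units.coeHom (PowerSeries F)).comp (zpowersHom _ (shiftUnit a)))

theorem constantCoeff_laurentShift (f : F[T;T⁻¹]) :
    PowerSeries.constantCoeff (laurentShift a f) = laurentEval a f := by
  have e : Units.map (PowerSeries.constantCoeff (R := F) : _ →* _) (shiftUnit a) = a :=
    Units.ext (by simp [val_shiftUnit])
  induction f using AddMonoidAlgebra.induction_on with
  | of k =>
    have e1 : laurentShift a (AddMonoidAlgebra.of F ℤ (Multiplicative.ofAdd k)) =
        ((shiftUnit a ^ k : (PowerSeries F)ˣ) : PowerSeries F) :=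
      AddMonoidAlgebra.lift_of _ _
    have e2 : laurentEval a (AddMonoidAlgebra.of F ℤ (Multiplicative.ofAdd k)) =
        ((a ^ k : Fˣ) : F) :=
      AddMonoidAlgebra.lift_of _ _
    rw [e1, e2]
    conv_rhs => rw [← e, ← map_zpow]
    rfl
  | add f g hf hg => simp only [map_add, hf, hg]
  | smul r f hf =>
    rw [map_smul (laurentShift a), map_smul (laurentEval a), ← hf, PowerSeries.smul_eq_C_mul,
      map_mul, smul_eq_mul, PowerSeries.constantCoeff_C]

theorem laurentLast_smul_base (f : F[T;T⁻¹]) (t : PowerSeries F ⊗[F] N) :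
    laurentLast p q n f • (generic p q n a N).baseMap (latticeMap N t) =
      (generic p q n a N).baseMap (latticeMap N (laurentShift a f • t)) := by
  have hx : ∀ t : PowerSeries F ⊗[F] N,
      xN p q (n + 1) (n + 1) • (generic p q n a N).baseMap (latticeMap N t) =
      (generic p q n a N).baseMap (latticeMap N ((shiftUnit a : PowerSeries F) • t)) := by
    intro t
    rw [latticeMap_smul]
    exact (generic p q n a N).rep_xN_last_emb _
  have hx' : ∀ t : PowerSeries F ⊗[F] N,
      (xN p q (n + 1) (n + 1))⁻¹ • (generic p q n a N).baseMap (latticeMap N t) =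
      (generic p q n a N).baseMap
        (latticeMap N (((shiftUnit a)⁻¹ : (PowerSeries F)ˣ) • t)) := by
    intro t
    rw [inv_smul_eq_iff, hx, ← Units.smul_def, smul_inv_smul]
  induction f using AddMonoidAlgebra.induction_on generalizing t with
  | of k =>
    have e1 : laurentShift a (AddMonoidAlgebra.of F ℤ (Multiplicative.ofAdd k)) =
        ((shiftUnit a ^ k : (PowerSeries F)ˣ) : PowerSeries F) :=
      AddMonoidAlgebra.lift_of _ _
    have e2 : laurentLast p q n (AddMonoidAlgebra.of F ℤ (Multiplicative.ofAdd k)) =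
        ((X p q (Fin.last (n + 1)) ^ k : (HeckeB p q (n + 1))ˣ) :
          HeckeB p q (n + 1)) :=
      AddMonoidAlgebra.lift_of _ _
    rw [e1, e2, ← xN_last, ← Units.smul_def, ← Units.smul_def]
    clear e1 e2
    induction k using Int.induction_on generalizing t with
    | zero => rw [zpow_zero, zpow_zero, one_smul, one_smul]
    | succ m ih => rw [zpow_add_one, mul_smul, hx, ih, zpow_add_one, mul_smul]; rfl
    | pred m ih => rw [zpow_sub_one, mul_smul, hx', ih, zpow_sub_one, mul_smul]
  | add f g hf hg => rw [map_add, add_smul, hf, hg, map_add, add_smul, map_add, map_add]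
  | smul r f hf =>
    rw [map_smul (laurentLast p q n), smul_assoc, hf, map_smul (laurentShift a), smul_assoc,
      map_smul (latticeMap N), map_smul (generic p q n a N).baseMap]

/-- The generic module modulo `X` satisfies the relations of `f_a N`. -/
theorem genMap_inducedRel {t : HeckeB p q (n + 1) ⊗[F] BoxOne p q n a N}
    (ht : t ∈ inducedRel (parabolic p q n) (BoxOne p q n a N)) :
    ∃ l ∈ filt (p := p) (q := q) (n := n) (latticeBase p q n a N) (2 * n + 2),
      genMap p q n a N t = algebraMap (PowerSeries F) (PowerFrac F) PowerSeries.X • l := by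
  induction ht using Submodule.span_induction with
  | zero => exact ⟨0, zero_mem _, by rw [map_zero, smul_zero]⟩
  | add s t _ _ hs ht =>
    obtain ⟨l, hl, el⟩ := hs
    obtain ⟨m, hm, em⟩ := ht
    exact ⟨l + m, add_mem hl hm, by rw [map_add, el, em, smul_add]⟩
  | smul h t _ ht =>
    obtain ⟨l, hl, el⟩ := ht
    exact ⟨h • l, filt_top_stable latticeBase_parabolicStable h hl, by
      rw [genMap_smul, el, smul_smul_carrier]⟩
  | mem t ht =>
    obtain ⟨h, b, v, rfl⟩ := ht
    have key : ∀ (k : HeckeB p q n) (f : F[T;T⁻¹]),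
        ∃ l ∈ filt (p := p) (q := q) (n := n) (latticeBase p q n a N) (2 * n + 2),
          genMap p q n a N ((h * parabolic p q n (k ⊗ₜ f)) ⊗ₜ[F] v - h ⊗ₜ[F] ((k ⊗ₜ[F] f) • v)) =
            algebraMap (PowerSeries F) (PowerFrac F) PowerSeries.X • l := by
      intro k f
      -- f(a + X) ≡ f(a) modulo X: the action of X_{n+1} in the generic module specializes to the
      -- one on N ⊠ (a).
      have hd : PowerSeries.X ∣ laurentShift a f - PowerSeries.C (laurentEval a f) := by
        rw [PowerSeries.X_dvd_iff, map_sub, constantCoeff_laurentShift,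
          PowerSeries.constantCoeff_C, sub_self]
      obtain ⟨o, ho⟩ := hd
      let w : N := k • (show N from v)
      have h1 : genMap p q n a N ((h * parabolic p q n (k ⊗ₜ f)) ⊗ₜ[F] v) =
          h • (generic p q n a N).baseMap (latticeMap N (laurentShift a f ⊗ₜ w)) := by
        have e1 : incl p q n k • (generic p q n a N).baseMap (latticeMap N (1 ⊗ₜ v)) =
          (generic p q n a N).baseMap (latticeMap N (1 ⊗ₜ w)) :=
          ((generic p q n a N).rep_incl_emb k _)
        refine (genMap_tmul _ _).trans ?_
        rw [parabolic, Algebra.TensorProduct.lift_tmul, (incl_commute_laurentLast k f).eq, mul_smul,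
          mul_smul, e1, laurentLast_smul_base, TensorProduct.smul_tmul', smul_eq_mul, mul_one]
      have h2 : genMap p q n a N (h ⊗ₜ[F] ((k ⊗ₜ[F] f) • v)) =
          h • (generic p q n a N).baseMap
            (latticeMap N (PowerSeries.C (laurentEval a f) ⊗ₜ w)) := by
        have e2 : ((k ⊗ₜ[F] f) • v : BoxOne p q n a N) = laurentEval a f • w := by
          have e4 : BoxOne.eval p q n a (k ⊗ₜ[F] f) = k * algebraMap F _ (laurentEval a f) :=
            Algebra.TensorProduct.lift_tmul _ _ _ _ _
          refine (congrArg (· • (show N from v)) e4).trans ?_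
          rw [← Algebra.commutes, mul_smul, algebraMap_smul]
        rw [e2]
        refine (genMap_tmul _ _).trans ?_
        rw [← TensorProduct.smul_tmul, PowerSeries.smul_eq_C_mul, mul_one]
      refine ⟨h • (generic p q n a N).baseMap (latticeMap N (o ⊗ₜ w)), ?_, ?_⟩
      · refine filt_top_stable latticeBase_parabolicStable h ?_
        have := word_smul_mem_filt (p := p) (q := q) (n := n) (l := 0) (k := 2 * n + 2)
          (S := latticeBase p q n a N) (by omega) ⟨_, ⟨o ⊗ₜ w, rfl⟩, rfl⟩
        rwa [word, one_smul] at this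
      · have e5 : latticeMap N (laurentShift a f ⊗ₜ w) -
            latticeMap N (PowerSeries.C (laurentEval a f) ⊗ₜ w) =
            algebraMap (PowerSeries F) (PowerFrac F) PowerSeries.X • latticeMap N (o ⊗ₜ w) := by
          rw [← map_sub, ← TensorProduct.sub_tmul, ho, ← smul_eq_mul, ← TensorProduct.smul_tmul',
            latticeMap_smul]
        refine (map_sub (genMap p q n a N) _ _).trans ?_
        rw [h1, h2, ← smul_sub, ← map_sub, e5, ← smul_smul_carrier]
        exact congrArg (h • ·) (map_smul (GenericScalar.emb n (PowerFrac F) (PowerFrac F ⊗[F] N) 0) _ _)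
    induction b using TensorProduct.induction_on with
    | zero =>
      rw [← TensorProduct.zero_tmul _ (0 : F[T;T⁻¹])]
      exact key 0 0
    | add b c hb hc =>
      obtain ⟨l, hl, el⟩ := hb
      obtain ⟨m, hm, em⟩ := hc
      refine ⟨l + m, add_mem hl hm, ?_⟩
      rw [smul_add, ← el, ← em, ← map_add, map_add (parabolic p q n), mul_add, add_smul,
        TensorProduct.add_tmul, TensorProduct.tmul_add]
      congr 1
      abel
    | tmul k f => exact key k f

/-- The graded pieces of `f_a N` are copies of `N`. -/
theorem eq_zero_of_word_smul_toInd_mem {k : ℕ} (hk : k ≤ 2 * n + 1) {v : N}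
    (h : word p q n k • toInd p q n a N v ∈
      filt (p := p) (q := q) (n := n) (LinearMap.range (toInd p q n a N)) k) : v = 0 := by
  let π : HeckeB p q (n + 1) ⊗[F] BoxOne p q n a N →ₗ[F] fInd p q n a N :=
    (inducedRel (parabolic p q n) (BoxOne p q n a N)).mkQ.restrictScalars F
  -- Elements of step k in f_a N lift to tensors whose generic images lie in step k of the lattice
  -- filtration.
  have h1 : filt (p := p) (q := q) (n := n) (LinearMap.range (toInd p q n a N)) k ≤
      ((filt (p := p) (q := q) (n := n) (latticeBase p q n a N) k).comap
        (genMap p q n a N)).map π := by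
    refine filt_le_iff.2 ?_
    rintro l hl _ ⟨v, rfl⟩
    rw [smul_toInd]
    have h2 : (generic p q n a N).baseMap (latticeMap N (1 ⊗ₜ v)) ∈ latticeBase p q n a N :=
      ⟨_, ⟨1 ⊗ₜ v, rfl⟩, rfl⟩
    exact ⟨_, word_smul_mem_filt hl h2, rfl⟩
  obtain ⟨t, ht, et⟩ := h1 h
  rw [smul_toInd] at et
  have h2 := (Submodule.Quotient.eq _).1 et
  obtain ⟨l, hl, el⟩ := genMap_inducedRel h2
  rw [map_sub] at el
  have hX : algebraMap (PowerSeries F) (PowerFrac F) PowerSeries.X ≠ 0 := fun h0 =>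
    PowerSeries.X_ne_zero ((map_eq_zero_iff _ (IsFractionRing.injective _ _)).1 h0)
  have ht' : genMap p q n a N t ∈ GenericScalar.below n (PowerFrac F) (PowerFrac F ⊗[F] N) k :=
    (generic p q n a N).filt_base_le _ (by omega) ht
  set W : (generic p q n a N).Carrier :=
    genMap p q n a N (word p q n k ⊗ₜ[F] (show BoxOne p q n a N from v)) with hW
  -- X l is supported on positions up to k, and X is invertible in the fraction field, so l is
  -- supported there too.
  have hb : l ∈ GenericScalar.below n (PowerFrac F) (PowerFrac F ⊗[F] N) (k + 1) := by
    have h3 : W ∈ filt (p := p) (q := q) (n := n) (latticeBase p q n a N) (k + 1) :=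
      word_smul_mem_filt k.lt_succ_self ⟨_, ⟨1 ⊗ₜ v, rfl⟩, rfl⟩
    have h4 := (generic p q n a N).filt_base_le _ (by omega) h3
    have h5 := sub_mem (GenericScalar.below_mono k.le_succ ht') h4
    intro j hj
    have h6 := h5 j hj
    have h7 := congrFun el j
    exact (smul_eq_zero.1 (h7.symm.trans h6)).resolve_left hX
  -- Hence l is in step k + 1, and its k-th coordinate belongs to F⟦X⟧ ⊗ N, not merely to K ⊗ N. At
  -- position k the equation becomes -(1 ⊗ v) = X s.
  have h8 := (generic p q n a N).mem_filt_of_mem_below _ (k + 1) hl (by omega) hb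
  rw [filt, Submodule.mem_sup] at h8
  obtain ⟨f, hf, _, ⟨_, ⟨_, ⟨s, rfl⟩, rfl⟩, rfl⟩, rfl⟩ := h8
  have hf' := (generic p q n a N).filt_base_le _ (by omega) hf ⟨k, by omega⟩ le_rfl
  have h9 := congrFun el ⟨k, by omega⟩
  have h10 : W ⟨k, by omega⟩ = latticeMap N (1 ⊗ₜ v) :=
    (generic p q n a N).word_smul_base_apply ⟨k, by omega⟩ _
  have h11 : (generic p q n a N).rep (word p q n k)
      (GenericScalar.emb n (PowerFrac F) _ 0 (latticeMap N s)) ⟨k, by omega⟩ = latticeMap N s :=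
    (generic p q n a N).word_smul_base_apply ⟨k, by omega⟩ _
  have h12 : genMap p q n a N t ⟨k, by omega⟩ - W ⟨k, by omega⟩ =
    algebraMap (PowerSeries F) (PowerFrac F) PowerSeries.X • (f ⟨k, by omega⟩ +
      (generic p q n a N).rep (word p q n k) (GenericScalar.emb n (PowerFrac F) _ 0 (latticeMap N s)) ⟨k, by omega⟩) := h9
  rw [ht' ⟨k, by omega⟩ le_rfl, hf', h11, h10, zero_add, zero_sub, latticeMap_tmul, map_one] at h12
  refine eq_zero_of_one_tmul_eq (t := -s) ?_
  rw [map_neg, smul_neg, ← h12, neg_neg]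

end Independence
end HeckeB

/-! ### Joint generalized eigenspaces. -/

section LinearAlgebra

variable {F A B : Type*} [Field F] [AddCommGroup A] [Module F A] [AddCommGroup B] [Module F B]

/-- The joint generalized eigenspace of the operators `f i`, `i ∈ s`, for the eigenvalue `a`. -/
def genEig (f : ℕ → Module.End F A) (a : F) (s : Finset ℕ) : Submodule F A :=
  ⨅ i ∈ s, (f i).maxGenEigenspace a

theorem mem_genEig {f : ℕ → Module.End F A} {a : F} {s : Finset ℕ} {v : A} :
    v ∈ genEig f a s ↔ ∀ i ∈ s, ∃ k : ℕ, ((f i - a • 1) ^ k) v = 0 := by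
  simp only [genEig, Submodule.mem_iInf, Module.End.mem_maxGenEigenspace]

/-- Intertwiners of two operators intertwine their polynomials. -/
theorem map_aeval_apply {φ : A →ₗ[F] B} {f : Module.End F A} {g : Module.End F B}
    (h : ∀ v, φ (f v) = g (φ v)) (P : Polynomial F) (v : A) :
    φ (Polynomial.aeval f P v) = Polynomial.aeval g P (φ v) := by
  induction P using Polynomial.induction_on' generalizing v with
  | add P Q hP hQ => simp only [map_add, LinearMap.add_apply, hP, hQ]
  | monomial k c =>
    simp only [Polynomial.aeval_monomial, Module.End.mul_apply, Module.algebraMap_end_apply,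
      map_smul]
    congr 1
    induction k generalizing v with
    | zero => simp
    | succ k ih => rw [pow_succ, pow_succ, Module.End.mul_apply, Module.End.mul_apply, ih, h]

theorem sub_smul_one_pow_eq_aeval (f : Module.End F A) (a : F) (k : ℕ) :
    (f - a • 1) ^ k = Polynomial.aeval f ((Polynomial.X - Polynomial.C a) ^ k) := by
  rw [map_pow, map_sub, Polynomial.aeval_X, Polynomial.aeval_C, Algebra.algebraMap_eq_smul_one]

theorem map_sub_smul_one_pow {φ : A →ₗ[F] B} {f : Module.End F A} {g : Module.End F B}
    (h : ∀ v, φ (f v) = g (φ v)) (a : F) (k : ℕ) (v : A) :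
    φ (((f - a • 1) ^ k) v) = ((g - a • 1) ^ k) (φ v) := by
  rw [sub_smul_one_pow_eq_aeval, sub_smul_one_pow_eq_aeval, map_aeval_apply h]

theorem map_mem_genEig {φ : A →ₗ[F] B} {f : ℕ → Module.End F A} {g : ℕ → Module.End F B}
    {s : Finset ℕ} (h : ∀ i ∈ s, ∀ v, φ (f i v) = g i (φ v)) {a : F} {v : A}
    (hv : v ∈ genEig f a s) : φ v ∈ genEig g a s := by
  rw [mem_genEig] at hv ⊢
  intro i hi
  obtain ⟨k, hk⟩ := hv i hi
  exact ⟨k, by rw [← map_sub_smul_one_pow (h i hi), hk, map_zero]⟩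

/-- Equivariant surjections are surjective on joint generalized eigenspaces. -/
theorem exists_mem_genEig_of_surjective [FiniteDimensional F A] {φ : A →ₗ[F] B}
    (hφ : Function.Surjective φ) {f : ℕ → Module.End F A} {g : ℕ → Module.End F B}
    {s : Finset ℕ} (h : ∀ i ∈ s, ∀ v, φ (f i v) = g i (φ v))
    (hf : ∀ i j, Commute (f i) (f j)) {a : F} {w : B} (hw : w ∈ genEig g a s) :
    ∃ v ∈ genEig f a s, φ v = w := by
  induction s using Finset.induction_on with
  | empty =>
    obtain ⟨v, rfl⟩ := hφ w
    exact ⟨v, by simp [mem_genEig], rfl⟩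
  | insert i s _ ih =>
    rw [mem_genEig] at hw
    obtain ⟨v, hv, rfl⟩ := ih (fun j hj => h j (Finset.mem_insert_of_mem hj))
      (mem_genEig.2 fun j hj => hw j (Finset.mem_insert_of_mem hj))
    obtain ⟨k, hk⟩ := hw i (Finset.mem_insert_self _ _)
    have hi := h i (Finset.mem_insert_self _ _)
    have hP : minpoly F (f i) ≠ 0 := minpoly.ne_zero (Algebra.IsIntegral.isIntegral _)
    -- The minimal polynomial is (X - a)^r P with P(a) ≠ 0. From u (X - a)^k + w P = 1 the vector
    -- (wP)(f) v is killed by (f - a)^r and has the same image as v, because (g - a)^k kills that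
    -- image. Polynomials in f i preserve the eigenspaces already achieved.
    obtain ⟨P, hP1, hP2⟩ := Polynomial.exists_eq_pow_rootMultiplicity_mul_and_not_dvd _ hP a
    have hc : IsCoprime ((Polynomial.X - Polynomial.C a) ^ k) P :=
      (((Polynomial.irreducible_X_sub_C a).coprime_iff_not_dvd).2 hP2).pow_left
    obtain ⟨u, w, huw⟩ := hc
    have e := congrArg (fun R : Polynomial F => Polynomial.aeval (g i) R (φ v)) huw
    refine ⟨Polynomial.aeval (f i) (w * P) v, mem_genEig.2 fun j hj => ?_, ?_⟩
    · rcases Finset.mem_insert.1 hj with rfl | hj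
      · refine ⟨(minpoly F (f j)).rootMultiplicity a, ?_⟩
        rw [sub_smul_one_pow_eq_aeval, ← Module.End.mul_apply, ← map_mul, mul_left_comm, ← hP1,
          map_mul, minpoly.aeval, mul_zero, LinearMap.zero_apply]
      · obtain ⟨m, hm⟩ := mem_genEig.1 hv j hj
        refine ⟨m, ?_⟩
        have hcomm : ∀ x, Polynomial.aeval (f i) (w * P) (f j x) =
            f j (Polynomial.aeval (f i) (w * P) x) := fun x =>
          (map_aeval_apply (φ := f j) (fun y => congrArg (· y) (hf j i).eq) (w * P) x).symm
        rw [← map_sub_smul_one_pow hcomm, hm, map_zero]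
    · rw [map_aeval_apply hi]
      simp only [map_add, LinearMap.add_apply, map_one, Module.End.one_apply] at e
      rwa [map_mul _ u, Module.End.mul_apply, ← sub_smul_one_pow_eq_aeval, hk, map_zero,
        zero_add] at e

theorem mem_maxGenEigenspace_of_sub_mem {f : Module.End F A} {a : F} {v : A}
    (h : f v - a • v ∈ f.maxGenEigenspace a) : v ∈ f.maxGenEigenspace a := by
  rw [Module.End.mem_maxGenEigenspace] at h ⊢
  obtain ⟨k, hk⟩ := h
  refine ⟨k + 1, ?_⟩
  rw [pow_succ, Module.End.mul_apply]
  exact hk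

end LinearAlgebra

/-! ### Tail eigenspaces and the independence of the vectors T_j ⋯ T_{n-1} u. -/

namespace HeckeB
variable {F : Type*} [Field F] {p q : Fˣ} {n : ℕ}

variable (p q n) in
/-- The vectors on which `X_b, …, X_n` have the generalized eigenvalue `a`. -/
noncomputable def tailSpace (a : F) (M : Type*) [AddCommGroup M] [Module F M]
    [Module (HeckeB p q n) M] [IsScalarTower F (HeckeB p q n) M] (b : ℕ) : Submodule F M :=
  genEig (fun i => Algebra.lsmul F F M (xN p q n i : HeckeB p q n)) a (Finset.Icc b n)

variable {a : F} {M : Type*} [AddCommGroup M] [Module F M]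
    [Module (HeckeB p q n) M] [IsScalarTower F (HeckeB p q n) M] {b : ℕ}

theorem mem_tailSpace {v : M} : v ∈ tailSpace p q n a M b ↔ ∀ i, b ≤ i → i ≤ n →
    v ∈ (Algebra.lsmul F F M (xN p q n i : HeckeB p q n)).maxGenEigenspace a := by
  simp only [tailSpace, genEig, Submodule.mem_iInf, Finset.mem_Icc, and_imp]

theorem commute_mem_tailSpace {h : HeckeB p q n} {v : M}
    (hc : ∀ i, b ≤ i → i ≤ n → Commute h (xN p q n i)) (hv : v ∈ tailSpace p q n a M b) :
    h • v ∈ tailSpace p q n a M b := by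
  refine map_mem_genEig (φ := Algebra.lsmul F F M h) (fun i hi w => ?_) hv
  rw [Finset.mem_Icc] at hi
  change h • (xN p q n i : HeckeB p q n) • w = (xN p q n i : HeckeB p q n) • h • w
  rw [← mul_smul, (hc i hi.1 hi.2).eq, mul_smul]

theorem xN_mem_tailSpace (j : ℕ) {v : M} (hv : v ∈ tailSpace p q n a M b) :
    xN p q n j • v ∈ tailSpace p q n a M b :=
  commute_mem_tailSpace (fun i _ _ => xN_val_comm j i) hv

/-- T_l interchanges X_l and X_{l+1} up to a multiple of X_{l+1} v, and both carry the eigenvalue a.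
So X_l - a on T_l v reduces to X_{l+1} - a on v plus a vector already in the eigenspace; induction
on the nilpotency exponent finishes, likewise with the roles exchanged. -/
theorem tN_mem_tailSpace {l : ℕ} (h1 : 1 ≤ l) (hb : b ≤ l) (hl : l < n) {v : M}
    (hv : v ∈ tailSpace p q n a M b) : tN p q n l • v ∈ tailSpace p q n a M b := by
  have hX : ∀ j, ∀ w ∈ tailSpace p q n a M b, xN p q n j • w - a • w ∈ tailSpace p q n a M b :=
    fun j w hw => sub_mem (xN_mem_tailSpace j hw) (Submodule.smul_mem _ _ hw)
  rw [mem_tailSpace]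
  intro i hi hin
  by_cases hil : i = l ∨ i = l + 1
  · rcases hil with rfl | rfl
    · obtain ⟨k, hk⟩ := (Module.End.mem_maxGenEigenspace _ _ _).1
        (mem_tailSpace.1 hv (i + 1) (by omega) (by omega))
      induction k generalizing v with
      | zero =>
        have : v = 0 := hk
        rw [this, smul_zero]
        exact zero_mem _
      | succ k ih =>
        refine mem_maxGenEigenspace_of_sub_mem ?_
        have e : xN p q n i • tN p q n i • v - a • tN p q n i • v =
            tN p q n i • (xN p q n (i + 1) • v - a • v) - qc p q i • xN p q n (i + 1) • v := by
          rw [xN_smul_tN_self h1 hl, smul_sub, smul_comm a]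
          abel
        change xN p q n i • tN p q n i • v - a • tN p q n i • v ∈ _
        rw [e]
        refine sub_mem (ih (hX _ v hv) ?_) (Submodule.smul_mem _ _
          (mem_tailSpace.1 (xN_mem_tailSpace (i + 1) hv) i hi hin))
        rw [pow_succ, Module.End.mul_apply] at hk
        exact hk
    · obtain ⟨k, hk⟩ := (Module.End.mem_maxGenEigenspace _ _ _).1
        (mem_tailSpace.1 hv l (by omega) (by omega))
      induction k generalizing v with
      | zero =>
        have : v = 0 := hk
        rw [this, smul_zero]
        exact zero_mem _
      | succ k ih =>
        refine mem_maxGenEigenspace_of_sub_mem ?_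
        have e : xN p q n (l + 1) • tN p q n l • v - a • tN p q n l • v =
            tN p q n l • (xN p q n l • v - a • v) + qc p q l • xN p q n (l + 1) • v := by
          rw [xN_succ_smul_tN h1 hl, smul_sub, smul_comm a]
          abel
        change xN p q n (l + 1) • tN p q n l • v - a • tN p q n l • v ∈ _
        rw [e]
        refine add_mem (ih (hX _ v hv) ?_) (Submodule.smul_mem _ _
          (mem_tailSpace.1 (xN_mem_tailSpace (l + 1) hv) (l + 1) hi hin))
        rw [pow_succ, Module.End.mul_apply] at hk
        exact hk
  · have hv' : v ∈ tailSpace p q n a M i := mem_tailSpace.2 fun j hj hjn =>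
      mem_tailSpace.1 hv j (by omega) hjn
    obtain ⟨k, hk⟩ := (Module.End.mem_maxGenEigenspace _ _ _).1 (mem_tailSpace.1 hv i hi hin)
    refine (Module.End.mem_maxGenEigenspace _ _ _).2 ⟨k, ?_⟩
    have hc : ∀ w : M, Algebra.lsmul F F M (tN p q n l)
        (Algebra.lsmul F F M (xN p q n i : HeckeB p q n) w) =
        Algebra.lsmul F F M (xN p q n i : HeckeB p q n) (Algebra.lsmul F F M (tN p q n l) w) := by
      intro w
      rw [← Module.End.mul_apply, ← map_mul, (tN_xN_comm (by omega) (by omega)).eq, map_mul,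
        Module.End.mul_apply]
    exact (map_sub_smul_one_pow hc a k v).symm.trans (by rw [hk, map_zero])

variable (p q n) in
/-- The product `T_j T_{j+1} ⋯ T_{s-1}`. -/
def ladder (j : ℕ) : ℕ → HeckeB p q n
  | 0 => 1
  | s + 1 => if j ≤ s then ladder j s * tN p q n s else 1

theorem ladder_succ {j s : ℕ} (h : j ≤ s) :
    ladder p q n j (s + 1) = ladder p q n j s * tN p q n s := if_pos h

theorem ladder_of_le {j s : ℕ} (h : s ≤ j) : ladder p q n j s = 1 := by
  cases s with
  | zero => rfl
  | succ s => exact if_neg (by omega)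

theorem xN_ladder_comm {i j s : ℕ} (h : s < i) :
    Commute (xN p q n i : HeckeB p q n) (ladder p q n j s) := by
  induction s with
  | zero => exact Commute.one_right _
  | succ s ih =>
    by_cases hj : j ≤ s
    · rw [ladder_succ hj]
      exact (ih (by omega)).mul_right (tN_xN_comm (by omega) (by omega)).symm
    · rw [ladder_of_le (by omega)]
      exact Commute.one_right _

theorem ladder_mem_tailSpace {j s : ℕ} (h1 : 1 ≤ j) (hb : b ≤ j) (hs : s ≤ n) {v : M}
    (hv : v ∈ tailSpace p q n a M b) : ladder p q n j s • v ∈ tailSpace p q n a M b := by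
  induction s generalizing v with
  | zero =>
    rw [ladder, one_smul]
    exact hv
  | succ s ih =>
    by_cases hj : j ≤ s
    · rw [ladder_succ hj, mul_smul]
      exact ih (by omega) (tN_mem_tailSpace (by omega) (by omega) (by omega) hv)
    · rw [ladder_of_le (by omega), one_smul]
      exact hv

/-- The vectors `T_j ⋯ T_{s-1} u_j` are independent for `u_j` in an eigenspace of `X_s`. -/
theorem ladder_independent (hq : qc p q 1 ≠ 0) (ha : a ≠ 0) (hb : 1 ≤ b) {s : ℕ} (hs : s ≤ n)
    (u : ℕ → M) (hu : ∀ j, xN p q n s • u j = a • u j)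
    (hn : ∀ j i, b ≤ i → i < s →
      u j ∈ (Algebra.lsmul F F M (xN p q n i : HeckeB p q n)).maxGenEigenspace a)
    (y : M) (hy : xN p q n s • y = a • y)
    (h0 : ∑ j ∈ Finset.Ico b s, ladder p q n j s • u j + y = 0) :
    ∀ j ∈ Finset.Ico b s, u j = 0 := by
  induction s generalizing u y with
  | zero => simp
  | succ s ih =>
    by_cases hbs : b ≤ s
    swap
    · intro j hj
      rw [Finset.mem_Ico] at hj
      omega
    -- A common exponent m with (X_s - a)^m u_j = 0 serves for an inner induction; m = 0 means u_j =
    -- 0.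
    obtain ⟨m, hm⟩ : ∃ m : ℕ, ∀ j ∈ Finset.Ico b (s + 1),
        ((Algebra.lsmul F F M (xN p q n s : HeckeB p q n) - a • 1) ^ m) (u j) = 0 := by
      choose k hk using fun j =>
        (Module.End.mem_maxGenEigenspace _ _ _).1 (hn j s hbs s.lt_succ_self)
      refine ⟨(Finset.Ico b (s + 1)).sup k, fun j hj => ?_⟩
      exact Module.End.pow_map_zero_of_le (Finset.le_sup hj) (hk j)
    induction m generalizing u y with
    | zero => exact hm
    | succ m ihm =>
      have e : ∀ j ∈ Finset.Ico b (s + 1),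
          xN p q n (s + 1) • ladder p q n j (s + 1) • u j - a • ladder p q n j (s + 1) • u j =
          ladder p q n j (s + 1) • (xN p q n s • u j - a • u j) +
            (qc p q 1 * a) • ladder p q n j s • u j := by
        intro j hj
        rw [Finset.mem_Ico] at hj
        have hs0 : s ≠ 0 := by omega
        rw [ladder_succ (by omega), mul_smul, mul_smul, Units.smul_def, ← mul_smul,
          (xN_ladder_comm s.lt_succ_self).eq, mul_smul, ← Units.smul_def,
          xN_succ_smul_tN (by omega) (by omega), hu j, qc_of_ne_zero hs0, smul_add, smul_sub,
          smul_sub, smul_comm a, smul_comm a (tN p q n s), mul_smul,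
          smul_comm (ladder p q n j s) (qc p q 1), smul_comm (ladder p q n j s) a]
        abel
      -- X_{s+1} - a kills y. On the other terms it replaces u_j by (X_s - a) u_j and adds ca T_j ⋯
      -- T_{s-1} u_j, with T_s stripped.
      have h1 := congrArg (fun x => xN p q n (s + 1) • x - a • x) h0
      simp only [smul_add, smul_zero, sub_zero, hy, add_sub_add_right_eq_sub, Finset.smul_sum,
        ← Finset.sum_sub_distrib] at h1
      rw [Finset.sum_congr rfl e, Finset.sum_add_distrib, ← Finset.smul_sum] at h1
      have hcomm : ∀ i j (w : M), (xN p q n i : HeckeB p q n) • (xN p q n j : HeckeB p q n) • w =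
          (xN p q n j : HeckeB p q n) • (xN p q n i : HeckeB p q n) • w := fun i j w => by
        rw [← mul_smul, (xN_val_comm i j).eq, mul_smul]
      -- The family (X_s - a) u_j has a smaller exponent, and the stripped terms commute with
      -- X_{s+1}, so their sum is an admissible new y.
      have hz : ∀ j ∈ Finset.Ico b (s + 1), xN p q n s • u j - a • u j = 0 := by
        refine ihm (fun j => xN p q n s • u j - a • u j) (fun j => ?_) (fun j i hbi his => ?_) _ ?_
          h1 (fun j hj => ?_)
        · have h3 : xN p q n (s + 1) • xN p q n s • u j = xN p q n s • xN p q n (s + 1) • u j :=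
            hcomm _ _ _
          rw [smul_sub, smul_comm _ a, h3, hu, smul_sub, smul_comm a (xN p q n s)]
        · have hui := hn j i hbi his
          refine sub_mem ?_ (Submodule.smul_mem _ _ hui)
          obtain ⟨k, hk⟩ := (Module.End.mem_maxGenEigenspace _ _ _).1 hui
          refine (Module.End.mem_maxGenEigenspace _ _ _).2 ⟨k, ?_⟩
          refine (map_sub_smul_one_pow (φ := Algebra.lsmul F F M (xN p q n s : HeckeB p q n))
            (f := Algebra.lsmul F F M (xN p q n i : HeckeB p q n))
            (g := Algebra.lsmul F F M (xN p q n i : HeckeB p q n))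
            (fun w => hcomm s i w) a k (u j)).symm.trans ?_
          rw [hk, map_zero]
        · rw [smul_comm _ (qc p q 1 * a), smul_comm a]
          congr 1
          rw [Finset.smul_sum, Finset.smul_sum]
          refine Finset.sum_congr rfl fun j _ => ?_
          rw [Units.smul_def, ← mul_smul, (xN_ladder_comm s.lt_succ_self).eq, mul_smul,
            ← Units.smul_def, hu, smul_comm a]
        · have := hm j hj
          rw [pow_succ, Module.End.mul_apply] at this
          exact this
      rw [Finset.sum_eq_zero (fun j hj => by rw [hz j hj, smul_zero]), zero_add,
        smul_eq_zero_iff_right (mul_ne_zero hq ha)] at h1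
      have h2 : ∀ j ∈ Finset.Ico b (s + 1), xN p q n s • u j = a • u j := fun j hj =>
        sub_eq_zero.1 (hz j hj)
      -- What remains is ca Σ T_j ⋯ T_{s-1} u_j = 0 with ca ≠ 0: a relation one step shorter, whose
      -- term j = s has an empty product and serves as y. The extension by zero meets the hypotheses
      -- for every index.
      let u' : ℕ → M := fun j => if j ∈ Finset.Ico b (s + 1) then u j else 0
      have hu' : ∀ j ∈ Finset.Ico b (s + 1), u' j = u j := fun j hj => if_pos hj
      have hsb : s ∈ Finset.Ico b (s + 1) := Finset.mem_Ico.2 ⟨hbs, s.lt_succ_self⟩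
      rw [Finset.sum_Ico_succ_top hbs, ladder_of_le le_rfl, one_smul] at h1
      have hsub : ∀ j ∈ Finset.Ico b s, j ∈ Finset.Ico b (s + 1) := fun j hj =>
        Finset.Ico_subset_Ico_right s.le_succ hj
      have h4 : ∀ j ∈ Finset.Ico b s, u j = 0 := by
        intro j hj
        rw [← hu' j (hsub j hj)]
        refine ih (by omega) u' (fun j => ?_) (fun j i hbi his => ?_) (u s) (h2 s hsb) ?_ j hj
        · by_cases hj : j ∈ Finset.Ico b (s + 1)
          · rw [hu' j hj, h2 j hj]
          · simp only [u', if_neg hj, smul_zero]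
        · by_cases hj : j ∈ Finset.Ico b (s + 1)
          · rw [hu' j hj]
            exact hn j i hbi (by omega)
          · simp only [u', if_neg hj]
            exact zero_mem _
        · rw [← h1]
          congr 1
          exact Finset.sum_congr rfl fun j hj => by rw [hu' j (hsub j hj)]
      rw [Finset.sum_eq_zero (fun j hj => by rw [h4 j hj, smul_zero]), zero_add] at h1
      intro j hj
      rcases Nat.lt_or_ge j s with hjs | hjs
      · exact h4 j (Finset.mem_Ico.2 ⟨(Finset.mem_Ico.1 hj).1, hjs⟩)
      · obtain rfl : j = s := by
          have := (Finset.mem_Ico.1 hj).2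
          omega
        exact h1

/-- Eigenvectors of the last lattice generator produce linearly independent vectors. -/
theorem mul_finrank_le_finrank_tailSpace [FiniteDimensional F M] (hq : qc p q 1 ≠ 0) (ha : a ≠ 0)
    (hb : 1 ≤ b) (hbn : b ≤ n) (U : Submodule F M) (hU : U ≤ tailSpace p q n a M b)
    (hX : ∀ u ∈ U, xN p q n n • u = a • u) :
    (n + 1 - b) * Module.finrank F U ≤ Module.finrank F (tailSpace p q n a M b) := by
  let Φ : (Fin (n + 1 - b) → U) →ₗ[F] tailSpace p q n a M b :=
    ∑ j : Fin (n + 1 - b), (LinearMap.restrict (Algebra.lsmul F F M (ladder p q n (b + j) n))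
      (fun v hv => ladder_mem_tailSpace (by omega) (by omega) le_rfl (hU hv))) ∘ₗ
        LinearMap.proj j
  have hΦ : ∀ u, (Φ u : M) = ∑ j : Fin (n + 1 - b), ladder p q n (b + j) n • (u j : M) := by
    intro u
    simp only [Φ, LinearMap.sum_apply, AddSubmonoidClass.coe_finsetSum]
    rfl
  have hinj : Function.Injective Φ := by
    rw [← LinearMap.ker_eq_bot, LinearMap.ker_eq_bot']
    intro u hu0
    have h0 : ∑ j : Fin (n + 1 - b), ladder p q n (b + j) n • (u j : M) = 0 := by
      rw [← hΦ, hu0]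
      rfl
    let w : ℕ → M := fun j => if h : b ≤ j ∧ j ≤ n then u ⟨j - b, by omega⟩ else 0
    have hw : ∀ j : Fin (n + 1 - b), w (b + j) = u j := by
      intro j
      have h : b ≤ b + j.val ∧ b + j.val ≤ n := by omega
      simp only [w, dif_pos h]
      congr 2
      exact Fin.ext (by simp)
    have hwU : ∀ j, w j ∈ U := by
      intro j
      simp only [w]
      split_ifs
      · exact Submodule.coe_mem _
      · exact zero_mem _
    -- Of the n + 1 - b summands the one with j = n has an empty product, so it takes the role of y.
    have h1 : ∑ j ∈ Finset.Ico b n, ladder p q n j n • w j + w n = 0 := by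
      have h2 : ladder p q n n n • w n = w n := by rw [ladder_of_le le_rfl, one_smul]
      rw [← h2, ← Finset.sum_Ico_succ_top hbn (fun j => ladder p q n j n • w j),
        Finset.sum_Ico_eq_sum_range, ← h0, ← Fin.sum_univ_eq_sum_range
          (fun j => ladder p q n (b + j) n • w (b + j))]
      exact Finset.sum_congr rfl fun j _ => by rw [hw]
    have h3 := ladder_independent hq ha hb le_rfl w (fun j => hX _ (hwU j))
      (fun j i hi hin => mem_tailSpace.1 (hU (hwU j)) i hi hin.le) (w n) (hX _ (hwU n)) h1
    rw [Finset.sum_eq_zero (fun j hj => by rw [h3 j hj, smul_zero]), zero_add] at h1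
    funext j
    refine Subtype.ext ?_
    rw [← hw]
    rcases Nat.lt_or_ge (b + j.val) n with h | h
    · exact h3 _ (Finset.mem_Ico.2 ⟨by omega, h⟩)
    · have : b + j.val = n := by omega
      rw [this, h1]
      rfl
  have := LinearMap.finrank_le_finrank_of_injective hinj
  rwa [Module.finrank_pi_fintype, Finset.sum_const, Finset.card_univ, Fintype.card_fin,
    smul_eq_mul] at this

end HeckeB

namespace HeckeB
variable {F : Type*} [Field F] {p q : Fˣ} {n : ℕ}

/-! ### The upper bound for the tail eigenspace of f_a N. -/

section UpperBound

variable {a : Fˣ} {N : Type*} [AddCommGroup N] [Module F N] [Module (HeckeB p q n) N]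
  [IsScalarTower F (HeckeB p q n) N] [FiniteDimensional F N] {b : ℕ}

variable (p q n a N) in
/-- The filtration `∑_{l < k} w_l (1 ⊗ N)` of `f_a N`. -/
noncomputable def indFilt (k : ℕ) : Submodule F (fInd p q n a N) :=
  filt (p := p) (q := q) (n := n) (LinearMap.range (toInd p q n a N)) k

variable (p q n a N) in
/-- The embedding of `N` into the quotient of `f_a N` by a step of the filtration. -/
noncomputable def gradedMap (k : ℕ) : N →ₗ[F] fInd p q n a N ⧸ indFilt p q n a N k :=
  (indFilt p q n a N k).mkQ ∘ₗ Algebra.lsmul F F _ (word p q n k) ∘ₗ toInd p q n a N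

omit [IsScalarTower F (HeckeB p q n) N] [FiniteDimensional F N] in
theorem gradedMap_eq_iff {k : ℕ} {v : N} {g : fInd p q n a N} :
    gradedMap p q n a N k v = (indFilt p q n a N k).mkQ g ↔
      g - word p q n k • toInd p q n a N v ∈ indFilt p q n a N k := by
  rw [eq_comm]
  exact Submodule.Quotient.eq _

theorem gradedMap_injective {k : ℕ} (hk : k ≤ 2 * n + 1) :
    Function.Injective (gradedMap p q n a N k) := by
  rw [← LinearMap.ker_eq_bot, LinearMap.ker_eq_bot']
  intro v hv
  refine eq_zero_of_word_smul_toInd_mem (p := p) (q := q) (a := a) hk ?_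
  exact (Submodule.Quotient.mk_eq_zero _).1 hv

/-- The lattice acts on the quotient by a step of the filtration. -/
noncomputable def quotientX (k : ℕ) (hk : k ≤ 2 * n + 1) (i : ℕ) (hi : i ≤ n + 1) :
    Module.End F (fInd p q n a N ⧸ indFilt p q n a N k) :=
  (indFilt p q n a N k).mapQ (indFilt p q n a N k)
    (Algebra.lsmul F F _ (xN p q (n + 1) i : HeckeB p q (n + 1)))
    (fun g hg => ((xN_filt toInd_parabolicStable k hk).1 g hg i hi).1)

omit [FiniteDimensional F N] in
theorem quotientX_gradedMap {k : ℕ} (hk : k ≤ 2 * n + 1) {i : ℕ} (hi : i ≤ n + 1) {v w : N}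
    (h : twist p q n k i • toInd p q n a N v = toInd p q n a N w) :
    quotientX k hk i hi (gradedMap p q n a N k v) = gradedMap p q n a N k w := by
  refine (Submodule.Quotient.eq _).2 ?_
  have := (xN_filt (p := p) (q := q) (toInd_parabolicStable (a := a) (N := N)) k hk).2.1 _ ⟨v, rfl⟩ i hi
  rw [h] at this
  exact this

/-- The k-th subquotient is a copy of N inside f_a N modulo step k, so a generalized eigenvector of
X_i on f_a N with leading term v makes v one of X_j on N. -/
theorem mem_maxGenEigenspace_of_gradedMap {k : ℕ} (hk : k ≤ 2 * n + 1) {i j : ℕ} (hi : i ≤ n + 1)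
    (h : ∀ v, twist p q n k i • toInd p q n a N v = toInd p q n a N (xN p q n j • v)) {v : N}
    {g : fInd p q n a N} (hv : gradedMap p q n a N k v = (indFilt p q n a N k).mkQ g)
    (hg : g ∈ (Algebra.lsmul F F _ (xN p q (n + 1) i : HeckeB p q (n + 1))).maxGenEigenspace
      (a : F)) :
    v ∈ (Algebra.lsmul F F _ (xN p q n j : HeckeB p q n)).maxGenEigenspace (a : F) := by
  rw [Module.End.mem_maxGenEigenspace] at hg ⊢
  obtain ⟨m, hm⟩ := hg
  refine ⟨m, gradedMap_injective (p := p) (q := q) (a := a) hk ?_⟩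
  rw [map_zero, map_sub_smul_one_pow (g := quotientX k hk i hi)
    (fun v => (quotientX_gradedMap hk hi (h v)).symm), hv,
    ← map_sub_smul_one_pow (φ := (indFilt p q n a N k).mkQ) (fun v => rfl), hm, map_zero]

omit [IsScalarTower F (HeckeB p q n) N] [FiniteDimensional F N] in
theorem twist_toInd_of_lt {k i : ℕ} (h0 : 1 ≤ i) (h : i < chainPos n k) (hk : k ≤ 2 * n + 1)
    (v : N) : twist p q n k i • toInd p q n a N v = toInd p q n a N (xN p q n i • v) := by
  have hi : i ≤ n := by
    unfold chainPos at h
    split_ifs at h <;> omega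
  rw [twist, if_neg (by omega), if_pos h, Units.smul_def, Units.smul_def, ← incl_xN hi,
    incl_smul_toInd]

omit [IsScalarTower F (HeckeB p q n) N] [FiniteDimensional F N] in
theorem twist_toInd_of_gt {k i : ℕ} (h : chainPos n k < i) (hi : i ≤ n + 1)
    (v : N) : twist p q n k i • toInd p q n a N v = toInd p q n a N (xN p q n (i - 1) • v) := by
  rw [twist, if_neg (by omega), if_neg (by omega), if_neg (by omega), Units.smul_def,
    Units.smul_def, ← incl_xN (by omega), incl_smul_toInd]

theorem one_le_chainPos {k : ℕ} : 1 ≤ chainPos n k := by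
  unfold chainPos
  split_ifs <;> omega

/-- The contribution of the `k`-th graded piece to the joint generalized eigenspace. -/
theorem mem_tailSpace_of_gradedMap {k : ℕ} (hk : k ≤ 2 * n + 1) (hb : 1 ≤ b) {v : N}
    {g : fInd p q n a N} (hv : gradedMap p q n a N k v = (indFilt p q n a N k).mkQ g)
    (hg : g ∈ tailSpace p q (n + 1) (a : F) (fInd p q n a N) b) :
    v ∈ tailSpace p q n (a : F) N (if b ≤ chainPos n k then b else b - 1) := by
  rw [mem_tailSpace] at hg ⊢
  intro i hi hin
  -- With J the position of w_k, X_i acts as X_i for i < J and as X_{i-1} for i > J. If J ≥ b,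
  -- deleting X_J from X_b, …, X_{n+1} leaves X_b, …, X_n; if J < b the list becomes X_{b-1}, …,
  -- X_n.
  split_ifs at hi with hJ
  · rcases Nat.lt_or_ge i (chainPos n k) with h | h
    · exact mem_maxGenEigenspace_of_gradedMap hk (by omega)
        (twist_toInd_of_lt (by omega) h hk) hv (hg i hi (by omega))
    · refine mem_maxGenEigenspace_of_gradedMap hk (i := i + 1) (by omega) ?_ hv
        (hg (i + 1) (by omega) (by omega))
      exact twist_toInd_of_gt (by omega) (by omega)
  · refine mem_maxGenEigenspace_of_gradedMap hk (i := i + 1) (by omega) ?_ hv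
        (hg (i + 1) (by omega) (by omega))
    exact twist_toInd_of_gt (by omega) (by omega)

/-- By minimality of b the steps with J < b add nothing; since J ≥ 1 this case forces b ≥ 2. Every
other step adds at most dim N_b. -/
theorem finrank_tailSpace_inf_indFilt_le (hb : 1 ≤ b)
    (hmin : 2 ≤ b → tailSpace p q n (a : F) N (b - 1) = ⊥) {k : ℕ} (hk : k ≤ 2 * n + 2) :
    Module.finrank F (tailSpace p q (n + 1) (a : F) (fInd p q n a N) b ⊓ indFilt p q n a N k :
      Submodule F (fInd p q n a N)) ≤
    ((Finset.range k).filter (fun l => b ≤ chainPos n l)).card *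
      Module.finrank F (tailSpace p q n (a : F) N b) := by
  have := finiteDimensional_fInd (p := p) (q := q) (n := n) (a := a) (N := N)
  induction k with
  | zero =>
    have h : indFilt p q n a N 0 = ⊥ := rfl
    rw [h, inf_bot_eq, finrank_bot]
    exact Nat.zero_le _
  | succ k ih =>
    set V := tailSpace p q (n + 1) (a : F) (fInd p q n a N) b
    let f := (indFilt p q n a N k).mkQ ∘ₗ (V ⊓ indFilt p q n a N (k + 1)).subtype
    rw [← LinearMap.finrank_range_add_finrank_ker f]
    have h1 : Module.finrank F (LinearMap.ker f) ≤
        Module.finrank F (V ⊓ indFilt p q n a N k : Submodule F (fInd p q n a N)) := by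
      have hx : ∀ x : LinearMap.ker f, (x.1.1 : fInd p q n a N) ∈ V ⊓ indFilt p q n a N k :=
        fun x => ⟨x.1.2.1, (Submodule.Quotient.mk_eq_zero _).1 x.2⟩
      exact LinearMap.finrank_le_finrank_of_injective (f := LinearMap.codRestrict _
        ((V ⊓ indFilt p q n a N (k + 1)).subtype ∘ₗ (LinearMap.ker f).subtype) hx)
        (fun x y hxy => by
          have h := congrArg Subtype.val hxy
          exact Subtype.ext (Subtype.ext h))
    have h2 : LinearMap.range f ≤ (tailSpace p q n (a : F) N
        (if b ≤ chainPos n k then b else b - 1)).map (gradedMap p q n a N k) := by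
      rintro _ ⟨⟨g, hgV, hg⟩, rfl⟩
      obtain ⟨g0, hg0, _, ⟨_, ⟨v, rfl⟩, rfl⟩, e⟩ := Submodule.mem_sup.1 hg
      have hv : gradedMap p q n a N k v = (indFilt p q n a N k).mkQ g := by
        rw [gradedMap_eq_iff, ← e]
        change g0 + word p q n k • toInd p q n a N v - _ ∈ _
        rwa [add_sub_cancel_right]
      exact ⟨v, mem_tailSpace_of_gradedMap (by omega) hb hv hgV, hv⟩
    have h4 := ih (by omega)
    rw [Finset.range_add_one, Finset.filter_insert]
    by_cases hJ : b ≤ chainPos n k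
    · rw [if_pos hJ] at h2
      have h3 := (Submodule.finrank_mono h2).trans (Submodule.finrank_map_le _ _)
      rw [if_pos hJ, Finset.card_insert_of_notMem (by simp), add_mul, one_mul]
      omega
    · rw [if_neg hJ, hmin (by have := one_le_chainPos (n := n) (k := k); omega)] at h2
      have h3 := (Submodule.finrank_mono h2).trans (Submodule.finrank_map_le _ _)
      rw [finrank_bot] at h3
      rw [if_neg hJ]
      omega

/-- The position runs from n + 1 down to 1 and back up, visiting each of b, …, n + 1 twice. -/
theorem card_filter_chainPos_le (hb : b ≤ n + 1) :
    ((Finset.range (2 * n + 2)).filter (fun l => b ≤ chainPos n l)).card ≤ 2 * (n + 2 - b) := by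
  have h : (Finset.range (2 * n + 2)).filter (fun l => b ≤ chainPos n l) ⊆
      Finset.range (n + 2 - b) ∪ Finset.Ico (n + b) (2 * n + 2) := by
    intro l hl
    rw [Finset.mem_filter, Finset.mem_range] at hl
    rw [Finset.mem_union, Finset.mem_range, Finset.mem_Ico]
    obtain ⟨h1, h2⟩ := hl
    unfold chainPos at h2
    split_ifs at h2 <;> omega
  refine (Finset.card_le_card h).trans ((Finset.card_union_le _ _).trans ?_)
  rw [Finset.card_range, Nat.card_Ico]
  omega

theorem finrank_tailSpace_fInd_le (hb : 1 ≤ b) (hbn : b ≤ n + 1)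
    (hmin : 2 ≤ b → tailSpace p q n (a : F) N (b - 1) = ⊥) :
    Module.finrank F (tailSpace p q (n + 1) (a : F) (fInd p q n a N) b) ≤
      2 * (n + 2 - b) * Module.finrank F (tailSpace p q n (a : F) N b) := by
  have h := finrank_tailSpace_inf_indFilt_le (p := p) (q := q) (a := a) (N := N) hb hmin le_rfl
  rw [indFilt, filt_toInd_top, inf_top_eq] at h
  exact h.trans (Nat.mul_le_mul_right _ (card_filter_chainPos_le hbn))

end UpperBound

/-! ### Submodules of f_a N and the top subquotient. -/

section Socle

variable {a : Fˣ} {N : Type*} [AddCommGroup N] [Module F N] [Module (HeckeB p q n) N]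
  [IsScalarTower F (HeckeB p q n) N]

omit [IsScalarTower F (HeckeB p q n) N] in
theorem eq_top_of_stable [IsSimpleModule (HeckeB p q n) N] (P : Submodule F N)
    (hP : ∀ (h : HeckeB p q n), ∀ v ∈ P, h • v ∈ P) (h0 : ∃ v ∈ P, v ≠ 0) (v : N) : v ∈ P := by
  let P' : Submodule (HeckeB p q n) N :=
    { P with smul_mem' := fun h v hv => hP h v hv }
  rcases eq_bot_or_eq_top P' with h | h
  · obtain ⟨w, hw, hw0⟩ := h0
    have hw' : w ∈ P' := hw
    rw [h, Submodule.mem_bot] at hw'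
    exact absurd hw' hw0
  · have : v ∈ P' := h ▸ Submodule.mem_top
    exact this

variable [FiniteDimensional F N] {b : ℕ}

/-- A nonzero submodule of `f_a N` is not contained in the largest proper filtration step. -/
theorem exists_notMem_indFilt {K : Submodule (HeckeB p q (n + 1)) (fInd p q n a N)}
    (hK : K ≠ ⊥) : ∃ x ∈ K, x ∉ indFilt p q n a N (2 * n + 1) := by
  have key : ∀ k ≤ 2 * n + 1, ∃ x ∈ K, x ∉ indFilt p q n a N k := by
    intro k hk
    induction k with
    | zero =>
      obtain ⟨x, hx, hx0⟩ := (Submodule.ne_bot_iff _).1 hK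
      exact ⟨x, hx, hx0⟩
    | succ k ih =>
      obtain ⟨x, hx, hxk⟩ := ih (by omega)
      by_cases h : x ∈ indFilt p q n a N (k + 1)
      swap
      · exact ⟨x, hx, h⟩
      -- If x has leading term w_k v, then T_{i_k} x has leading term w_{k+1} v, which is nonzero
      -- because that subquotient is a full copy of N. A nonzero element can thus be pushed to the
      -- top.
      refine ⟨tN p q (n + 1) (chainIdx n k) • x, K.smul_mem _ hx, fun hT => hxk ?_⟩
      rw [indFilt, filt, Submodule.mem_sup] at h
      obtain ⟨g, hg, _, ⟨_, ⟨v, rfl⟩, rfl⟩, rfl⟩ := h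
      have hd : chainIdx n k ≤ n := by
        unfold chainIdx
        split_ifs <;> omega
      have h1 := tN_smul_filt toInd_parabolicStable (by omega) hd hg
      rw [smul_add] at hT
      have h2 := sub_mem hT h1
      rw [add_sub_cancel_left] at h2
      have h3 : word p q n (k + 1) • toInd p q n a N v ∈
          filt (p := p) (q := q) (n := n) (LinearMap.range (toInd p q n a N)) (k + 1) := by
        rw [word, mul_smul]
        exact h2
      rw [eq_zero_of_word_smul_toInd_mem (by omega) h3, map_zero, map_zero, add_zero]
      exact hg
  exact key _ le_rfl

omit [FiniteDimensional F N] in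
theorem gradedMap_top_surjective : Function.Surjective (gradedMap p q n a N (2 * n + 1)) := by
  intro x
  obtain ⟨g, rfl⟩ := Submodule.mkQ_surjective _ x
  have hg : g ∈ filt (p := p) (q := q) (n := n) (LinearMap.range (toInd p q n a N))
      (2 * n + 1 + 1) := by
    rw [filt_toInd_top]
    exact Submodule.mem_top
  rw [filt, Submodule.mem_sup] at hg
  obtain ⟨g0, hg0, _, ⟨_, ⟨v, rfl⟩, rfl⟩, rfl⟩ := hg
  refine ⟨v, ?_⟩
  rw [gradedMap_eq_iff]
  change g0 + word p q n _ • toInd p q n a N v - _ ∈ _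
  rwa [add_sub_cancel_right]

variable (p q n a N) in
/-- The projection of `f_a N` onto its top graded piece. -/
noncomputable def topProj : fInd p q n a N →ₗ[F] N :=
  (LinearEquiv.ofBijective (gradedMap p q n a N (2 * n + 1))
    ⟨gradedMap_injective le_rfl, gradedMap_top_surjective⟩).symm.toLinearMap ∘ₗ
      (indFilt p q n a N (2 * n + 1)).mkQ

theorem topProj_eq_iff {g : fInd p q n a N} {v : N} : topProj p q n a N g = v ↔
    g - word p q n (2 * n + 1) • toInd p q n a N v ∈ indFilt p q n a N (2 * n + 1) := by
  rw [topProj, LinearMap.comp_apply, LinearEquiv.coe_coe, LinearEquiv.symm_apply_eq, eq_comm]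
  exact gradedMap_eq_iff

theorem topProj_sub_mem (g : fInd p q n a N) :
    g - word p q n (2 * n + 1) • toInd p q n a N (topProj p q n a N g) ∈
      indFilt p q n a N (2 * n + 1) := topProj_eq_iff.1 rfl

theorem topProj_xN {i : ℕ} (hi : i ≤ n + 1) {g : fInd p q n a N} {w : N}
    (h : twist p q n (2 * n + 1) i • toInd p q n a N (topProj p q n a N g) = toInd p q n a N w) :
    topProj p q n a N (xN p q (n + 1) i • g) = w := by
  obtain ⟨h1, h2, -⟩ := xN_filt (p := p) (q := q) (toInd_parabolicStable (a := a) (N := N))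
    (2 * n + 1) le_rfl
  have h3 := add_mem (h1 _ (topProj_sub_mem g) i hi).1 (h2 _ ⟨topProj p q n a N g, rfl⟩ i hi)
  rw [smul_sub, sub_add_sub_cancel, h] at h3
  exact topProj_eq_iff.2 h3

theorem topProj_xN_pos {i : ℕ} (h1 : 1 ≤ i) (hi : i ≤ n) (g : fInd p q n a N) :
    topProj p q n a N (xN p q (n + 1) i • g) = xN p q n i • topProj p q n a N g := by
  refine topProj_xN (by omega) (twist_toInd_of_lt h1 ?_ le_rfl _)
  unfold chainPos
  split_ifs <;> omega

/-- The longest representative inverts X_{n+1}, whence a⁻¹. -/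
theorem topProj_xN_last (g : fInd p q n a N) :
    topProj p q n a N (xN p q (n + 1) (n + 1) • g) = (a : F)⁻¹ • topProj p q n a N g := by
  refine topProj_xN le_rfl ?_
  have hJ : chainPos n (2 * n + 1) = n + 1 := by
    unfold chainPos
    split_ifs <;> omega
  rw [twist, hJ, if_neg (by omega), if_neg (by omega), if_pos rfl, if_neg (by omega),
    inv_smul_eq_iff, map_smul, smul_comm, xN_last_smul_toInd, inv_smul_smul₀ a.ne_zero]

theorem topProj_xN_zero (g : fInd p q n a N) :
    topProj p q n a N (xN p q (n + 1) 0 • g) = (a : F) • xN p q n 0 • topProj p q n a N g := by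
  refine topProj_xN (by omega) ?_
  rw [twist, if_pos rfl, if_neg (by omega), mul_smul, xN_last_smul_toInd, map_smul, smul_comm,
    Units.smul_def (xN p q (n + 1) 0), ← incl_xN (Nat.zero_le n), incl_smul_toInd, Units.smul_def]

theorem topProj_tN {i : ℕ} (hi : i < n) (g : fInd p q n a N) :
    topProj p q n a N (tN p q (n + 1) i • g) = tN p q n i • topProj p q n a N g := by
  rw [topProj_eq_iff]
  have h := tN_smul_filt_colevel_one (p := p) (q := q) toInd_parabolicStable hi (topProj_sub_mem g)
  have hw := (tN_mul_word (p := p) (q := q) (2 * n + 1) le_rfl).1 i (by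
    unfold chainPos
    split_ifs <;> omega)
  rw [smul_sub, ← mul_smul (tN p q (n + 1) i) (word _ _ _ _), hw, mul_smul, ← incl_tN hi,
    incl_smul_toInd] at h
  rw [← incl_tN hi]
  exact h

variable [hN : IsSimpleModule (HeckeB p q n) N]

/-- The projection commutes with T_i for i < n and with X_1, …, X_n, and with X_0 up to the scalar
a. The image of K is therefore an H_n-submodule of the simple module N, and it is nonzero because K
reaches the top. -/
theorem topProj_surjOn {K : Submodule (HeckeB p q (n + 1)) (fInd p q n a N)} (hK : K ≠ ⊥)
    (v : N) : ∃ x ∈ K, topProj p q n a N x = v := by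
  let P : Submodule F N := (K.restrictScalars F).map (topProj p q n a N)
  have hX : ∀ j ≤ n, ∀ v ∈ P, xN p q n j • v ∈ P := by
    rintro j hj _ ⟨x, hx, rfl⟩
    have hx' : ∀ h : HeckeB p q (n + 1), h • x ∈ K.restrictScalars F := fun h => K.smul_mem h hx
    rcases Nat.eq_zero_or_pos j with rfl | h0
    · refine ⟨(a : F)⁻¹ • (xN p q (n + 1) 0 : HeckeB p q (n + 1)) • x,
        Submodule.smul_mem _ _ (hx' _), ?_⟩
      rw [map_smul, ← Units.smul_def, topProj_xN_zero, inv_smul_smul₀ a.ne_zero]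
    · exact ⟨_, hx' (xN p q (n + 1) j), topProj_xN_pos h0 hj x⟩
  refine eq_top_of_stable (p := p) (q := q) (n := n) P (fun h => ?_) ?_ v
  · induction h using gen_induction with
    | hs r =>
      intro v hv
      rw [algebraMap_smul]
      exact P.smul_mem _ hv
    | hT i hi =>
      rintro _ ⟨x, hx, rfl⟩
      exact ⟨tN p q (n + 1) i • x, K.smul_mem _ hx, topProj_tN hi x⟩
    | hX j hj => exact hX j hj
    | hX' j hj =>
      intro v hv
      -- Stability under X_j⁻¹ follows from stability under X_j: an injective endomorphism of a
      -- finite-dimensional space is onto.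
      have hinj : Function.Injective ((Algebra.lsmul F F N (xN p q n j : HeckeB p q n)).restrict
          (hX j hj)) := fun x y hxy => Subtype.ext (smul_left_cancel (xN p q n j)
            (congrArg Subtype.val hxy))
      obtain ⟨w, hw⟩ := LinearMap.injective_iff_surjective.1 hinj ⟨v, hv⟩
      have e : xN p q n j • (w : N) = v := congrArg Subtype.val hw
      rw [← Units.smul_def, ← e, inv_smul_smul]
      exact w.2
    | hmul a b ha hb =>
      intro v hv
      rw [mul_smul]
      exact ha _ (hb _ hv)
    | hadd a b ha hb =>
      intro v hv
      rw [add_smul]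
      exact add_mem (ha _ hv) (hb _ hv)
  · obtain ⟨x, hx, hx'⟩ := exists_notMem_indFilt hK
    refine ⟨_, ⟨x, hx, rfl⟩, fun h0 => hx' ?_⟩
    have := topProj_sub_mem x
    rwa [h0, map_zero, smul_zero, sub_zero] at this

/-- The joint generalized eigenspace detects the submodules of `f_a N`. -/
theorem exists_mem_tailSpace (ha : (a : F)⁻¹ = a) (hb : 1 ≤ b)
    (hV : tailSpace p q n (a : F) N b ≠ ⊥)
    {K : Submodule (HeckeB p q (n + 1)) (fInd p q n a N)} (hK : K ≠ ⊥) :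
    ∃ x ∈ K, x ∈ tailSpace p q (n + 1) (a : F) (fInd p q n a N) b ∧ x ≠ 0 := by
  have := finiteDimensional_fInd (p := p) (q := q) (n := n) (a := a) (N := N)
  have : FiniteDimensional F K := inferInstanceAs (FiniteDimensional F (K.restrictScalars F))
  obtain ⟨w, hw, hw0⟩ := (Submodule.ne_bot_iff _).1 hV
  let φ : K →ₗ[F] N := topProj p q n a N ∘ₗ (K.subtype.restrictScalars F)
  have hφ : Function.Surjective φ := fun v => by
    obtain ⟨x, hx, e⟩ := topProj_surjOn (a := a) hK v
    exact ⟨⟨x, hx⟩, e⟩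
  -- The operators that X_b, …, X_{n+1} induce on the top subquotient; the last is the scalar a⁻¹ =
  -- a. For these, N_b lies in the joint eigenspace, and a nonzero vector of it lifts to K.
  let g : ℕ → Module.End F N := fun i =>
    if i ≤ n then Algebra.lsmul F F N (xN p q n i : HeckeB p q n) else (a : F) • 1
  have hg : ∀ i ∈ Finset.Icc b (n + 1), ∀ x : K,
      φ (Algebra.lsmul F F K (xN p q (n + 1) i : HeckeB p q (n + 1)) x) = g i (φ x) := by
    intro i hi x
    rw [Finset.mem_Icc] at hi
    by_cases hin : i ≤ n
    · simp only [g, if_pos hin]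
      exact topProj_xN_pos (by omega) hin _
    · obtain rfl : i = n + 1 := by omega
      simp only [g, if_neg hin]
      refine (topProj_xN_last _).trans ?_
      rw [ha]
      rfl
  have hw' : w ∈ genEig g (a : F) (Finset.Icc b (n + 1)) := by
    rw [mem_genEig]
    intro i hi
    rw [Finset.mem_Icc] at hi
    by_cases hin : i ≤ n
    · simp only [g, if_pos hin]
      exact mem_genEig.1 hw i (Finset.mem_Icc.2 ⟨hi.1, hin⟩)
    · simp only [g, if_neg hin]
      exact ⟨1, by simp⟩
  obtain ⟨x, hx, e⟩ := exists_mem_genEig_of_surjective hφ hg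
    (fun i j => (xN_val_comm i j).map _) hw'
  refine ⟨x, x.2, ?_, fun h0 => hw0 ?_⟩
  · exact map_mem_genEig (φ := K.subtype.restrictScalars F) (fun i _ v => rfl) hx
  · rw [← e]
    change topProj p q n a N x = 0
    rw [h0, map_zero]

end Socle
end HeckeB

namespace HeckeB
variable {F : Type*} [Field F] {p q : Fˣ} {n : ℕ}

/-! ### Cosocles and pairs of quotients. -/

section Modules

/-- A semisimple quotient has zero Jacobson radical, so it factors through M modulo its own radical.
With a single maximal submodule K that radical is K. -/
theorem isSimpleModule_cosocle_of_unique_isCoatom {R M : Type*} [Ring R] [AddCommGroup M]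
    [Module R M] {K : Submodule R M} (hK : IsCoatom K) (h : ∀ L : Submodule R M, IsCoatom L → L = K) :
    IsSimpleModule R (Cosocle R M) := by
  have hs : IsSimpleModule R (M ⧸ K) := isSimpleModule_iff_isCoatom.2 hK
  have hj : Module.jacobson R M = K := by
    refine le_antisymm (sInf_le hK) (le_sInf fun L hL => (h L hL).ge)
  have e : sInf {L : Submodule R M | IsSemisimpleModule R (M ⧸ L)} = K := by
    refine le_antisymm (sInf_le (inferInstanceAs (IsSemisimpleModule R (M ⧸ K))))
      (le_sInf fun L hL => ?_)
    have hL' : IsSemisimpleModule R (M ⧸ L) := hL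
    rw [← hj]
    exact Module.jacobson_le_of_eq_bot (IsSemisimpleModule.jacobson_eq_bot R (M ⧸ L))
  change IsSimpleModule R (M ⧸ sInf {L : Submodule R M | IsSemisimpleModule R (M ⧸ L)})
  rw [e]
  exact hs

variable {a : F} {M : Type*} [AddCommGroup M] [Module F M]
    [Module (HeckeB p q n) M] [IsScalarTower F (HeckeB p q n) M] {b : ℕ}

/-- By the Chinese remainder theorem M maps onto M/K₁ × M/K₂ with kernel K₁ ∩ K₂, and generalized
eigenvectors lift along surjections. -/
theorem finrank_tailSpace_quotient_add_le [FiniteDimensional F M]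
    (K₁ K₂ : Submodule (HeckeB p q n) M) (h : K₁ ⊔ K₂ = ⊤) :
    Module.finrank F (tailSpace p q n a (M ⧸ K₁) b) +
      Module.finrank F (tailSpace p q n a (M ⧸ K₂) b) +
      Module.finrank F (tailSpace p q n a M b ⊓ (K₁ ⊓ K₂).restrictScalars F : Submodule F M) ≤
    Module.finrank F (tailSpace p q n a M b) := by
  let φ : M →ₗ[F] (M ⧸ K₁) × (M ⧸ K₂) := (K₁.mkQ.prod K₂.mkQ).restrictScalars F
  have hφ : Function.Surjective φ := by
    rintro ⟨x, y⟩
    obtain ⟨x, rfl⟩ := K₁.mkQ_surjective x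
    obtain ⟨y, rfl⟩ := K₂.mkQ_surjective y
    obtain ⟨k₁, h₁, k₂, h₂, e⟩ := Submodule.mem_sup.1 (h ▸ Submodule.mem_top : x - y ∈ K₁ ⊔ K₂)
    refine ⟨x - k₁, Prod.ext ?_ ?_⟩
    · refine (Submodule.Quotient.eq _).2 ?_
      rw [sub_sub_cancel_left]
      exact neg_mem h₁
    · refine (Submodule.Quotient.eq _).2 ?_
      rw [sub_right_comm, ← e, add_sub_cancel_left]
      exact h₂
  let f := φ ∘ₗ (tailSpace p q n a M b).subtype
  rw [← LinearMap.finrank_range_add_finrank_ker f]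
  refine add_le_add ?_ ?_
  · have hr : ∀ z : tailSpace p q n a (M ⧸ K₁) b × tailSpace p q n a (M ⧸ K₂) b,
        ((z.1 : M ⧸ K₁), (z.2 : M ⧸ K₂)) ∈ LinearMap.range f := by
      intro z
      let g : ℕ → Module.End F ((M ⧸ K₁) × (M ⧸ K₂)) := fun i =>
        (Algebra.lsmul F F (M ⧸ K₁) (xN p q n i : HeckeB p q n)).prodMap
          (Algebra.lsmul F F (M ⧸ K₂) (xN p q n i : HeckeB p q n))
      have h1 : LinearMap.inl F (M ⧸ K₁) (M ⧸ K₂) z.1 ∈ genEig g a (Finset.Icc b n) :=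
        map_mem_genEig (fun i _ v => by simp [g]) z.1.2
      have h2 : LinearMap.inr F (M ⧸ K₁) (M ⧸ K₂) z.2 ∈ genEig g a (Finset.Icc b n) :=
        map_mem_genEig (fun i _ v => by simp [g]) z.2.2
      have h3 := add_mem h1 h2
      rw [LinearMap.inl_apply, LinearMap.inr_apply, Prod.mk_add_mk, add_zero, zero_add] at h3
      obtain ⟨v, hv, e⟩ := exists_mem_genEig_of_surjective hφ
        (f := fun i => Algebra.lsmul F F M (xN p q n i : HeckeB p q n)) (fun i _ v => rfl)
        (fun i j => (xN_val_comm i j).map _) h3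
      exact ⟨⟨v, hv⟩, e⟩
    rw [← Module.finrank_prod]
    refine LinearMap.finrank_le_finrank_of_injective (f := LinearMap.codRestrict _
      ((tailSpace p q n a (M ⧸ K₁) b).subtype.prodMap (tailSpace p q n a (M ⧸ K₂) b).subtype) hr)
      (fun x y hxy => ?_)
    have h1 := congrArg Subtype.val hxy
    exact Prod.ext (Subtype.ext (congrArg Prod.fst h1)) (Subtype.ext (congrArg Prod.snd h1))
  · have hk : ∀ x : (tailSpace p q n a M b ⊓ (K₁ ⊓ K₂).restrictScalars F : Submodule F M),
        (⟨x, x.2.1⟩ : tailSpace p q n a M b) ∈ LinearMap.ker f := fun x =>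
      Prod.ext ((Submodule.Quotient.mk_eq_zero _).2 x.2.2.1)
        ((Submodule.Quotient.mk_eq_zero _).2 x.2.2.2)
    refine LinearMap.finrank_le_finrank_of_injective (f := LinearMap.codRestrict _
      (Submodule.inclusion inf_le_left) hk) (fun x y hxy => ?_)
    have h1 := congrArg Subtype.val hxy
    have h2 := congrArg Subtype.val h1
    exact Subtype.ext h2

end Modules

/-! ### Lower bounds from copies of N ⊠ (a). -/

section Embeddings

variable {a : F} {N : Type*} [AddCommGroup N] [Module F N] [Module (HeckeB p q n) N]
  [IsScalarTower F (HeckeB p q n) N] {M : Type*} [AddCommGroup M] [Module F M]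
  [Module (HeckeB p q (n + 1)) M] [IsScalarTower F (HeckeB p q (n + 1)) M] {b : ℕ}

variable (p q n) in
/-- An `H_{n,1}`-equivariant map from `N ⊠ (a)` to the restriction of an `H_{n+1}`-module. -/
structure IsBoxMap (a : F) (j : N →ₗ[F] M) : Prop where
  map_incl : ∀ (h : HeckeB p q n) v, j (h • v) = incl p q n h • j v
  map_last : ∀ v, xN p q (n + 1) (n + 1) • j v = a • j v

theorem IsBoxMap.mem_tailSpace {j : N →ₗ[F] M} (hj : IsBoxMap p q n a j) {v : N}
    (hv : v ∈ tailSpace p q n a N b) : j v ∈ tailSpace p q (n + 1) a M b := by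
  rw [HeckeB.mem_tailSpace] at hv ⊢
  intro i hi hin
  rcases Nat.lt_or_ge n i with h | h
  · obtain rfl : i = n + 1 := by omega
    refine mem_maxGenEigenspace_of_sub_mem ?_
    have e := hj.map_last v
    have e' : Algebra.lsmul F F M (xN p q (n + 1) (n + 1) : HeckeB p q (n + 1)) (j v) -
        a • j v = 0 := sub_eq_zero.2 e
    rw [e']
    exact zero_mem _
  · have h1 := hv i hi h
    rw [Module.End.mem_maxGenEigenspace] at h1 ⊢
    obtain ⟨k, hk⟩ := h1
    refine ⟨k, ?_⟩
    rw [← map_sub_smul_one_pow (φ := j) (f := Algebra.lsmul F F N (xN p q n i : HeckeB p q n))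
      (fun v => ?_), hk, map_zero]
    rw [← incl_xN h]
    exact hj.map_incl _ v

variable [IsSimpleModule (HeckeB p q n) N]

omit [IsScalarTower F (HeckeB p q n) N] [IsScalarTower F (HeckeB p q (n + 1)) M] in
theorem IsBoxMap.injective {j : N →ₗ[F] M} (hj : IsBoxMap p q n a j) (h0 : j ≠ 0) :
    Function.Injective j := by
  rw [← LinearMap.ker_eq_bot, Submodule.eq_bot_iff]
  by_contra! h
  obtain ⟨v, hv, hv0⟩ := h
  refine h0 (LinearMap.ext fun w => ?_)
  refine eq_top_of_stable (p := p) (q := q) (n := n) (LinearMap.ker j) (fun h v hv => ?_)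
    ⟨v, hv, hv0⟩ w
  rw [LinearMap.mem_ker] at hv ⊢
  rw [hj.map_incl, hv, smul_zero]

variable [FiniteDimensional F N] [FiniteDimensional F M]

-- A nonzero box map embeds N, and X_{n+1} = a on the image: this is the eigenvector condition
-- required of the space U in `mul_finrank_le_finrank_tailSpace`.
omit [FiniteDimensional F N] in
theorem IsBoxMap.mul_finrank_le {j : N →ₗ[F] M} (hj : IsBoxMap p q n a j) (h0 : j ≠ 0)
    (hq : qc p q 1 ≠ 0) (ha : a ≠ 0) (hb : 1 ≤ b) (hbn : b ≤ n + 1) :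
    (n + 2 - b) * Module.finrank F (tailSpace p q n a N b) ≤
      Module.finrank F (tailSpace p q (n + 1) a M b) := by
  have h := mul_finrank_le_finrank_tailSpace (p := p) (q := q) hq ha hb hbn
    ((tailSpace p q n a N b).map j) ?_ ?_
  · rwa [LinearEquiv.finrank_eq (Submodule.equivMapOfInjective j (hj.injective h0) _).symm] at h
  · rintro _ ⟨v, hv, rfl⟩
    exact hj.mem_tailSpace hv
  · rintro _ ⟨v, _, rfl⟩
    exact hj.map_last v

omit [IsScalarTower F (HeckeB p q n) N] [FiniteDimensional F M] in
/-- Two box maps either are proportional or have independent images. -/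
theorem IsBoxMap.exists_smul_or_injective [IsAlgClosed F] {j j' : N →ₗ[F] M}
    (hj : IsBoxMap p q n a j) (hj' : IsBoxMap p q n a j') (h0 : j ≠ 0) :
    (∃ c : F, ∀ v, j' v = c • j v) ∨ Function.Injective (j.coprod j') := by
  rw [or_iff_not_imp_right, ← LinearMap.ker_eq_bot, Submodule.eq_bot_iff]
  intro h
  push Not at h
  obtain ⟨⟨v, w⟩, hvw, hne⟩ := h
  rw [LinearMap.mem_ker, LinearMap.coprod_apply] at hvw
  have hw : w ≠ 0 := by
    rintro rfl
    rw [map_zero, add_zero] at hvw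
    have hv : v = 0 := hj.injective h0 (hvw.trans (map_zero j).symm)
    exact hne (by rw [hv]; rfl)
  have hr : ∀ x, ∃ y, j y = j' x := by
    have hx := eq_top_of_stable (p := p) (q := q) (n := n) ((LinearMap.range j).comap j') ?_
      ⟨w, ⟨-v, by rw [map_neg, neg_eq_iff_add_eq_zero]; exact hvw⟩, hw⟩
    · exact fun x => hx x
    · rintro h x ⟨y, hy⟩
      exact ⟨h • y, by rw [hj.map_incl, hj'.map_incl, hy]⟩
  -- Schur's lemma: if the images meet, simplicity puts the second inside the first. On an
  -- eigenspace of α = j⁻¹ j' the map j' - cj vanishes, so by simplicity it vanishes everywhere.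
  let α : Module.End F N :=
    (LinearEquiv.ofInjective j (hj.injective h0)).symm.toLinearMap ∘ₗ
      j'.codRestrict (LinearMap.range j) hr
  have hα : ∀ x, j (α x) = j' x := fun x => by
    have := congrArg Subtype.val ((LinearEquiv.ofInjective j (hj.injective h0)).apply_symm_apply
      (j'.codRestrict (LinearMap.range j) hr x))
    exact this
  have : Nontrivial N := ⟨w, 0, hw⟩
  obtain ⟨c, hc⟩ := Module.End.exists_eigenvalue α
  obtain ⟨x, hx⟩ := hc.exists_hasEigenvector
  refine ⟨c, fun v => ?_⟩
  have := eq_top_of_stable (p := p) (q := q) (n := n) (LinearMap.ker (j' - c • j)) ?_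
    ⟨x, ?_, hx.2⟩ v
  · exact sub_eq_zero.1 this
  · intro h y hy
    have hy' : j' y = c • j y := sub_eq_zero.1 hy
    rw [LinearMap.mem_ker, LinearMap.sub_apply, LinearMap.smul_apply, hj.map_incl, hj'.map_incl,
      hy', smul_comm, sub_self]
  · rw [LinearMap.mem_ker, LinearMap.sub_apply, LinearMap.smul_apply, ← hα, hx.apply_eq_smul,
      map_smul, sub_self]

-- X_{n+1} is the scalar a on the sum of the two images, so the ladder argument applies to two
-- copies of N_b at once.
omit [IsSimpleModule (HeckeB p q n) N] in
theorem IsBoxMap.two_mul_finrank_le {j j' : N →ₗ[F] M}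
    (hj : IsBoxMap p q n a j) (hj' : IsBoxMap p q n a j') (hi : Function.Injective (j.coprod j'))
    (hq : qc p q 1 ≠ 0) (ha : a ≠ 0) (hb : 1 ≤ b) (hbn : b ≤ n + 1) :
    (n + 2 - b) * (2 * Module.finrank F (tailSpace p q n a N b)) ≤
      Module.finrank F (tailSpace p q (n + 1) a M b) := by
  let f := (j.coprod j') ∘ₗ
    ((tailSpace p q n a N b).subtype.prodMap (tailSpace p q n a N b).subtype)
  have hf : Function.Injective f := hi.comp
    (Function.Injective.prodMap Subtype.val_injective Subtype.val_injective)
  have h := mul_finrank_le_finrank_tailSpace (p := p) (q := q) hq ha hb hbn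
    (LinearMap.range f) ?_ ?_
  · rwa [LinearMap.finrank_range_of_inj hf, Module.finrank_prod, ← two_mul] at h
  · rintro _ ⟨v, rfl⟩
    exact add_mem (hj.mem_tailSpace v.1.2) (hj'.mem_tailSpace v.2.2)
  · rintro _ ⟨v, rfl⟩
    change xN p q (n + 1) (n + 1) • (j v.1 + j' v.2) = a • (j v.1 + j' v.2)
    rw [smul_add, hj.map_last, hj'.map_last, smul_add]

end Embeddings

/-! ### The dimension count. -/

section Main

variable {a : Fˣ} {N : Type*} [AddCommGroup N] [Module F N] [Module (HeckeB p q n) N]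
  [IsScalarTower F (HeckeB p q n) N]

theorem isBoxMap_toInd : IsBoxMap p q n (a : F) (toInd p q n a N) where
  map_incl h v := (incl_smul_toInd h v).symm
  map_last := xN_last_smul_toInd

omit [IsScalarTower F (HeckeB p q n) N] in
theorem IsBoxMap.comp {M M' : Type*} [AddCommGroup M] [Module F M]
    [Module (HeckeB p q (n + 1)) M] [IsScalarTower F (HeckeB p q (n + 1)) M] [AddCommGroup M']
    [Module F M'] [Module (HeckeB p q (n + 1)) M'] [IsScalarTower F (HeckeB p q (n + 1)) M']
    {c : F} {j : N →ₗ[F] M} (hj : IsBoxMap p q n c j) (f : M →ₗ[HeckeB p q (n + 1)] M') :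
    IsBoxMap p q n c (f.restrictScalars F ∘ₗ j) where
  map_incl h v := by
    change f (j (h • v)) = _ • f (j v)
    rw [hj.map_incl, map_smul]
  map_last v := by
    change _ • f (j v) = _ • f (j v)
    rw [Units.smul_def, ← map_smul, ← Units.smul_def, hj.map_last, LinearMap.map_smul_of_tower]

theorem mem_of_toInd_mem {K : Submodule (HeckeB p q (n + 1)) (fInd p q n a N)}
    (h : ∀ v, toInd p q n a N v ∈ K) (x : fInd p q n a N) : x ∈ K := by
  have h1 : filt (p := p) (q := q) (n := n) (LinearMap.range (toInd p q n a N)) (2 * n + 2) ≤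
      K.restrictScalars F := by
    refine filt_le_iff.2 ?_
    rintro l _ _ ⟨v, rfl⟩
    exact K.smul_mem _ (h v)
  rw [filt_toInd_top] at h1
  exact h1 Submodule.mem_top

theorem mkQ_toInd_ne_zero {K : Submodule (HeckeB p q (n + 1)) (fInd p q n a N)} (hK : K ≠ ⊤) :
    K.mkQ.restrictScalars F ∘ₗ toInd p q n a N ≠ 0 := by
  intro h
  refine hK (eq_top_iff.2 fun x _ => mem_of_toInd_mem (fun v => ?_) x)
  exact (Submodule.Quotient.mk_eq_zero _).1 (LinearMap.congr_fun h v)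

variable [FiniteDimensional F N] [hN : IsSimpleModule (HeckeB p q n) N]

omit [FiniteDimensional F N] in
variable (p q n a N) in
/-- The least index from which on the eigenvalue `a` occurs jointly on `N`. -/
theorem exists_tail_index : ∃ b, 1 ≤ b ∧ b ≤ n + 1 ∧ tailSpace p q n (a : F) N b ≠ ⊥ ∧
    (2 ≤ b → tailSpace p q n (a : F) N (b - 1) = ⊥) := by
  have : Nontrivial N := IsSimpleModule.nontrivial (HeckeB p q n) N
  have h : ∃ b, 1 ≤ b ∧ tailSpace p q n (a : F) N b ≠ ⊥ := by
    -- For b = n + 1 there is no condition on N, so the tail space is all of N.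
    refine ⟨n + 1, by omega, ?_⟩
    simp [tailSpace, genEig]
  classical
  refine ⟨Nat.find h, (Nat.find_spec h).1, Nat.find_min' h ⟨by omega, ?_⟩, (Nat.find_spec h).2,
    fun h2 => ?_⟩
  · simp [tailSpace, genEig]
  · have := Nat.find_min h (Nat.sub_one_lt (by omega : Nat.find h ≠ 0))
    by_contra hne
    exact this ⟨by omega, hne⟩

theorem isSimpleModule_cosocle_or_isCompl [IsAlgClosed F] (hq : qc p q 1 ≠ 0)
    (ha : (a : F)⁻¹ = a) :
    IsSimpleModule (HeckeB p q (n + 1)) (Cosocle (HeckeB p q (n + 1)) (fInd p q n a N)) ∨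
      ∃ M₁ M₂ : Submodule (HeckeB p q (n + 1)) (fInd p q n a N),
        IsCompl M₁ M₂ ∧ IsSimpleModule (HeckeB p q (n + 1)) M₁ ∧
          IsSimpleModule (HeckeB p q (n + 1)) M₂ ∧
          IsEmpty (M₁ ≃ₗ[HeckeB p q (n + 1)] M₂) := by
  have hfd := finiteDimensional_fInd (p := p) (q := q) (n := n) (a := a) (N := N)
  obtain ⟨b, hb, hbn, hV, hmin⟩ := exists_tail_index p q n a N
  have hup := finrank_tailSpace_fInd_le (p := p) (q := q) (a := a) (N := N) hb hbn hmin
  have hNt : Nontrivial N := IsSimpleModule.nontrivial (HeckeB p q n) N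
  have hnt : Nontrivial (fInd p q n a N) := by
    obtain ⟨v, hv⟩ := exists_ne (0 : N)
    refine ⟨toInd p q n a N v, 0, fun h0 => hv ?_⟩
    refine eq_zero_of_word_smul_toInd_mem (p := p) (q := q) (n := n) (a := a) (k := 0)
      (Nat.zero_le _) ?_
    rw [h0, smul_zero]
    exact zero_mem _
  have hnoeth : IsNoetherian (HeckeB p q (n + 1)) (fInd p q n a N) := isNoetherian_of_tower F
    inferInstance
  obtain ⟨K₁, hK₁, -⟩ := (eq_top_or_exists_le_coatom
    (⊥ : Submodule (HeckeB p q (n + 1)) (fInd p q n a N))).resolve_left bot_ne_top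
  by_cases huniq : ∀ L : Submodule (HeckeB p q (n + 1)) (fInd p q n a N), IsCoatom L → L = K₁
  · exact Or.inl (isSimpleModule_cosocle_of_unique_isCoatom hK₁ huniq)
  push Not at huniq
  obtain ⟨K₂, hK₂, hne⟩ := huniq
  right
  have hsup : K₁ ⊔ K₂ = ⊤ := hK₁.sup_eq_top_of_ne hK₂ hne.symm
  have hsum := finrank_tailSpace_quotient_add_le (a := (a : F)) (b := b) K₁ K₂ hsup
  have hj₁ := (isBoxMap_toInd (p := p) (q := q) (n := n) (a := a) (N := N)).comp K₁.mkQ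
  have hj₂ := (isBoxMap_toInd (p := p) (q := q) (n := n) (a := a) (N := N)).comp K₂.mkQ
  have hz₁ := mkQ_toInd_ne_zero hK₁.1
  have hz₂ := mkQ_toInd_ne_zero hK₂.1
  have hlow₁ := hj₁.mul_finrank_le hz₁ hq a.ne_zero hb hbn
  have hlow₂ := hj₂.mul_finrank_le hz₂ hq a.ne_zero hb hbn
  have hd : 0 < (n + 2 - b) * Module.finrank F (tailSpace p q n (a : F) N b) :=
    Nat.mul_pos (by omega) (Module.finrank_pos_iff.2 (Submodule.nontrivial_iff_ne_bot.2 hV))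
  rw [mul_assoc] at hup
  -- The two quotients use up the whole upper bound, so K₁ ∩ K₂ contains no vector of the tail
  -- space.
  have hinf : K₁ ⊓ K₂ = ⊥ := by
    by_contra hK
    obtain ⟨x, hxK, hxV, hx0⟩ := exists_mem_tailSpace ha hb hV hK
    have h0 : tailSpace p q (n + 1) (a : F) (fInd p q n a N) b ⊓
        (K₁ ⊓ K₂).restrictScalars F = ⊥ := Submodule.finrank_eq_zero.1 (by omega)
    have hx : x ∈ tailSpace p q (n + 1) (a : F) (fInd p q n a N) b ⊓
        (K₁ ⊓ K₂).restrictScalars F := ⟨hxV, hxK⟩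
    rw [h0] at hx
    exact hx0 hx
  have hc : IsCompl K₁ K₂ := ⟨disjoint_iff.2 hinf, codisjoint_iff.2 hsup⟩
  have e₁ := Submodule.quotientEquivOfIsCompl K₂ K₁ hc.symm
  have e₂ := Submodule.quotientEquivOfIsCompl K₁ K₂ hc
  have hs₁ : IsSimpleModule (HeckeB p q (n + 1)) (fInd p q n a N ⧸ K₁) :=
    isSimpleModule_iff_isCoatom.2 hK₁
  have hs₂ : IsSimpleModule (HeckeB p q (n + 1)) (fInd p q n a N ⧸ K₂) :=
    isSimpleModule_iff_isCoatom.2 hK₂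
  refine ⟨K₁, K₂, hc, IsSimpleModule.congr e₁.symm, IsSimpleModule.congr e₂.symm, ⟨fun e => ?_⟩⟩
  let θ : (fInd p q n a N ⧸ K₂) ≃ₗ[HeckeB p q (n + 1)] (fInd p q n a N ⧸ K₁) :=
    (e₁.trans e).trans e₂.symm
  have hj₃ := hj₂.comp θ.toLinearMap
  -- An isomorphism of the summands yields a second box map into M/K₁. If it is proportional to the
  -- first, then θ π₂ = c π₁ on the generators 1 ⊗ N and hence everywhere, so K₁ ≤ K₂, which is
  -- impossible for distinct maximal submodules.
  rcases hj₁.exists_smul_or_injective hj₃ hz₁ with ⟨c, hcv⟩ | hinj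
  · let ψ : fInd p q n a N →ₗ[F] fInd p q n a N ⧸ K₁ :=
      (θ.toLinearMap ∘ₗ K₂.mkQ).restrictScalars F - c • K₁.mkQ.restrictScalars F
    let L : Submodule (HeckeB p q (n + 1)) (fInd p q n a N) :=
      { LinearMap.ker ψ with
        smul_mem' := fun h x hx => by
          have hx' : θ (K₂.mkQ x) - c • K₁.mkQ x = 0 := hx
          change θ (K₂.mkQ (h • x)) - c • K₁.mkQ (h • x) = 0
          rw [map_smul, map_smul, map_smul, smul_comm c, ← smul_sub, hx', smul_zero] }
    have hL : ∀ x, θ (K₂.mkQ x) = c • K₁.mkQ x := fun x =>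
      sub_eq_zero.1 (mem_of_toInd_mem (K := L) (fun v => sub_eq_zero.2 (hcv v)) x)
    have hle : K₁ ≤ K₂ := by
      intro x hx
      have h1 := hL x
      have h2 : K₁.mkQ x = 0 := (Submodule.Quotient.mk_eq_zero _).2 hx
      rw [h2, smul_zero, LinearEquiv.map_eq_zero_iff] at h1
      exact (Submodule.Quotient.mk_eq_zero _).1 h1
    rcases hK₁.le_iff.1 hle with h | h
    · exact hK₂.1 h
    · exact hne h
  -- Otherwise M/K₁ needs 2md dimensions and M/K₂ another md > 0, more than the upper bound 2md.
  · have h := hj₁.two_mul_finrank_le hj₃ hinj hq a.ne_zero hb hbn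
    rw [Nat.mul_left_comm] at h
    omega

end Main
end HeckeB

theorem mainTheorem9 {F : Type*} [Field F] [IsAlgClosed F] (hF : ringChar F ≠ 2)
    (p q : Fˣ) (hp : ∀ k : ℕ, 0 < k → p ^ k ≠ 1) (hq : ∀ k : ℕ, 0 < k → q ^ k ≠ 1)
    (n : ℕ) (N : Type*) [AddCommGroup N] [Module F N] [Module (HeckeB p q n) N]
    [IsScalarTower F (HeckeB p q n) N] [FiniteDimensional F N]
    (hN : IsSimpleModule (HeckeB p q n) N)
    (hτ : Nonempty (N ≃ₗ[HeckeB p q n] TauDual p q n N))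
    (a : Fˣ) (ha : a = 1 ∨ a = -1) :
    IsSimpleModule (HeckeB p q (n + 1)) (Cosocle (HeckeB p q (n + 1)) (fInd p q n a N)) ∨
      ∃ M₁ M₂ : Submodule (HeckeB p q (n + 1)) (fInd p q n a N),
        IsCompl M₁ M₂ ∧ IsSimpleModule (HeckeB p q (n + 1)) M₁ ∧
          IsSimpleModule (HeckeB p q (n + 1)) M₂ ∧
          IsEmpty (M₁ ≃ₗ[HeckeB p q (n + 1)] M₂) := by
  refine HeckeB.isSimpleModule_cosocle_or_isCompl (HeckeB.qc_one_ne_zero hq) ?_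
  rcases ha with rfl | rfl <;> simp
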